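/- Let $\mathbb{F}_q$ be the field with $q$ elements, and let $K$ be a field containing $\mathbb{F}_q$ that is complete with respect to a nontrivial nonarchimedean absolute value $|\cdot|$, with valuation ring $\mathcal{O}_K$, maximal ideal $\mathfrak{m}_K$ and residue field $k=\mathcal{O}_K/\mathfrak{m}_K$. Fix an element $\zeta\in\mathcal{O}_K$ with $0<|\zeta|<1$ and a ring homomorphism $k\hookrightarrow\mathcal{O}_K$ that is a section of the residue map. On each of the rings $\mathcal{O}_K[[z]]$, $k((z))$, $\mathcal{O}_K[[z,z^{-1}\}$ below, $\sigma$ denotes the endomorphism with $\sigma(z)=z$ that acts on coefficients by $b\mapsto b^q$, and $\sigma^*$ denotes base change along $\sigma$. *Local shtukas.* A local shtuka over $\mathcal{O}_K$ is a finite free $\mathcal{O}_K[[z]]$-module $M$ with an isomorphism $F_M:\sigma^*M[\frac1{z-\zeta}]\to M[\frac1{z-\zeta}]$ such that for some integer $e$ one has $F_M(\sigma^*M)\subset(z-\zeta)^{-e}M$ and $(z-\zeta)^{-e}M/F_M(\sigma^*M)$ is finite free over $\mathcal{O}_K$. A morphism $f:M\to M'$ is an $\mathcal{O}_K[[z]]$-linear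 map with $F_{M'}\circ\sigma^*f=f\circ F_M$. Put $(D,F_D)=(M,F_M)\otimes_{\mathcal{O}_K[[z]]}k((z))$. *Rigidifications.* Let $$\mathcal{O}_K[[z,z^{-1}\}=\Bigl\{\sum_{i\in\mathbb{Z}}b_iz^i:\ b_i\in\mathcal{O}_K,\ |b_i\zeta^{ri}|\to0\ (i\to-\infty)\text{ for all } r>0\Bigr\},\qquad t=\prod_{i\ge0}\Bigl(1-\frac{\zeta^{q^i}}{z}\Bigr).$$ It contains $k((z))$ via the section. A rigidified local shtuka is a triple $(M,F_M,\delta_M)$ in which $(M,F_M)$ is a local shtuka over $\mathcal{O}_K$ and $$\delta_M: M\otimes_{\mathcal{O}_K[[z]]}\mathcal{O}_K[[z,z^{-1}\}[t^{-1}]\ \to\ D\otimes_{k((z))}\mathcal{O}_K[[z,z^{-1}\}[t^{-1}]$$ is an isomorphism with $\delta_M\circ F_M=F_D\circ\sigma^*\delta_M$ that reduces to the identity of $D$ modulo $\mathfrak{m}_K$. A morphism of rigidified local shtukas is a morphism $f$ of local shtukas with $\delta_{M'}\circ f=(f\bmod\mathfrak{m}_K)\circ\delta_M$. It is an isogeny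 if there is a morphism $g$ in the opposite direction such that $f\circ g$ and $g\circ f$ are multiplication by a power of $z$. The category of rigidified local shtukas up to isogeny is obtained by formally inverting the isogenies. *Hodge-Pink structures.* A $z$-isocrystal with Hodge-Pink structure over $K$ is a triple $(D,F_D,\mathfrak{q})$ consisting of a finite-dimensional $k((z))$-vector space $D$, an isomorphism $F_D:\sigma^*D\to D$, and a $K[[z-\zeta]]$-lattice $\mathfrak{q}$ of full rank in $\sigma^*D\otimes_{k((z))}K((z-\zeta))$, where $k((z))\to K[[z-\zeta]]$ is the section on $k$ and maps $z$ to $\zeta+(z-\zeta)$. A morphism $(D,F_D,\mathfrak{q})\to(D',F_{D'},\mathfrak{q}')$ is a $k((z))$-linear map $f:D\to D'$ with $F_{D'}\circ\sigma^*f=f\circ F_D$ and $(\sigma^*f\otimes\mathrm{id})(\mathfrak{q})\subset\mathfrak{q}'$. *The functor $\mathbb{H}$.* To $(M,F_M,\delta_M)$ it assigns $(D,F_D)=(M,F_M)\otimes k((z))$ with the lattice $\mathfrak{q}=\sigma^*\delta_M\circ F_M^{-1}\bigl(M\otimes_{\mathcal{O}_K[[z]]}K[[z-\zeta]]\bigr)$,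 where $\sigma^*\delta_M$ and $F_M$ are extended to $K((z-\zeta))$ (this is possible since $\sigma(t)$ does not vanish at $z=\zeta$). To a morphism $f$ it assigns $f\bmod\mathfrak{m}_K$. It maps isogenies to isomorphisms. **Proposition.** The functor induced by $\mathbb{H}$ from the category of rigidified local shtukas over $\mathcal{O}_K$ up to isogeny to the category of $z$-isocrystals with Hodge-Pink structure over $K$ is fully faithful. -/

import Mathlib

open Filter Topology

universe u v

noncomputable section

namespace HodgePink

/-- The valuation ring `O_K` of a nonarchimedean normed field `K`. -/
abbrev OK (K : Type u) [NormedField K] [IsUltrametricDist K] : ValuationSubring K :=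
  (NormedField.valuation (K := K)).valuationSubring

/-- The residue field `k` of `O_K`. -/
abbrev ResField (K : Type u) [NormedField K] [IsUltrametricDist K] : Type u :=
  IsLocalRing.ResidueField (OK K)

/-- The base data: an element `ζ` of the valuation ring with `0 < |ζ| < 1`, and a ring-theoretic
section of the residue map `O_K → k`. -/
structure Base (F : Type v) (K : Type u) [Field F] [Fintype F] [NormedField K]
    [IsUltrametricDist K] [Algebra F (OK K)] where
  ζ : OK K
  ζ_ne_zero : ζ ≠ 0
  norm_ζ_lt_one : ‖(ζ : K)‖ < 1
  sec : ResField K →+* OK K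
  residue_sec : ∀ x, IsLocalRing.residue (OK K) (sec x) = x

section Norms

variable {K : Type u} [NormedField K] [IsUltrametricDist K]

lemma mem_OK {x : K} : x ∈ OK K ↔ ‖x‖ ≤ 1 := by
  simp [OK, Valuation.mem_valuationSubring_iff, ← NNReal.coe_le_coe]

lemma norm_le_one (x : OK K) : ‖x‖ ≤ 1 := mem_OK.1 x.2

lemma norm_mul' (x y : OK K) : ‖x * y‖ = ‖x‖ * ‖y‖ := norm_mul (x : K) y

lemma norm_pow' (x : OK K) (n : ℕ) : ‖x ^ n‖ = ‖x‖ ^ n := norm_pow (x : K) n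

instance [CompleteSpace K] : CompleteSpace (OK K) := by
  have : IsClosed {x : K | ‖x‖ ≤ 1} := isClosed_le continuous_norm continuous_const
  have h : ((OK K : Set K)) = {x : K | ‖x‖ ≤ 1} := by
    ext x
    exact mem_OK
  exact (h ▸ this).completeSpace_coe

instance : NonarchimedeanRing (OK K) :=
  ⟨IsUltrametricDist.nonarchimedeanAddGroup.is_nonarchimedean⟩

lemma nonarchRing : NonarchimedeanRing K :=
  ⟨IsUltrametricDist.nonarchimedeanAddGroup.is_nonarchimedean⟩

lemma residue_eq_zero {x : OK K} : IsLocalRing.residue (OK K) x = 0 ↔ ‖x‖ < 1 := by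
  rw [IsLocalRing.residue_eq_zero_iff, IsLocalRing.mem_maximalIdeal, mem_nonunits_iff,
    ← not_le, not_iff_not]
  constructor
  · rintro ⟨u, rfl⟩
    have h : ‖(u : OK K)‖ * ‖((u⁻¹ : (OK K)ˣ) : OK K)‖ = 1 := by
      rw [← norm_mul', ← Units.val_mul, mul_inv_cancel]
      exact norm_one (α := K)
    rw [← h]
    exact mul_le_of_le_one_right (norm_nonneg _) (norm_le_one _)
  · intro h
    have h0 : (x : K) ≠ 0 := fun h0 => by
      have : ‖x‖ = ‖(x : K)‖ := rfl
      rw [this, h0, norm_zero] at h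
      linarith
    have h1 : (x : K)⁻¹ ∈ OK K := mem_OK.2 (by rw [norm_inv]; exact inv_le_one_of_one_le₀ h)
    exact IsUnit.of_mul_eq_one ⟨_, h1⟩ (Subtype.ext (mul_inv_cancel₀ h0))

lemma residue_tsum {f : ℤ → OK K} (hf : Summable f) (s : Finset ℤ)
    (hs : ∀ i ∉ s, IsLocalRing.residue (OK K) (f i) = 0) :
    IsLocalRing.residue (OK K) (∑' i, f i) = ∑ i ∈ s, IsLocalRing.residue (OK K) (f i) := by
  classical
  rw [← map_sum, ← sub_eq_zero, ← map_sub, residue_eq_zero]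
  have h1 : Tendsto (fun t : Finset ℤ => ∑ i ∈ t, f i - ∑ i ∈ s, f i) atTop
      (𝓝 (∑' i, f i - ∑ i ∈ s, f i)) := hf.hasSum.sub_const _
  have h2 : IsClosed (Metric.ball (0 : OK K) 1) := IsUltrametricDist.isClosed_ball _ _
  have h3 : ∑' i, f i - ∑ i ∈ s, f i ∈ Metric.ball (0 : OK K) 1 := by
    refine h2.mem_of_tendsto h1 ?_
    filter_upwards [eventually_ge_atTop s] with t ht
    rw [mem_ball_zero_iff, ← Finset.sum_sdiff ht, add_sub_cancel_right, ← residue_eq_zero, map_sum]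
    refine Finset.sum_eq_zero fun i hi => hs i (Finset.mem_sdiff.1 hi).2
  simpa using h3

end Norms

variable {F : Type v} {K : Type u} [Field F] [Fintype F] [NormedField K] [IsUltrametricDist K]
  [Algebra F (OK K)]

lemma Base.norm_pos (P : Base F K) : 0 < ‖(P.ζ : K)‖ :=
  norm_pos_iff.2 fun h => P.ζ_ne_zero (Subtype.ext h)

/-- The `q`-Frobenius `b ↦ b ^ q` of an `𝔽_q`-algebra. -/
def frob (F : Type v) [Field F] [Fintype F] (R : Type u) [CommRing R] [Algebra F R] : R →+* R :=
  (FiniteField.frobeniusAlgHom F R : R →+* R)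

lemma frob_apply {R : Type u} [CommRing R] [Algebra F R] (x : R) :
    frob F R x = x ^ Fintype.card F := rfl

/-- Elements of `O_K[[z, z⁻¹}`: bilateral series `∑ b_i z^i` with coefficients in `O_K` such that
`|b_i ζ^{r i}| → 0` for `i → -∞`, for all `r > 0`. -/
@[ext]
structure Annulus (P : Base F K) where
  coeff : ℤ → OK K
  decay : ∀ r : ℝ, 0 < r →
    Tendsto (fun i : ℤ => ‖(coeff i : K)‖ * ‖(P.ζ : K)‖ ^ (r * i)) atBot (𝓝 0)

namespace Annulus

variable {P : Base F K}

lemma decay_iff {b : ℤ → OK K} :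
    (∀ r : ℝ, 0 < r → Tendsto (fun i : ℤ => ‖(b i : K)‖ * ‖(P.ζ : K)‖ ^ (r * i)) atBot (𝓝 0)) ↔
    ∀ r : ℝ, 0 < r → ∀ ε : ℝ, 0 < ε → ∀ᶠ i : ℤ in atBot, ‖b i‖ * ‖(P.ζ : K)‖ ^ (r * i) ≤ ε := by
  have h0 : ∀ (r : ℝ) (i : ℤ), 0 ≤ ‖(b i : K)‖ * ‖(P.ζ : K)‖ ^ (r * i) := fun r i => by positivity
  constructor
  · intro h r hr ε hε
    filter_upwards [(h r hr).eventually_lt_const hε] with i hi using hi.le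
  · intro h r hr
    rw [Metric.tendsto_nhds]
    intro ε hε
    filter_upwards [h r hr (ε / 2) (by positivity)] with i hi
    rw [Real.dist_0_eq_abs, abs_of_nonneg (h0 r i)]
    exact lt_of_le_of_lt hi (by linarith)

lemma tendsto_atBot (a : Annulus P) : Tendsto (fun i => ‖a.coeff i‖) atBot (𝓝 0) := by
  refine squeeze_zero' (.of_forall fun _ => norm_nonneg _) ?_ (a.decay 1 one_pos)
  filter_upwards [eventually_le_atBot 0] with i hi
  refine le_mul_of_one_le_right (norm_nonneg _) ?_
  refine Real.one_le_rpow_of_pos_of_le_one_of_nonpos P.norm_pos P.norm_ζ_lt_one.le ?_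
  simpa using hi

instance : Zero (Annulus P) := ⟨⟨0, fun r _ => by simp⟩⟩

instance : Add (Annulus P) := ⟨fun a b => ⟨a.coeff + b.coeff, decay_iff.2 fun r hr ε hε => by
  filter_upwards [decay_iff.1 a.decay r hr ε hε, decay_iff.1 b.decay r hr ε hε] with i h1 h2
  have h3 : ‖(a.coeff + b.coeff) i‖ ≤ max ‖a.coeff i‖ ‖b.coeff i‖ :=
    IsUltrametricDist.norm_add_le_max _ _
  rcases le_max_iff.1 h3 with h | h
  · exact (mul_le_mul_of_nonneg_right h (by positivity)).trans h1
  · exact (mul_le_mul_of_nonneg_right h (by positivity)).trans h2⟩⟩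

instance : Neg (Annulus P) := ⟨fun a => ⟨-a.coeff, fun r hr => by simpa using a.decay r hr⟩⟩

/-- The monomial `x z^d`. -/
def mono (d : ℤ) (x : OK K) : Annulus P := ⟨Pi.single d x, fun r _ => by
  refine tendsto_const_nhds.congr' ?_
  filter_upwards [eventually_lt_atBot d] with i hi
  simp [hi.ne]⟩

instance : One (Annulus P) := ⟨mono 0 1⟩

@[simp] lemma coeff_zero (i : ℤ) : (0 : Annulus P).coeff i = 0 := rfl
@[simp] lemma coeff_add (a b : Annulus P) (i : ℤ) : (a + b).coeff i = a.coeff i + b.coeff i := rfl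
@[simp] lemma coeff_neg (a : Annulus P) (i : ℤ) : (-a).coeff i = -a.coeff i := rfl
lemma coeff_mono (d : ℤ) (x : OK K) (i : ℤ) :
    (mono d x : Annulus P).coeff i = if i = d then x else 0 := by
  simp [mono, Pi.single_apply]
lemma coeff_one (i : ℤ) : (1 : Annulus P).coeff i = if i = 0 then 1 else 0 := coeff_mono 0 1 i

instance : AddCommGroup (Annulus P) where
  add_assoc a b c := by ext; simp [add_assoc]
  zero_add a := by ext; simp
  add_zero a := by ext; simp
  add_comm a b := by ext; simp [add_comm]
  neg_add_cancel a := by ext; simp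
  nsmul := nsmulRec
  zsmul := zsmulRec

@[simp] lemma coeff_sub (a b : Annulus P) (i : ℤ) : (a - b).coeff i = a.coeff i - b.coeff i := by
  rw [sub_eq_add_neg, coeff_add, coeff_neg, sub_eq_add_neg]

lemma decay_mul (a b : Annulus P) : ∀ r : ℝ, 0 < r →
    Tendsto (fun n : ℤ => ‖((∑' i, a.coeff i * b.coeff (n - i) : OK K) : K)‖ *
      ‖(P.ζ : K)‖ ^ (r * n)) atBot (𝓝 0) := by
  refine decay_iff.2 fun r hr ε hε => ?_
  have h2r : 0 < 2 * r := by positivity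
  obtain ⟨N, hN⟩ := eventually_atBot.1 ((decay_iff.1 a.decay _ h2r ε hε).and
    (decay_iff.1 b.decay _ h2r ε hε))
  filter_upwards [eventually_le_atBot (2 * N)] with n hn
  have hpos : 0 < ‖(P.ζ : K)‖ ^ (r * n) := Real.rpow_pos_of_pos P.norm_pos _
  rw [← le_div_iff₀ hpos]
  refine IsUltrametricDist.norm_tsum_le_of_forall_le fun i => ?_
  rw [le_div_iff₀ hpos, norm_mul']
  have key : ∀ j : ℤ, 2 * j ≤ n → ‖(P.ζ : K)‖ ^ (r * n) ≤ ‖(P.ζ : K)‖ ^ (2 * r * j) := by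
    intro j hj
    refine Real.rpow_le_rpow_of_exponent_ge P.norm_pos P.norm_ζ_lt_one.le ?_
    have : (2 * j : ℝ) ≤ n := by exact_mod_cast hj
    nlinarith
  rcases le_total (2 * i) n with h | h
  · refine le_trans ?_ (hN i (by omega)).1
    refine mul_le_mul (mul_le_of_le_one_right (norm_nonneg _) (norm_le_one _)) (key i h)
      hpos.le (norm_nonneg _)
  · refine le_trans ?_ (hN (n - i) (by omega)).2
    refine mul_le_mul (mul_le_of_le_one_left (norm_nonneg _) (norm_le_one _))
      (key (n - i) (by omega)) hpos.le (norm_nonneg _)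

variable [CompleteSpace K]

lemma summable_of_le {f : ℤ → OK K} {g h : ℤ → ℝ} (hg : Tendsto g atBot (𝓝 0))
    (hh : Tendsto h atTop (𝓝 0)) (h1 : ∀ i, ‖f i‖ ≤ g i) (h2 : ∀ i, ‖f i‖ ≤ h i) : Summable f := by
  refine NonarchimedeanAddGroup.summable_of_tendsto_cofinite_zero ?_
  rw [Int.cofinite_eq, tendsto_sup]
  exact ⟨squeeze_zero_norm h1 hg, squeeze_zero_norm h2 hh⟩

lemma tendsto_sub_atTop (n : ℤ) : Tendsto (fun i : ℤ => n - i) atTop atBot := by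
  simpa [sub_eq_add_neg] using tendsto_atBot_add_const_left atTop n tendsto_neg_atTop_atBot

lemma summable_mul (a b : Annulus P) (n : ℤ) :
    Summable fun i => a.coeff i * b.coeff (n - i) := by
  refine summable_of_le a.tendsto_atBot (b.tendsto_atBot.comp (tendsto_sub_atTop n)) ?_ ?_
  · intro i
    rw [norm_mul']
    exact mul_le_of_le_one_right (norm_nonneg _) (norm_le_one _)
  · intro i
    rw [norm_mul']
    exact mul_le_of_le_one_left (norm_nonneg _) (norm_le_one _)

/-- Multiplication is the Cauchy product `(a b)_n = ∑_i a_i b_{n-i}` (a convergent sum). -/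
instance : Mul (Annulus P) :=
  ⟨fun a b => ⟨fun n => ∑' i, a.coeff i * b.coeff (n - i), decay_mul a b⟩⟩

lemma coeff_mul (a b : Annulus P) (n : ℤ) :
    (a * b).coeff n = ∑' i, a.coeff i * b.coeff (n - i) := rfl

lemma mul_comm' (a b : Annulus P) : a * b = b * a := by
  ext n
  rw [coeff_mul, coeff_mul, ← (Equiv.subLeft n).tsum_eq]
  congr 2
  ext i
  simp [mul_comm]

lemma coeff_mul_mono (a : Annulus P) (d : ℤ) (x : OK K) (n : ℤ) :
    (a * mono d x).coeff n = a.coeff (n - d) * x := by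
  rw [coeff_mul, tsum_eq_single (n - d)]
  · simp [coeff_mono]
  · intro i hi
    rw [coeff_mono, if_neg, mul_zero]
    intro h
    exact hi (by omega)

lemma summable_assoc (a b c : Annulus P) (n : ℤ) :
    Summable (Function.uncurry fun i j : ℤ => a.coeff i * b.coeff (j - i) * c.coeff (n - j)) := by
  refine NonarchimedeanAddGroup.summable_of_tendsto_cofinite_zero ?_
  rw [tendsto_zero_iff_norm_tendsto_zero, Metric.tendsto_nhds]
  intro ε hε
  have h (x : Annulus P) : ∃ N : ℤ, ∀ i ≤ N, ‖x.coeff i‖ < ε :=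
    eventually_atBot.1 (x.tendsto_atBot.eventually_lt_const hε)
  obtain ⟨A, hA⟩ := h a
  obtain ⟨B, hB⟩ := h b
  obtain ⟨C, hC⟩ := h c
  rw [eventually_cofinite]
  refine ((Set.finite_Icc A (n - C - B)).prod (Set.finite_Icc (A + B) (n - C))).subset ?_
  rintro ⟨i, j⟩ hij
  simp only [Function.uncurry, dist_zero_right, not_lt, Set.mem_ofPred_eq, norm_mul'] at hij
  rw [Real.norm_of_nonneg (by positivity)] at hij
  have ha := norm_le_one (a.coeff i)
  have hb := norm_le_one (b.coeff (j - i))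
  have hc := norm_le_one (c.coeff (n - j))
  have ha' := norm_nonneg (a.coeff i)
  have hb' := norm_nonneg (b.coeff (j - i))
  have hc' := norm_nonneg (c.coeff (n - j))
  have hab := mul_le_one₀ ha hb' hb
  have h1 : A < i := by
    by_contra! hi
    have := hA i hi
    have : ‖a.coeff i‖ * ‖b.coeff (j - i)‖ * ‖c.coeff (n - j)‖ ≤ ‖a.coeff i‖ := by
      rw [mul_assoc]
      exact mul_le_of_le_one_right ha' (mul_le_one₀ hb hc' hc)
    linarith
  have h2 : B < j - i := by
    by_contra! hi
    have := hB _ hi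
    have : ‖a.coeff i‖ * ‖b.coeff (j - i)‖ * ‖c.coeff (n - j)‖ ≤ ‖b.coeff (j - i)‖ := by
      rw [mul_comm ‖a.coeff i‖, mul_assoc]
      exact mul_le_of_le_one_right hb' (mul_le_one₀ ha hc' hc)
    linarith
  have h3 : C < n - j := by
    by_contra! hi
    have := hC _ hi
    have : ‖a.coeff i‖ * ‖b.coeff (j - i)‖ * ‖c.coeff (n - j)‖ ≤ ‖c.coeff (n - j)‖ :=
      mul_le_of_le_one_left hc' hab
    linarith
  simp only [Set.mem_prod, Set.mem_Icc]
  omega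

lemma mul_assoc' (a b c : Annulus P) : a * b * c = a * (b * c) := by
  ext n : 2
  have hs := summable_assoc a b c n
  calc ∑' j, (∑' i, a.coeff i * b.coeff (j - i)) * c.coeff (n - j)
      = ∑' j, ∑' i, a.coeff i * b.coeff (j - i) * c.coeff (n - j) := by
        congr 1; ext1 j
        rw [(summable_mul a b j).tsum_mul_right]
    _ = ∑' i, ∑' j, a.coeff i * b.coeff (j - i) * c.coeff (n - j) := hs.tsum_comm
    _ = ∑' i, a.coeff i * ∑' j, b.coeff j * c.coeff (n - i - j) := by
        congr 1; ext1 i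
        rw [← (Equiv.addRight i).tsum_eq, ← (summable_mul b c (n - i)).tsum_mul_left]
        congr 1; ext1 j
        simp [mul_assoc, sub_sub, add_comm]

instance : CommRing (Annulus P) where
  left_distrib a b c := by
    ext n : 2
    simp only [coeff_mul, coeff_add, mul_add]
    exact (summable_mul a b n).tsum_add (summable_mul a c n)
  right_distrib a b c := by
    ext n : 2
    simp only [coeff_mul, coeff_add, add_mul]
    exact (summable_mul a c n).tsum_add (summable_mul b c n)
  zero_mul a := by ext n; simp [coeff_mul]
  mul_zero a := by ext n; simp [coeff_mul]
  mul_assoc := mul_assoc'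
  one_mul a := by
    rw [mul_comm']
    ext n
    exact congrArg Subtype.val ((coeff_mul_mono a 0 1 n).trans (by simp))
  mul_one a := by
    ext n
    exact congrArg Subtype.val ((coeff_mul_mono a 0 1 n).trans (by simp))
  mul_comm := mul_comm'
  neg_add_cancel := neg_add_cancel
  zsmul := zsmulRec
  nsmul := nsmulRec

lemma mono_mul_mono (d e : ℤ) (x y : OK K) :
    (mono d x : Annulus P) * mono e y = mono (d + e) (x * y) := by
  ext n : 2
  rw [coeff_mul_mono, coeff_mono, coeff_mono, ite_mul, zero_mul]
  simp only [sub_eq_iff_eq_add]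

/-- The `q`-Frobenius `σ` of `O_K[[z, z⁻¹}`: the identity on `z` and `b ↦ b ^ q` on `O_K`. -/
def σ : Annulus P →+* Annulus P where
  toFun a := ⟨fun i => frob F (OK K) (a.coeff i), fun r hr => by
    refine squeeze_zero' (.of_forall fun _ => by positivity) (.of_forall fun i => ?_)
      (a.decay r hr)
    refine mul_le_mul_of_nonneg_right ?_ (by positivity)
    have h : ‖frob F (OK K) (a.coeff i)‖ ≤ ‖a.coeff i‖ := by
      rw [frob_apply, norm_pow']
      exact pow_le_of_le_one (norm_nonneg _) (norm_le_one _) Fintype.card_ne_zero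
    exact h⟩
  map_zero' := by ext i : 2; exact map_zero (frob F (OK K))
  map_add' a b := by ext i : 2; exact map_add (frob F (OK K)) _ _
  map_one' := by
    ext i : 2
    simp only [coeff_one]
    split_ifs <;> simp
  map_mul' a b := by
    ext n : 2
    have hc : Continuous (frob F (OK K)) := continuous_pow (Fintype.card F)
    have h := (summable_mul a b n).hasSum.map (frob F (OK K)) hc
    exact h.tsum_eq.symm.trans (by simp [coeff_mul])

@[simp] lemma coeff_σ (a : Annulus P) (i : ℤ) : (σ a).coeff i = a.coeff i ^ Fintype.card F := rfl

lemma σ_mono (d : ℤ) (x : OK K) :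
    σ (mono d x : Annulus P) = mono d (x ^ Fintype.card F) := by
  ext i : 2
  rw [coeff_σ, coeff_mono, coeff_mono]
  split_ifs <;> simp

/-- The inclusion `O_K((z)) → O_K[[z, z⁻¹}`. -/
def ofLaurent : LaurentSeries (OK K) →+* Annulus P where
  toFun f := ⟨f.coeff, fun r _ => by
    refine tendsto_const_nhds.congr' ?_
    filter_upwards [eventually_lt_atBot f.order] with i hi
    simp [HahnSeries.coeff_eq_zero_of_lt_order hi]⟩
  map_zero' := by ext i : 2; simp
  map_add' f g := by ext i : 2; simp
  map_one' := by ext i : 2; simp [coeff_one, HahnSeries.coeff_one]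
  map_mul' f g := by
    classical
    ext n : 2
    rw [coeff_mul]
    simp only [HahnSeries.coeff_mul]
    rw [tsum_eq_sum (s := (Finset.antidiagonal f.isPWO_support g.isPWO_support n).image
      Prod.fst)]
    · rw [Finset.sum_image]
      · refine Finset.sum_congr rfl fun ij hij => ?_
        rw [Finset.mem_antidiagonal] at hij
        rw [← hij.2.2, add_sub_cancel_left]
      · intro x hx y hy hxy
        simp only [Finset.mem_coe, Finset.mem_antidiagonal] at hx hy
        exact Prod.ext hxy (by omega)
    · intro i hi
      by_contra h
      refine hi (Finset.mem_image.2 ⟨(i, n - i), ?_, rfl⟩)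
      rw [Finset.mem_antidiagonal]
      exact ⟨left_ne_zero_of_mul h, right_ne_zero_of_mul h, by simp⟩

@[simp] lemma coeff_ofLaurent (f : LaurentSeries (OK K)) (i : ℤ) :
    (ofLaurent f : Annulus P).coeff i = f.coeff i := rfl

lemma bddBelow_residue (a : Annulus P) :
    BddBelow (Function.support fun i => IsLocalRing.residue (OK K) (a.coeff i)) := by
  obtain ⟨N, hN⟩ := eventually_atBot.1 (a.tendsto_atBot.eventually_lt_const one_pos)
  refine ⟨N, fun i hi => ?_⟩
  by_contra! h
  exact hi (residue_eq_zero.2 (hN i h.le))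

/-- Reduction of the coefficients modulo the maximal ideal, `O_K[[z, z⁻¹} → k((z))`. -/
def red : Annulus P →+* LaurentSeries (ResField K) where
  toFun a := HahnSeries.ofSuppBddBelow (fun i => IsLocalRing.residue (OK K) (a.coeff i))
    (bddBelow_residue a)
  map_zero' := by ext i; simp
  map_add' a b := by ext i; simp
  map_one' := by
    ext i
    simp only [HahnSeries.ofSuppBddBelow_coeff, coeff_one, HahnSeries.coeff_one]
    split_ifs <;> simp
  map_mul' a b := by
    classical
    ext n
    simp only [HahnSeries.ofSuppBddBelow_coeff, HahnSeries.coeff_mul, coeff_mul]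
    rw [residue_tsum (summable_mul a b n) ((Finset.antidiagonal
      (HahnSeries.isPWO_support (HahnSeries.ofSuppBddBelow _ (bddBelow_residue a)))
      (HahnSeries.isPWO_support (HahnSeries.ofSuppBddBelow _ (bddBelow_residue b))) n).image
      Prod.fst)]
    · rw [Finset.sum_image]
      · refine Finset.sum_congr rfl fun ij hij => ?_
        rw [Finset.mem_antidiagonal] at hij
        rw [← hij.2.2, add_sub_cancel_left, map_mul]
      · intro x hx y hy hxy
        simp only [Finset.mem_coe, Finset.mem_antidiagonal] at hx hy
        exact Prod.ext hxy (by omega)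
    · intro i hi
      by_contra h
      rw [map_mul] at h
      refine hi (Finset.mem_image.2 ⟨(i, n - i), ?_, rfl⟩)
      rw [Finset.mem_antidiagonal]
      exact ⟨left_ne_zero_of_mul h, right_ne_zero_of_mul h, by simp⟩

@[simp] lemma coeff_red (a : Annulus P) (i : ℤ) :
    (red a).coeff i = IsLocalRing.residue (OK K) (a.coeff i) := rfl

/-! ### Expansion at `z = ζ` -/

/-- `z = ζ + (z - ζ)`, as a unit of `K[[z - ζ]]`. -/
def zUnit (P : Base F K) : (PowerSeries K)ˣ :=
  IsUnit.unit (a := PowerSeries.C (P.ζ : K) + PowerSeries.X) <| by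
    rw [PowerSeries.isUnit_iff_constantCoeff]
    simpa using fun h => P.ζ_ne_zero (Subtype.ext h)

lemma val_zUnit : (zUnit P : PowerSeries K) = PowerSeries.C (P.ζ : K) + PowerSeries.X := rfl

lemma norm_coeff_zUnit (j : ℕ) :
    ‖PowerSeries.coeff j (zUnit P : PowerSeries K)‖ ≤ ‖(P.ζ : K)‖ * ‖(P.ζ : K)‖⁻¹ ^ j := by
  have hp := P.norm_pos
  rw [val_zUnit, map_add, PowerSeries.coeff_C, PowerSeries.coeff_X]
  rcases j with _ | _ | j
  · simp
  · simp [hp.ne']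
  · simp; positivity

lemma norm_coeff_zUnit_inv (j : ℕ) :
    ‖PowerSeries.coeff j ((zUnit P)⁻¹ : (PowerSeries K)ˣ).val‖ ≤
      ‖(P.ζ : K)‖⁻¹ * ‖(P.ζ : K)‖⁻¹ ^ j := by
  have hp := P.norm_pos
  have h : (PowerSeries.C (P.ζ : K) + PowerSeries.X) * ((zUnit P)⁻¹ : (PowerSeries K)ˣ).val = 1 :=
    (zUnit P).mul_inv
  have hz : (P.ζ : K) ≠ 0 := norm_pos_iff.1 hp
  induction j with
  | zero =>
    have h0 := congrArg (PowerSeries.coeff 0) h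
    simp only [add_mul, map_add, PowerSeries.coeff_C_mul, PowerSeries.coeff_zero_X_mul,
      add_zero, PowerSeries.coeff_zero_one] at h0
    rw [eq_inv_of_mul_eq_one_right h0]
    simp
  | succ j ih =>
    have h0 := congrArg (PowerSeries.coeff (j + 1)) h
    simp only [add_mul, map_add, PowerSeries.coeff_C_mul, PowerSeries.coeff_succ_X_mul,
      PowerSeries.coeff_one, Nat.succ_ne_zero, if_false] at h0
    have h1 : PowerSeries.coeff (j + 1) ((zUnit P)⁻¹ : (PowerSeries K)ˣ).val =
        -((P.ζ : K)⁻¹ * PowerSeries.coeff j ((zUnit P)⁻¹ : (PowerSeries K)ˣ).val) := by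
      field_simp
      linear_combination h0
    rw [h1, norm_neg, norm_mul, norm_inv, pow_succ]
    calc _ ≤ ‖(P.ζ : K)‖⁻¹ * (‖(P.ζ : K)‖⁻¹ * ‖(P.ζ : K)‖⁻¹ ^ j) := by gcongr
      _ = _ := by ring

lemma norm_coeff_mul {f g : PowerSeries K} {ρ c d : ℝ} (hρ : 0 ≤ ρ) (hc : 0 ≤ c) (hd : 0 ≤ d)
    (hf : ∀ j, ‖PowerSeries.coeff j f‖ ≤ c * ρ ^ j)
    (hg : ∀ j, ‖PowerSeries.coeff j g‖ ≤ d * ρ ^ j) (j : ℕ) :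
    ‖PowerSeries.coeff j (f * g)‖ ≤ c * d * ρ ^ j := by
  rw [PowerSeries.coeff_mul]
  refine IsUltrametricDist.norm_sum_le_of_forall_le_of_nonneg (by positivity) fun ij hij => ?_
  rw [Finset.HasAntidiagonal.mem_antidiagonal] at hij
  rw [norm_mul, ← hij, pow_add]
  calc _ ≤ (c * ρ ^ ij.1) * (d * ρ ^ ij.2) :=
        mul_le_mul (hf _) (hg _) (norm_nonneg _) (by positivity)
    _ = _ := by ring

/-- The coefficient of `(z - ζ)^j` in `z^i`. -/
def zc (P : Base F K) (j : ℕ) (i : ℤ) : K := PowerSeries.coeff j ((zUnit P) ^ i).val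

lemma norm_zc (j : ℕ) (i : ℤ) :
    ‖zc P j i‖ ≤ ‖(P.ζ : K)‖ ^ i * ‖(P.ζ : K)‖⁻¹ ^ j := by
  have hp := P.norm_pos
  unfold zc
  induction i generalizing j with
  | zero =>
    simp only [zpow_zero, Units.val_one, PowerSeries.coeff_one, one_mul]
    split_ifs with h
    · simp [h]
    · simp
  | succ i ih =>
    rw [zpow_add_one, zpow_add_one₀ hp.ne', Units.val_mul]
    exact norm_coeff_mul (by positivity) (by positivity) (by positivity) ih norm_coeff_zUnit j
  | pred i ih =>
    rw [zpow_sub_one, zpow_sub_one₀ hp.ne', Units.val_mul]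
    exact norm_coeff_mul (by positivity) (by positivity) (by positivity) ih
      norm_coeff_zUnit_inv j

lemma summable_ev (a : Annulus P) (j : ℕ) :
    Summable fun i : ℤ => (a.coeff i : K) * zc P j i := by
  have hp := P.norm_pos
  refine NonarchimedeanAddGroup.summable_of_tendsto_cofinite_zero ?_
  have hle : ∀ i, ‖(a.coeff i : K) * zc P j i‖ ≤
      ‖(a.coeff i : K)‖ * ‖(P.ζ : K)‖ ^ i * ‖(P.ζ : K)‖⁻¹ ^ j := fun i => by
    rw [norm_mul, mul_assoc]
    exact mul_le_mul_of_nonneg_left (norm_zc j i) (norm_nonneg _)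
  rw [Int.cofinite_eq, tendsto_sup]
  constructor
  · refine squeeze_zero_norm hle ?_
    have := (a.decay 1 one_pos).mul_const (‖(P.ζ : K)‖⁻¹ ^ j)
    simpa only [one_mul, Real.rpow_intCast, zero_mul] using this
  · refine squeeze_zero_norm (a := fun i : ℤ => ‖(P.ζ : K)‖ ^ i * ‖(P.ζ : K)‖⁻¹ ^ j)
      (fun i => (hle i).trans ?_) ?_
    · refine mul_le_mul_of_nonneg_right ?_ (by positivity)
      exact mul_le_of_le_one_left (by positivity) (norm_le_one _)
    · have h1 : Tendsto (fun i : ℤ => ‖(P.ζ : K)‖ ^ i) atTop (𝓝 0) := by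
        have h3 : Tendsto Int.toNat atTop atTop :=
          tendsto_atTop.2 fun n => by
            filter_upwards [eventually_ge_atTop (n : ℤ)] with i hi
            omega
        have h2 := (tendsto_pow_atTop_nhds_zero_of_lt_one hp.le P.norm_ζ_lt_one).comp h3
        refine h2.congr' ?_
        filter_upwards [eventually_ge_atTop 0] with i hi
        simp only [Function.comp]
        rw [← zpow_natCast, Int.toNat_of_nonneg hi]
      simpa using h1.mul_const (‖(P.ζ : K)‖⁻¹ ^ j)

lemma cauchy_product {x y : ℤ → K} (hx : Summable x) (hy : Summable y) :
    Summable (fun p : ℤ × ℤ => x p.2 * y (p.1 - p.2)) ∧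
    (∑' i, x i) * (∑' i, y i) = ∑' p : ℤ × ℤ, x p.2 * y (p.1 - p.2) := by
  have := nonarchRing (K := K)
  let e : ℤ × ℤ ≃ ℤ × ℤ :=
    { toFun p := (p.2, p.1 - p.2)
      invFun p := (p.1 + p.2, p.1)
      left_inv p := by ext <;> simp
      right_inv p := by ext <;> simp }
  have h := hx.mul_of_nonarchimedean hy
  exact ⟨(e.summable_iff).2 h, (tsum_mul_tsum_of_nonarchimedean hx hy).trans (e.tsum_eq _).symm⟩

lemma zc_add (j : ℕ) (n i : ℤ) :
    zc P j n = ∑ p ∈ Finset.HasAntidiagonal.antidiagonal j, zc P p.1 i * zc P p.2 (n - i) := by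
  unfold zc
  rw [← PowerSeries.coeff_mul, ← Units.val_mul, ← zpow_add, add_sub_cancel]

lemma ev_mul_aux (a b : Annulus P) (j : ℕ) :
    ∑' n : ℤ, ((∑' i : ℤ, a.coeff i * b.coeff (n - i) : OK K) : K) * zc P j n =
      ∑ p ∈ Finset.HasAntidiagonal.antidiagonal j, (∑' i : ℤ, (a.coeff i : K) * zc P p.1 i) *
        (∑' i : ℤ, (b.coeff i : K) * zc P p.2 i) := by
  have hs (p : ℕ × ℕ) := cauchy_product (summable_ev a p.1) (summable_ev b p.2)
  rw [Finset.sum_congr rfl fun p _ => (hs p).2, ← Summable.tsum_finsetSum fun p _ => (hs p).1,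
    (summable_sum fun p _ => (hs p).1).tsum_prod]
  congr 1; ext1 n
  have h4 := (summable_mul a b n).hasSum.map (OK K).subtype.toAddMonoidHom continuous_subtype_val
  have h5 := h4.mul_right (zc P j n)
  refine h5.tsum_eq.symm.trans ?_
  congr 1; ext1 i
  simp only [Function.comp_apply, RingHom.toAddMonoidHom_eq_coe, AddMonoidHom.coe_coe,
    map_mul, ValuationSubring.subtype_apply]
  rw [zc_add j n i, Finset.mul_sum]
  refine Finset.sum_congr rfl fun p _ => ?_
  ring

/-- Expansion at `z = ζ`: `∑ b_i z^i ↦ ∑ b_i (ζ + (z - ζ))^i`, the sum being taken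
coefficientwise. The variable of the power series ring stands for `z - ζ`. -/
def ev : Annulus P →+* PowerSeries K where
  toFun a := PowerSeries.mk fun j =>
    ∑' i : ℤ, (a.coeff i : K) * zc P j i
  map_zero' := by ext j; simp
  map_add' a b := by
    ext j
    simp only [PowerSeries.coeff_mk, map_add, coeff_add]
    rw [← (summable_ev a j).tsum_add (summable_ev b j)]
    congr 1; ext1 i
    simp [add_mul]
  map_one' := by
    ext j
    simp only [PowerSeries.coeff_mk]
    rw [tsum_eq_single 0]
    · simp [coeff_one, zc]
    · intro i hi
      simp [coeff_one, hi]
  map_mul' a b := by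
    ext j
    rw [PowerSeries.coeff_mul]
    simp only [PowerSeries.coeff_mk]
    exact ev_mul_aux a b j

lemma coeff_ev (a : Annulus P) (j : ℕ) :
    PowerSeries.coeff j (ev a) = ∑' i : ℤ, (a.coeff i : K) * zc P j i := by
  simp [ev]

lemma ev_mono (d : ℤ) (x : OK K) :
    ev (mono d x : Annulus P) = PowerSeries.C (x : K) * ((zUnit P) ^ d).val := by
  ext j
  rw [coeff_ev, tsum_eq_single d]
  · simp [coeff_mono, zc]
  · intro i hi
    simp [coeff_mono, hi]

/-! ### The element `t` -/

/-- The finite products `∏_{i < m} (1 - ζ^{q^i} / z)`. -/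
def tPartial (P : Base F K) (m : ℕ) : Annulus P :=
  ∏ i ∈ Finset.range m, (1 - mono (-1) (P.ζ ^ Fintype.card F ^ i))

lemma coeff_tPartial_succ (m : ℕ) (i : ℤ) : (tPartial P (m + 1)).coeff i =
    (tPartial P m).coeff i - (tPartial P m).coeff (i + 1) * P.ζ ^ Fintype.card F ^ m := by
  rw [tPartial, Finset.prod_range_succ, mul_sub, mul_one, coeff_sub, coeff_mul_mono,
    sub_neg_eq_add]
  rfl

/-- The triangular numbers, used as exponents in the bounds for the coefficients of `t`. -/
def tri (n : ℕ) : ℕ := ∑ i ∈ Finset.range (n + 1), i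

lemma tri_succ (n : ℕ) : tri (n + 1) = tri n + (n + 1) := Finset.sum_range_succ _ _

lemma two_mul_tri (n : ℕ) : 2 * tri n = n * (n + 1) := by
  induction n with
  | zero => rfl
  | succ n ih => rw [tri_succ, mul_add, ih]; ring

lemma one_lt_q : 1 < Fintype.card F := Fintype.one_lt_card

lemma tPartial_spec (m : ℕ) : (∀ i : ℤ, 0 < i → (tPartial P m).coeff i = 0) ∧
    (∀ n : ℕ, m < n → (tPartial P m).coeff (-n) = 0) ∧ (tPartial P m).coeff 0 = 1 ∧
    ∀ n : ℕ, ‖(tPartial P m).coeff (-n)‖ ≤ ‖(P.ζ : K)‖ ^ tri n := by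
  have hp := P.norm_pos
  induction m with
  | zero =>
    have h : tPartial P 0 = 1 := rfl
    rw [h]
    refine ⟨fun i hi => ?_, fun n hn => ?_, ?_, fun n => ?_⟩
    · rw [coeff_one, if_neg hi.ne']
    · rw [coeff_one, if_neg (by omega)]
    · rw [coeff_one, if_pos rfl]
    · rw [coeff_one]
      rcases Nat.eq_zero_or_pos n with rfl | hn
      · exact (norm_le_one _).trans (by simp [tri])
      · rw [if_neg (by omega), norm_zero]
        positivity
  | succ m ih =>
    obtain ⟨h1, h2, h3, h4⟩ := ih
    refine ⟨fun i hi => ?_, fun n hn => ?_, ?_, fun n => ?_⟩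
    · rw [coeff_tPartial_succ, h1 i hi, h1 (i + 1) (by omega)]
      simp
    · obtain ⟨n, rfl⟩ := Nat.exists_eq_succ_of_ne_zero (by omega : n ≠ 0)
      rw [coeff_tPartial_succ, h2 _ (by omega),
        show -((n.succ : ℕ) : ℤ) + 1 = -(n : ℤ) by push_cast; ring, h2 n (by omega)]
      simp
    · rw [coeff_tPartial_succ, h3, h1 (0 + 1) (by omega)]
      simp
    · rcases Nat.eq_zero_or_pos n with rfl | hn
      · exact (norm_le_one _).trans (by simp [tri])
      obtain ⟨n, rfl⟩ := Nat.exists_eq_succ_of_ne_zero hn.ne'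
      rw [coeff_tPartial_succ,
        show -((n.succ : ℕ) : ℤ) + 1 = -(n : ℤ) by push_cast; ring]
      rw [sub_eq_add_neg]
      refine (IsUltrametricDist.norm_add_le_max _ _).trans (max_le (h4 _) ?_)
      rw [norm_neg]
      by_cases hnm : m < n
      · rw [h2 n hnm, zero_mul, norm_zero]
        positivity
      · rw [norm_mul', norm_pow']
        have h5 : n + 1 ≤ Fintype.card F ^ m :=
          (Nat.succ_le_succ (not_lt.1 hnm)).trans (Nat.lt_pow_self one_lt_q)
        calc ‖(tPartial P m).coeff (-n)‖ * ‖(P.ζ : K)‖ ^ Fintype.card F ^ m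
            ≤ ‖(P.ζ : K)‖ ^ tri n * ‖(P.ζ : K)‖ ^ (n + 1) :=
              mul_le_mul (h4 n) (pow_le_pow_of_le_one hp.le P.norm_ζ_lt_one.le h5)
                (by positivity) (by positivity)
          _ = _ := by rw [← pow_add, Nat.succ_eq_add_one, tri_succ]

lemma exists_tendsto_tPartial (i : ℤ) :
    ∃ c : OK K, Tendsto (fun m => (tPartial P m).coeff i) atTop (𝓝 c) := by
  have hp := P.norm_pos
  refine cauchySeq_tendsto_of_complete
    (cauchySeq_of_le_geometric ‖(P.ζ : K)‖ 1 P.norm_ζ_lt_one fun m => ?_)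
  rw [dist_eq_norm, coeff_tPartial_succ, sub_sub_cancel, norm_mul', norm_pow', one_mul]
  refine (mul_le_of_le_one_left (by positivity) (norm_le_one _)).trans ?_
  exact pow_le_pow_of_le_one hp.le P.norm_ζ_lt_one.le (Nat.lt_pow_self one_lt_q).le

/-- The coefficients of `t = ∏_{i ≥ 0} (1 - ζ^{q^i} / z)`, as limits of the coefficients of the
finite products. -/
def tCoeff (P : Base F K) (i : ℤ) : OK K := limUnder atTop fun m => (tPartial P m).coeff i

lemma tendsto_tCoeff (i : ℤ) :
    Tendsto (fun m => (tPartial P m).coeff i) atTop (𝓝 (tCoeff P i)) :=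
  tendsto_nhds_limUnder (exists_tendsto_tPartial i)

lemma tCoeff_pos {i : ℤ} (hi : 0 < i) : tCoeff P i = 0 :=
  tendsto_nhds_unique (tendsto_tCoeff i)
    (tendsto_const_nhds.congr fun m => ((tPartial_spec m).1 i hi).symm)

lemma tCoeff_zero : tCoeff P 0 = 1 :=
  tendsto_nhds_unique (tendsto_tCoeff 0)
    (tendsto_const_nhds.congr fun m => (tPartial_spec m).2.2.1.symm)

lemma norm_tCoeff_neg (n : ℕ) : ‖tCoeff P (-n)‖ ≤ ‖(P.ζ : K)‖ ^ tri n :=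
  le_of_tendsto (tendsto_tCoeff _).norm (.of_forall fun m => (tPartial_spec m).2.2.2 n)

/-- `t = ∏_{i ≥ 0} (1 - ζ^{q^i} / z)`. -/
def t (P : Base F K) : Annulus P := ⟨tCoeff P, decay_iff.2 fun r hr ε hε => by
  have hp := P.norm_pos
  have h1 := tendsto_pow_atTop_nhds_zero_of_lt_one hp.le P.norm_ζ_lt_one
  obtain ⟨N, hN⟩ := eventually_atTop.1 (h1.eventually_lt_const hε)
  obtain ⟨M, hM⟩ := exists_nat_ge (2 * r + 1)
  filter_upwards [eventually_le_atBot (-(N : ℤ)), eventually_le_atBot (-(M : ℤ))] with i h2 h3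
  obtain ⟨n, rfl⟩ : ∃ n : ℕ, i = -n := ⟨i.natAbs, by omega⟩
  refine le_trans ?_ (hN n (by omega)).le
  refine (mul_le_mul_of_nonneg_right (norm_tCoeff_neg n) (by positivity)).trans ?_
  rw [← Real.rpow_natCast, ← Real.rpow_natCast, ← Real.rpow_add hp]
  refine Real.rpow_le_rpow_of_exponent_ge hp P.norm_ζ_lt_one.le ?_
  have h4 : (2 * tri n : ℝ) = n * (n + 1) := by exact_mod_cast two_mul_tri n
  have h5 : (M : ℝ) ≤ n := by exact_mod_cast (by omega : M ≤ n)
  have h6 : (0 : ℝ) ≤ n := by positivity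
  push_cast
  nlinarith⟩

@[simp] lemma coeff_t (i : ℤ) : (t P).coeff i = tCoeff P i := rfl

lemma tPartial_succ' (m : ℕ) :
    tPartial P (m + 1) = (1 - mono (-1) P.ζ) * σ (tPartial P m) := by
  rw [tPartial, tPartial, Finset.prod_range_succ', map_prod, mul_comm]
  congr 1
  · simp
  · refine Finset.prod_congr rfl fun i _ => ?_
    rw [map_sub, map_one, σ_mono, ← pow_mul, ← pow_succ]

/-- The functional equation `t = (1 - ζ / z) σ(t)`. -/
lemma t_eq : t P = (1 - mono (-1) P.ζ) * σ (t P) := by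
  ext i : 2
  refine tendsto_nhds_unique ((tendsto_tCoeff i).comp (tendsto_add_atTop_nat 1)) ?_
  have h : ∀ a : Annulus P, ((1 - mono (-1) P.ζ) * a).coeff i =
      a.coeff i - a.coeff (i + 1) * P.ζ := fun a => by
    rw [mul_comm, mul_sub, mul_one, coeff_sub, coeff_mul_mono, sub_neg_eq_add]
  simp only [Function.comp_def, tPartial_succ', h, coeff_σ]
  exact ((tendsto_tCoeff i).pow _).sub (((tendsto_tCoeff (i + 1)).pow _).mul_const _)

lemma red_t : red (t P) = 1 := by
  ext i
  rw [coeff_red, coeff_t, HahnSeries.coeff_one]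
  split_ifs with h
  · rw [h, tCoeff_zero, map_one]
  · rw [residue_eq_zero]
    rcases lt_or_gt_of_ne h with h | h
    · obtain ⟨n, rfl⟩ : ∃ n : ℕ, i = -n := ⟨i.natAbs, by omega⟩
      have h4 := two_mul_tri n
      have : tri n ≠ 0 := by
        intro h0
        rw [h0] at h4
        have : n ≠ 0 := by omega
        simp_all
      exact (norm_tCoeff_neg n).trans_lt (pow_lt_one₀ (norm_nonneg _) P.norm_ζ_lt_one this)
    · rw [tCoeff_pos h]
      simp

/-- `σ(t)` does not vanish at `z = ζ`. -/
lemma isUnit_ev_σ_t : IsUnit (ev (σ (t P))) := by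
  have hp := P.norm_pos
  rw [PowerSeries.isUnit_iff_constantCoeff, isUnit_iff_ne_zero,
    ← PowerSeries.coeff_zero_eq_constantCoeff_apply, coeff_ev]
  intro h0
  have hs := summable_ev (σ (t P)) 0
  have hb : ∀ i : ℤ, ‖((σ (t P)).coeff i : K) * zc P 0 i - (if i = 0 then 1 else 0)‖ ≤
      ‖(P.ζ : K)‖ := by
    intro i
    rcases lt_trichotomy i 0 with h | h | h
    · rw [if_neg h.ne, sub_zero, norm_mul]
      obtain ⟨n, rfl⟩ : ∃ n : ℕ, i = -n := ⟨i.natAbs, by omega⟩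
      have h1 : ‖(((σ (t P)).coeff (-n) : OK K) : K)‖ ≤ ‖(P.ζ : K)‖ ^ (n + 1) := by
        have h2 : ‖(t P).coeff (-n)‖ ^ Fintype.card F ≤
            (‖(P.ζ : K)‖ ^ tri n) ^ Fintype.card F :=
          pow_le_pow_left₀ (norm_nonneg _) (norm_tCoeff_neg n) _
        have h3 : ‖(((σ (t P)).coeff (-n) : OK K) : K)‖ = ‖(t P).coeff (-n)‖ ^ Fintype.card F :=
          norm_pow' _ _
        rw [h3]
        refine h2.trans ?_
        rw [← pow_mul]
        refine pow_le_pow_of_le_one hp.le P.norm_ζ_lt_one.le ?_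
        have h4 := two_mul_tri n
        have h5 : 2 ≤ Fintype.card F := one_lt_q
        have h6 : 1 ≤ n := by omega
        nlinarith
      calc _ ≤ ‖(P.ζ : K)‖ ^ (n + 1) * (‖(P.ζ : K)‖ ^ (-n : ℤ) * ‖(P.ζ : K)‖⁻¹ ^ 0) :=
            mul_le_mul h1 (norm_zc 0 _) (norm_nonneg _) (by positivity)
        _ = ‖(P.ζ : K)‖ := by
            rw [zpow_neg, zpow_natCast, pow_succ]
            field_simp
    · subst h
      simp [tCoeff_zero, zc]
    · rw [if_neg h.ne', sub_zero, coeff_σ, coeff_t, tCoeff_pos h]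
      simp [Fintype.card_ne_zero]
  have hs1 : HasSum (fun i : ℤ => if i = 0 then (1 : K) else 0) 1 := by
    simpa using hasSum_ite_eq (0 : ℤ) (1 : K)
  have h1 := (hs.hasSum.sub hs1).tsum_eq
  have h2 := IsUltrametricDist.norm_tsum_le_of_forall_le hb
  rw [h1, h0, zero_sub, norm_neg, norm_one] at h2
  exact absurd P.norm_ζ_lt_one (not_lt.2 h2)

end Annulus
/-! ### Base change of modules along a ring homomorphism -/

section BaseChange

variable {R S T : Type u} [CommRing R] [CommRing S] [CommRing T]
variable {M N L : Type u} [AddCommGroup M] [AddCommGroup N] [AddCommGroup L]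

/-- The ring `S`, regarded as an algebra over `R` by means of a ring homomorphism `φ : R → S`. -/
def Along (_φ : R →+* S) : Type u := S

instance (φ : R →+* S) : CommRing (Along φ) := inferInstanceAs (CommRing S)

instance (φ : R →+* S) : Algebra R (Along φ) := RingHom.toAlgebra (S := Along φ) φ

/-- The base change `S ⊗_{R, φ} M` of an `R`-module `M` along a ring homomorphism `φ : R → S`. -/
def BaseChange (φ : R →+* S) (M : Type u) [AddCommGroup M] [Module R M] : Type u :=
  TensorProduct R (Along φ) M

namespace BaseChange

instance (φ : R →+* S) [Module R M] : AddCommGroup (BaseChange φ M) :=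
  inferInstanceAs (AddCommGroup (TensorProduct R (Along φ) M))

instance (φ : R →+* S) [Module R M] : Module S (BaseChange φ M) :=
  inferInstanceAs (Module (Along φ) (TensorProduct R (Along φ) M))

/-- The canonical `φ`-semilinear map `m ↦ 1 ⊗ m`. -/
def mk (φ : R →+* S) [Module R M] : M →ₛₗ[φ] BaseChange φ M where
  toFun := fun m => TensorProduct.mk R (Along φ) M 1 m
  map_add' := fun x y => map_add (TensorProduct.mk R (Along φ) M 1) x y
  map_smul' := fun r x => by
    have h1 : TensorProduct.mk R (Along φ) M 1 (r • x) =
        (algebraMap R (Along φ) r) • TensorProduct.mk R (Along φ) M 1 x := by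
      rw [map_smul, algebraMap_smul]
    exact h1

/-- Semilinear maps out of a base change. -/
def liftSL (φ : R →+* S) (ψ : S →+* T) (χ : R →+* T) (h : ∀ r, ψ (φ r) = χ r)
    [Module R M] [Module T N] (f : M →ₛₗ[χ] N) : BaseChange φ M →ₛₗ[ψ] N :=
  letI : Module (Along φ) N := Module.compHom N ψ
  letI : Module R N := Module.compHom N χ
  haveI : IsScalarTower R (Along φ) N := IsScalarTower.of_algebraMap_smul fun r x => by
    change ψ (φ r) • x = χ r • x
    rw [h]
  let g : M →ₗ[R] N :=
    { toFun := f, map_add' := f.map_add, map_smul' := fun r x => f.map_smulₛₗ r x }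
  let g' : TensorProduct R (Along φ) M →ₗ[Along φ] N := g.liftBaseChange (Along φ)
  { toFun := g', map_add' := g'.map_add, map_smul' := fun s x => g'.map_smul s x }

@[simp] lemma liftSL_mk (φ : R →+* S) (ψ : S →+* T) (χ : R →+* T) (h : ∀ r, ψ (φ r) = χ r)
    [Module R M] [Module T N] (f : M →ₛₗ[χ] N) (m : M) : liftSL φ ψ χ h f (mk φ m) = f m := by
  let : Module (Along φ) N := Module.compHom N ψ
  let : Module R N := Module.compHom N χ
  have : IsScalarTower R (Along φ) N := IsScalarTower.of_algebraMap_smul fun r x => by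
    change ψ (φ r) • x = χ r • x
    rw [h]
  let g : M →ₗ[R] N :=
    { toFun := f, map_add' := f.map_add, map_smul' := fun r x => f.map_smulₛₗ r x }
  have h1 : g.liftBaseChange (Along φ) (TensorProduct.mk R (Along φ) M 1 m) = g m := by simp
  exact h1

/-- Semilinear maps out of a base change agree if they agree on the elements `1 ⊗ m`. -/
lemma hom_ext {φ : R →+* S} {ψ : S →+* T} [Module R M] [Module T N]
    {f g : BaseChange φ M →ₛₗ[ψ] N} (h : ∀ m, f (mk φ m) = g (mk φ m)) : f = g := by
  refine LinearMap.ext fun x => ?_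
  change TensorProduct R (Along φ) M at x
  induction x using TensorProduct.induction_on with
  | zero => exact (map_zero f).trans (map_zero g).symm
  | tmul s m =>
    have h1 : (TensorProduct.tmul R s m : TensorProduct R (Along φ) M) =
        s • (TensorProduct.mk R (Along φ) M 1 m) := by
      simp [TensorProduct.smul_tmul']
    have h2 : ∀ s : S, f (s • mk φ m) = g (s • mk φ m) := fun s => by
      rw [f.map_smulₛₗ, g.map_smulₛₗ, h]
    exact (congrArg f h1).trans ((h2 s).trans (congrArg g h1).symm)
  | add x y hx hy => exact (map_add f x y).trans ((congrArg₂ (· + ·) hx hy).trans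
      (map_add g x y).symm)

/-- Linear maps out of a base change. -/
def lift (φ : R →+* S) [Module R M] [Module S N] (f : M →ₛₗ[φ] N) : BaseChange φ M →ₗ[S] N :=
  liftSL φ (RingHom.id S) φ (fun _ => rfl) f

@[simp] lemma lift_mk (φ : R →+* S) [Module R M] [Module S N] (f : M →ₛₗ[φ] N) (m : M) :
    lift φ f (mk φ m) = f m := liftSL_mk _ _ _ _ _ _

/-- The base change `id ⊗ f` of a linear map `f`. -/
def map (φ : R →+* S) [Module R M] [Module R N] (f : M →ₗ[R] N) :
    BaseChange φ M →ₗ[S] BaseChange φ N :=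
  lift φ ((mk φ).comp f)

@[simp] lemma map_mk (φ : R →+* S) [Module R M] [Module R N] (f : M →ₗ[R] N) (m : M) :
    map φ f (mk φ m) = mk φ (f m) := lift_mk _ _ _

lemma map_comp (φ : R →+* S) [Module R M] [Module R N] [Module R L] (g : N →ₗ[R] L)
    (f : M →ₗ[R] N) : map φ (g ∘ₗ f) = map φ g ∘ₗ map φ f :=
  hom_ext fun m => by simp

@[simp] lemma map_id (φ : R →+* S) [Module R M] :
    map φ (LinearMap.id : M →ₗ[R] M) = LinearMap.id :=
  hom_ext fun m => by simp

lemma map_smul' (φ : R →+* S) [Module R M] [Module R N] (r : R) (f : M →ₗ[R] N) :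
    map φ (r • f) = φ r • map φ f :=
  hom_ext fun m => by simp

/-- The base change of a linear equivalence. -/
def mapEquiv (φ : R →+* S) [Module R M] [Module R N] (e : M ≃ₗ[R] N) :
    BaseChange φ M ≃ₗ[S] BaseChange φ N :=
  LinearEquiv.ofLinearMap (map φ e.toLinearMap) (map φ e.symm.toLinearMap)
    (by rw [← map_comp]; simp) (by rw [← map_comp]; simp)

@[simp] lemma mapEquiv_toLinearMap (φ : R →+* S) [Module R M] [Module R N] (e : M ≃ₗ[R] N) :
    (mapEquiv φ e).toLinearMap = map φ e.toLinearMap := rfl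

@[simp] lemma mapEquiv_mk (φ : R →+* S) [Module R M] [Module R N] (e : M ≃ₗ[R] N) (m : M) :
    mapEquiv φ e (mk φ m) = mk φ (e m) := map_mk φ e.toLinearMap m

/-- The canonical isomorphism `T ⊗_{S, ψ} (S ⊗_{R, φ} M) ≅ T ⊗_{R, χ} M` if `ψ ∘ φ = χ`. -/
def assoc (φ : R →+* S) (ψ : S →+* T) (χ : R →+* T) (h : ∀ r, ψ (φ r) = χ r)
    (M : Type u) [AddCommGroup M] [Module R M] :
    BaseChange ψ (BaseChange φ M) ≃ₗ[T] BaseChange χ M :=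
  LinearEquiv.ofLinearMap
    (lift ψ (liftSL φ ψ χ h (mk χ)))
    (lift χ
      { toFun := fun m => mk ψ (mk φ m)
        map_add' := fun x y => by simp
        map_smul' := fun r x => by simp [h] })
    (hom_ext fun m => by simp)
    (hom_ext fun m => by
      have h1 : (((lift χ
          { toFun := fun m => mk ψ (mk φ m)
            map_add' := fun x y => by simp
            map_smul' := fun r x => by simp [h] }) ∘ₗ (lift ψ (liftSL φ ψ χ h (mk χ)))) :
          BaseChange ψ (BaseChange φ M) →ₗ[T] _).comp (mk ψ) = mk ψ :=
        hom_ext fun m => by simp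
      exact LinearMap.congr_fun h1 m)

@[simp] lemma assoc_mk (φ : R →+* S) (ψ : S →+* T) (χ : R →+* T) (h : ∀ r, ψ (φ r) = χ r)
    [Module R M] (m : M) : assoc φ ψ χ h M (mk ψ (mk φ m)) = mk χ m :=
  (lift_mk _ _ _).trans (liftSL_mk _ _ _ _ _ _)

@[simp] lemma assoc_symm_mk (φ : R →+* S) (ψ : S →+* T) (χ : R →+* T) (h : ∀ r, ψ (φ r) = χ r)
    [Module R M] (m : M) : (assoc φ ψ χ h M).symm (mk χ m) = mk ψ (mk φ m) :=
  lift_mk _ _ _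

/-- The canonical isomorphism `R ⊗_{R, id} M ≅ M`. -/
def idEquiv (M : Type u) [AddCommGroup M] [Module R M] :
    BaseChange (RingHom.id R) M ≃ₗ[R] M :=
  let f : BaseChange (RingHom.id R) M →ₗ[R] M := lift (RingHom.id R) LinearMap.id
  let g : M →ₗ[R] BaseChange (RingHom.id R) M := mk (RingHom.id R)
  LinearEquiv.ofLinearMap f g (LinearMap.ext fun m => lift_mk _ _ _)
    (hom_ext fun m => congrArg (mk (RingHom.id R)) (lift_mk _ _ _))

@[simp] lemma idEquiv_mk [Module R M] (m : M) : idEquiv M (mk (RingHom.id R) m) = m :=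
  lift_mk _ _ _

/-- The canonical isomorphism `R ⊗_{S, ψ} (S ⊗_{R, φ} M) ≅ M` if `ψ ∘ φ = id`. -/
def cancel (φ : R →+* S) (ψ : S →+* R) (h : ∀ r, ψ (φ r) = r)
    (M : Type u) [AddCommGroup M] [Module R M] :
    BaseChange ψ (BaseChange φ M) ≃ₗ[R] M :=
  (assoc φ ψ (RingHom.id R) h M).trans
    (idEquiv M)

@[simp] lemma cancel_mk (φ : R →+* S) (ψ : S →+* R) (h : ∀ r, ψ (φ r) = r)
    [Module R M] (m : M) : cancel φ ψ h M (mk ψ (mk φ m)) = m := by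
  rw [cancel, LinearEquiv.trans_apply, assoc_mk, idEquiv_mk]

end BaseChange

end BaseChange

/-! ### The rings and their homomorphisms -/

section Rings

/-- Apply a ring homomorphism to the coefficients of a Laurent series. -/
def mapLaurent {R S : Type u} [CommRing R] [CommRing S] (f : R →+* S) :
    LaurentSeries R →+* LaurentSeries S where
  toFun x := HahnSeries.map x f
  map_zero' := by ext i; simp
  map_one' := by
    ext i
    simp only [HahnSeries.map_coeff, HahnSeries.coeff_one]
    split_ifs <;> simp
  map_add' x y := by ext i; simp
  map_mul' x y := HahnSeries.map_mul (f : R →ₙ+* S)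

@[simp] lemma coeff_mapLaurent {R S : Type u} [CommRing R] [CommRing S] (f : R →+* S)
    (x : LaurentSeries R) (i : ℤ) : (mapLaurent f x).coeff i = f (x.coeff i) := rfl

lemma mapLaurent_single {R S : Type u} [CommRing R] [CommRing S] (f : R →+* S) (i : ℤ) (x : R) :
    mapLaurent f (HahnSeries.single i x) = HahnSeries.single i (f x) := by
  classical
  ext j
  simp only [coeff_mapLaurent, HahnSeries.coeff_single]
  split_ifs <;> simp

variable [CompleteSpace K]

/-- The ring `O_K[[z]]`. -/
abbrev OKz (K : Type u) [NormedField K] [IsUltrametricDist K] : Type u := PowerSeries (OK K)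

/-- The field `k((z))`. -/
abbrev kz (K : Type u) [NormedField K] [IsUltrametricDist K] : Type u := LaurentSeries (ResField K)

/-- The element `z - ζ` of `O_K[[z]]`. -/
def zSubζ (P : Base F K) : OKz K := PowerSeries.X - PowerSeries.C P.ζ

/-- The ring `O_K[[z]][1/(z - ζ)]`. -/
abbrev OKzInv (P : Base F K) : Type u := Localization.Away (zSubζ P)

/-- The ring `O_K[[z, z⁻¹}[t⁻¹]`. -/
abbrev AnnulusT (P : Base F K) : Type u := Localization.Away (Annulus.t P)

/-- The inclusion `O_K[[z]] → O_K[[z]][1/(z - ζ)]`. -/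
def loc (P : Base F K) : OKz K →+* OKzInv P := algebraMap _ _

/-- `z - ζ` as a unit of `O_K[[z]][1/(z - ζ)]`. -/
def zSubζUnit (P : Base F K) : (OKzInv P)ˣ :=
  (IsLocalization.Away.algebraMap_isUnit (S := OKzInv P) (zSubζ P)).unit

/-- The Frobenius `σ` of `O_K[[z]]`: the identity on `z` and `b ↦ b ^ q` on `O_K`. -/
def σA (_P : Base F K) : OKz K →+* OKz K := PowerSeries.map (frob F (OK K))

/-- The Frobenius `σ` of `k((z))`: the identity on `z` and `b ↦ b ^ q` on `k`. -/
def σB (_P : Base F K) : kz K →+* kz K := mapLaurent (frob F (ResField K))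

/-- The inclusion `O_K[[z]] → O_K[[z, z⁻¹}`. -/
def toAnnulus (P : Base F K) : OKz K →+* Annulus P :=
  Annulus.ofLaurent.comp (HahnSeries.ofPowerSeries ℤ (OK K))

/-- The homomorphism `k((z)) → O_K[[z, z⁻¹}` induced by the section `k → O_K`. -/
def ofkz (P : Base F K) : kz K →+* Annulus P := Annulus.ofLaurent.comp (mapLaurent P.sec)

lemma toAnnulus_X (P : Base F K) : toAnnulus P PowerSeries.X = Annulus.mono 1 1 := by
  ext i : 2
  simp [toAnnulus, Annulus.coeff_mono, HahnSeries.ofPowerSeries_X, HahnSeries.coeff_single]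

lemma toAnnulus_C (P : Base F K) (x : OK K) :
    toAnnulus P (PowerSeries.C x) = Annulus.mono 0 x := by
  ext i : 2
  simp [toAnnulus, Annulus.coeff_mono, HahnSeries.ofPowerSeries_C, HahnSeries.C_apply,
    HahnSeries.coeff_single]

lemma ofkz_single (P : Base F K) (i : ℤ) (x : ResField K) :
    ofkz P (HahnSeries.single i x) = Annulus.mono i (P.sec x) := by
  ext j : 2
  simp [ofkz, Annulus.coeff_mono, mapLaurent_single, HahnSeries.coeff_single]

lemma toAnnulus_zSubζ (P : Base F K) :
    toAnnulus P (zSubζ P) = Annulus.mono 1 1 * (1 - Annulus.mono (-1) P.ζ) := by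
  rw [zSubζ, map_sub, toAnnulus_X, toAnnulus_C, mul_sub, mul_one, Annulus.mono_mul_mono]
  simp

lemma isUnit_mono (P : Base F K) (i : ℤ) : IsUnit (Annulus.mono i 1 : Annulus P) :=
  IsUnit.of_mul_eq_one (Annulus.mono (-i) 1) (by
    rw [Annulus.mono_mul_mono, mul_one, add_neg_cancel]; rfl)

lemma σ_toAnnulus (P : Base F K) (x : OKz K) :
    Annulus.σ (toAnnulus P x) = toAnnulus P (σA P x) := by
  ext i : 2
  simp only [toAnnulus, Annulus.coeff_σ, RingHom.comp_apply, Annulus.coeff_ofLaurent, σA]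
  rcases le_or_gt 0 i with hi | hi
  · lift i to ℕ using hi
    rw [HahnSeries.ofPowerSeries_apply_coeff, HahnSeries.ofPowerSeries_apply_coeff,
      PowerSeries.coeff_map, frob_apply]
  · have h : ∀ y : OKz K, (HahnSeries.ofPowerSeries ℤ (OK K) y).coeff i = 0 := fun y => by
      rw [HahnSeries.ofPowerSeries_apply]
      refine HahnSeries.embDomain_of_notMem_range ?_
      rintro ⟨j, hj⟩
      simp at hj
      omega
    rw [h, h, zero_pow Fintype.card_ne_zero]

lemma residue_frob (x : OK K) : IsLocalRing.residue (OK K) (frob F (OK K) x) =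
    frob F (ResField K) (IsLocalRing.residue (OK K) x) := by
  rw [frob_apply, frob_apply, map_pow]

lemma σ_ofkz (P : Base F K) (x : kz K) : Annulus.σ (ofkz P x) = ofkz P (σB P x) := by
  ext i : 2
  simp [ofkz, σB, frob_apply]

/-- The homomorphism `O_K[[z]] → O_K[[z, z⁻¹}[t⁻¹]`. -/
def ιA (P : Base F K) : OKz K →+* AnnulusT P := (algebraMap _ _).comp (toAnnulus P)

/-- The homomorphism `k((z)) → O_K[[z, z⁻¹}[t⁻¹]` induced by the section `k → O_K`. -/
def ιB (P : Base F K) : kz K →+* AnnulusT P := (algebraMap _ _).comp (ofkz P)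

lemma isUnit_algebraMap_t (P : Base F K) :
    IsUnit (algebraMap (Annulus P) (AnnulusT P) (1 - Annulus.mono (-1) P.ζ) *
      algebraMap (Annulus P) (AnnulusT P) (Annulus.σ (Annulus.t P))) := by
  have h : IsUnit (algebraMap (Annulus P) (AnnulusT P) (Annulus.t P)) :=
    IsLocalization.Away.algebraMap_isUnit _
  have h2 := congrArg (algebraMap (Annulus P) (AnnulusT P)) (Annulus.t_eq (P := P))
  rw [map_mul] at h2
  exact h2 ▸ h

lemma isUnit_ιA_zSubζ (P : Base F K) : IsUnit (ιA P (zSubζ P)) := by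
  have h := isUnit_algebraMap_t P
  rw [ιA, RingHom.comp_apply, toAnnulus_zSubζ, map_mul]
  exact ((isUnit_mono P 1).map _).mul (isUnit_of_mul_isUnit_left h)

/-- The homomorphism `O_K[[z]][1/(z - ζ)] → O_K[[z, z⁻¹}[t⁻¹]`. -/
def ιA' (P : Base F K) : OKzInv P →+* AnnulusT P :=
  IsLocalization.Away.lift (zSubζ P) (isUnit_ιA_zSubζ P)

lemma ιA'_loc (P : Base F K) (x : OKz K) : ιA' P (loc P x) = ιA P x :=
  IsLocalization.Away.lift_eq _ _ _

lemma isUnit_σ_t (P : Base F K) :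
    IsUnit (((algebraMap (Annulus P) (AnnulusT P)).comp Annulus.σ) (Annulus.t P)) := by
  have h := isUnit_algebraMap_t P
  exact isUnit_of_mul_isUnit_right h

/-- The Frobenius `σ` of `O_K[[z, z⁻¹}[t⁻¹]`. -/
def σT (P : Base F K) : AnnulusT P →+* AnnulusT P :=
  IsLocalization.Away.lift (Annulus.t P) (isUnit_σ_t P)

lemma σT_algebraMap (P : Base F K) (x : Annulus P) :
    σT P (algebraMap _ _ x) = algebraMap _ _ (Annulus.σ x) :=
  IsLocalization.Away.lift_eq _ _ _

lemma σT_ιA (P : Base F K) (x : OKz K) : σT P (ιA P x) = ιA P (σA P x) :=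
  (σT_algebraMap P _).trans (congrArg (algebraMap _ (AnnulusT P)) (σ_toAnnulus P x))

lemma σT_ιB (P : Base F K) (x : kz K) : σT P (ιB P x) = ιB P (σB P x) :=
  (σT_algebraMap P _).trans (congrArg (algebraMap _ (AnnulusT P)) (σ_ofkz P x))

/-- Reduction modulo the maximal ideal of `O_K`, as a homomorphism `O_K[[z]] → k((z))`. -/
def redA (P : Base F K) : OKz K →+* kz K := Annulus.red.comp (toAnnulus P)

lemma red_σ (P : Base F K) (x : Annulus P) :
    Annulus.red (Annulus.σ x) = σB P (Annulus.red x) := by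
  ext i
  simp [σB, frob_apply]

lemma σB_redA (P : Base F K) (x : OKz K) : σB P (redA P x) = redA P (σA P x) := by
  rw [redA, RingHom.comp_apply, RingHom.comp_apply, ← red_σ, σ_toAnnulus]

lemma red_mono (P : Base F K) (i : ℤ) (x : OK K) :
    Annulus.red (Annulus.mono i x : Annulus P) =
      HahnSeries.single i (IsLocalRing.residue (OK K) x) := by
  classical
  ext j
  rw [Annulus.coeff_red, Annulus.coeff_mono, HahnSeries.coeff_single]
  split_ifs <;> simp

lemma redA_X (P : Base F K) : redA P PowerSeries.X = HahnSeries.single 1 1 := by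
  rw [redA, RingHom.comp_apply, toAnnulus_X, red_mono, map_one]

lemma isUnit_redA_zSubζ (P : Base F K) : IsUnit (redA P (zSubζ P)) := by
  have h : redA P (zSubζ P) = HahnSeries.single 1 1 := by
    rw [zSubζ, map_sub, redA_X, redA, RingHom.comp_apply, toAnnulus_C, red_mono,
      residue_eq_zero.2 P.norm_ζ_lt_one, HahnSeries.single_eq_zero, sub_zero]
  rw [h]
  exact IsUnit.of_mul_eq_one (HahnSeries.single (-1) 1) (by simp)

/-- Reduction modulo the maximal ideal of `O_K`, as a homomorphism
`O_K[[z]][1/(z - ζ)] → k((z))`. -/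
def redA' (P : Base F K) : OKzInv P →+* kz K :=
  IsLocalization.Away.lift (zSubζ P) (isUnit_redA_zSubζ P)

lemma redA'_loc (P : Base F K) (x : OKz K) : redA' P (loc P x) = redA P x :=
  IsLocalization.Away.lift_eq _ _ _

/-- Reduction modulo the maximal ideal of `O_K`, as a homomorphism
`O_K[[z, z⁻¹}[t⁻¹] → k((z))`. -/
def redT (P : Base F K) : AnnulusT P →+* kz K :=
  IsLocalization.Away.lift (g := Annulus.red) (Annulus.t P)
    (by rw [Annulus.red_t]; exact isUnit_one)

lemma redT_ιA (P : Base F K) (x : OKz K) : redT P (ιA P x) = redA P x :=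
  IsLocalization.Away.lift_eq _ _ _

lemma redT_ιB (P : Base F K) (x : kz K) : redT P (ιB P x) = x := by
  refine (IsLocalization.Away.lift_eq _ _ _).trans ?_
  ext i
  simp [ofkz, P.residue_sec]

/-- Expansion at `z = ζ`, as a homomorphism `O_K[[z, z⁻¹} → K((z - ζ))`. -/
def evL (P : Base F K) : Annulus P →+* LaurentSeries K :=
  (HahnSeries.ofPowerSeries ℤ K).comp Annulus.ev

/-- The homomorphism `O_K[[z]] → K((z - ζ))`, `z ↦ ζ + (z - ζ)`. -/
def evA (P : Base F K) : OKz K →+* LaurentSeries K := (evL P).comp (toAnnulus P)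

/-- The homomorphism `k((z)) → K((z - ζ))`, `z ↦ ζ + (z - ζ)`, given on `k` by the section
`k → O_K`. -/
def evB (P : Base F K) : kz K →+* LaurentSeries K := (evL P).comp (ofkz P)

lemma isUnit_evA_zSubζ (P : Base F K) : IsUnit (evA P (zSubζ P)) := by
  have h : evA P (zSubζ P) = HahnSeries.single 1 1 := by
    rw [evA, RingHom.comp_apply, zSubζ, map_sub, toAnnulus_C, toAnnulus_X, evL,
      RingHom.comp_apply, map_sub, Annulus.ev_mono, Annulus.ev_mono, zpow_one, zpow_zero,
      Annulus.val_zUnit]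
    simp [HahnSeries.ofPowerSeries_X]
  rw [h]
  exact IsUnit.of_mul_eq_one (HahnSeries.single (-1) 1) (by simp)

/-- The homomorphism `O_K[[z]][1/(z - ζ)] → K((z - ζ))`. -/
def evA' (P : Base F K) : OKzInv P →+* LaurentSeries K :=
  IsLocalization.Away.lift (zSubζ P) (isUnit_evA_zSubζ P)

lemma evA'_loc (P : Base F K) (x : OKz K) : evA' P (loc P x) = evA P x :=
  IsLocalization.Away.lift_eq _ _ _

/-- The homomorphism `O_K[[z, z⁻¹}[t⁻¹] → K((z - ζ))` obtained by applying `σ` and then expanding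
at `z = ζ` (which makes sense because `σ(t)` does not vanish at `z = ζ`). -/
def evσ (P : Base F K) : AnnulusT P →+* LaurentSeries K :=
  IsLocalization.Away.lift (g := (evL P).comp Annulus.σ) (Annulus.t P)
    (Annulus.isUnit_ev_σ_t.map (HahnSeries.ofPowerSeries ℤ K))

lemma evσ_algebraMap (P : Base F K) (x : Annulus P) :
    evσ P (algebraMap _ _ x) = evL P (Annulus.σ x) :=
  IsLocalization.Away.lift_eq _ _ _

lemma evσ_ιA (P : Base F K) (x : OKz K) : evσ P (ιA P x) = evA P (σA P x) :=
  (evσ_algebraMap P _).trans (congrArg (evL P) (σ_toAnnulus P x))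

lemma evσ_ιB (P : Base F K) (x : kz K) : evσ P (ιB P x) = evB P (σB P x) :=
  (evσ_algebraMap P _).trans (congrArg (evL P) (σ_ofkz P x))

lemma evB_single (P : Base F K) (i : ℤ) : evB P (HahnSeries.single i 1) =
    HahnSeries.ofPowerSeries ℤ K ((Annulus.zUnit P) ^ i).val := by
  rw [evB, RingHom.comp_apply, ofkz_single, evL, RingHom.comp_apply, Annulus.ev_mono]
  simp

lemma σB_single (P : Base F K) (i : ℤ) : σB P (HahnSeries.single i 1) =
    HahnSeries.single i 1 := by
  rw [σB, mapLaurent_single, map_one]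

end Rings

/-! ### Formal properties of base change -/

namespace BaseChange

variable {R S S' T : Type u} [CommRing R] [CommRing S] [CommRing S'] [CommRing T]
variable {M N L : Type u} [AddCommGroup M] [AddCommGroup N] [AddCommGroup L]

lemma map_comp_apply (φ : R →+* S) [Module R M] [Module R N] [Module R L] (g : N →ₗ[R] L)
    (f : M →ₗ[R] N) (x : BaseChange φ M) : map φ g (map φ f x) = map φ (g ∘ₗ f) x := by
  rw [map_comp]
  rfl

lemma map_congr (φ : R →+* S) [Module R M] [Module R N] {f g : M →ₗ[R] N} (h : ∀ m, f m = g m)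
    (x : BaseChange φ M) : map φ f x = map φ g x := by
  rw [LinearMap.ext h]

lemma mapEquiv_apply (φ : R →+* S) [Module R M] [Module R N] (e : M ≃ₗ[R] N)
    (x : BaseChange φ M) : mapEquiv φ e x = map φ e.toLinearMap x := rfl

/-- Linear maps out of a twofold base change agree if they agree on the elements
`1 ⊗ (1 ⊗ m)`. -/
lemma hom_ext₂ {φ : R →+* S} {ψ : S →+* T} [Module R M] [Module T N]
    {f g : BaseChange ψ (BaseChange φ M) →ₗ[T] N} (h : ∀ m, f (mk ψ (mk φ m)) = g (mk ψ (mk φ m))) :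
    f = g :=
  hom_ext fun x => by
    have h1 : f.comp (mk ψ) = g.comp (mk ψ) := hom_ext (φ := φ) fun m => h m
    exact LinearMap.congr_fun h1 x

lemma assoc_map (φ : R →+* S) (ψ : S →+* T) (χ : R →+* T) (h : ∀ r, ψ (φ r) = χ r)
    [Module R M] [Module R N] (f : M →ₗ[R] N) (x : BaseChange ψ (BaseChange φ M)) :
    assoc φ ψ χ h N (map ψ (map φ f) x) = map χ f (assoc φ ψ χ h M x) := by
  have h1 : (assoc φ ψ χ h N).toLinearMap ∘ₗ map ψ (map φ f) =
      map χ f ∘ₗ (assoc φ ψ χ h M).toLinearMap := hom_ext₂ fun m => by simp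
  exact LinearMap.congr_fun h1 x

lemma assoc_symm_map (φ : R →+* S) (ψ : S →+* T) (χ : R →+* T) (h : ∀ r, ψ (φ r) = χ r)
    [Module R M] [Module R N] (f : M →ₗ[R] N) (x : BaseChange χ M) :
    (assoc φ ψ χ h N).symm (map χ f x) = map ψ (map φ f) ((assoc φ ψ χ h M).symm x) := by
  rw [LinearEquiv.symm_apply_eq, assoc_map, LinearEquiv.apply_symm_apply]

/-- The canonical isomorphism `T ⊗_S (S ⊗_R M) ≅ T ⊗_{S'} (S' ⊗_R M)` attached to a commutative
square of ring homomorphisms. -/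
def swap (φ : R →+* S) (ψ : S →+* T) (φ' : R →+* S') (ψ' : S' →+* T)
    (h : ∀ r, ψ (φ r) = ψ' (φ' r)) (M : Type u) [AddCommGroup M] [Module R M] :
    BaseChange ψ (BaseChange φ M) ≃ₗ[T] BaseChange ψ' (BaseChange φ' M) :=
  (assoc φ ψ (ψ'.comp φ') h M).trans (assoc φ' ψ' (ψ'.comp φ') (fun _ => rfl) M).symm

@[simp] lemma swap_mk (φ : R →+* S) (ψ : S →+* T) (φ' : R →+* S') (ψ' : S' →+* T)
    (h : ∀ r, ψ (φ r) = ψ' (φ' r)) [Module R M] (m : M) :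
    swap φ ψ φ' ψ' h M (mk ψ (mk φ m)) = mk ψ' (mk φ' m) := by
  rw [swap, LinearEquiv.trans_apply, assoc_mk, assoc_symm_mk]

lemma swap_map (φ : R →+* S) (ψ : S →+* T) (φ' : R →+* S') (ψ' : S' →+* T)
    (h : ∀ r, ψ (φ r) = ψ' (φ' r)) [Module R M] [Module R N] (f : M →ₗ[R] N)
    (x : BaseChange ψ (BaseChange φ M)) :
    swap φ ψ φ' ψ' h N (map ψ (map φ f) x) = map ψ' (map φ' f) (swap φ ψ φ' ψ' h M x) := by
  rw [swap, swap, LinearEquiv.trans_apply, assoc_map, assoc_symm_map]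
  rfl

lemma span_mk (φ : R →+* S) [Module R M] :
    Submodule.span S (Set.range fun m : M => mk φ m) = ⊤ := by
  set p : Submodule S (BaseChange φ M) := Submodule.span S (Set.range fun m : M => mk φ m)
  have h : p.mkQ = 0 := hom_ext fun m => by
    have : mk φ m ∈ p := Submodule.subset_span ⟨m, rfl⟩
    simpa using this
  rw [← Submodule.ker_mkQ p, h, LinearMap.ker_zero]

lemma finite (φ : R →+* S) [Module R M] [Module.Finite R M] : Module.Finite S (BaseChange φ M) :=
  inferInstanceAs (Module.Finite (Along φ) (TensorProduct R (Along φ) M))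

end BaseChange

open BaseChange CategoryTheory

variable [CompleteSpace K]

/-! ### Local shtukas -/

section

variable {P : Base F K} {M : Type u} [AddCommGroup M] [Module (OKz K) M]

/-- `M[1/(z - ζ)]` as a module over `O_K[[z]]`. -/
instance : Module (OKz K) (BaseChange (loc P) M) := Module.compHom _ (loc P)

/-- `M[1/(z - ζ)]` as a module over `O_K`. -/
instance : Module (OK K) (BaseChange (loc P) M) :=
  Module.compHom _ ((loc P).comp PowerSeries.C)

instance : IsScalarTower (OK K) (OKz K) (BaseChange (loc P) M) :=
  IsScalarTower.of_algebraMap_smul fun _ _ => rfl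

variable (P M) in
/-- The submodule `(z - ζ)^e M` of `M[1/(z - ζ)]`. -/
def zSubζPow (e : ℤ) : Submodule (OKz K) (BaseChange (loc P) M) :=
  Submodule.span _ (Set.range fun m : M => (zSubζUnit P ^ e).val • mk (loc P) m)

/-- The image of `σ^* M` in `M[1/(z - ζ)]` under `F_M`. -/
def frobImage (φ : BaseChange (loc P) (BaseChange (σA P) M) ≃ₗ[OKzInv P] BaseChange (loc P) M) :
    Submodule (OKz K) (BaseChange (loc P) M) :=
  Submodule.span _ (Set.range fun m : BaseChange (σA P) M => φ (mk (loc P) m))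

end

/-- A local shtuka over `O_K`: a finite free `O_K[[z]]`-module `M` with an isomorphism
`F_M : σ^* M[1/(z - ζ)] ≅ M[1/(z - ζ)]` such that, for some integer `e`, the image `F_M(σ^* M)` is
contained in `(z - ζ)^{-e} M` and the quotient is finite free over `O_K`. -/
structure LocalShtuka (P : Base F K) where
  carrier : Type u
  [addCommGroup : AddCommGroup carrier]
  [module : Module (OKz K) carrier]
  [free : Module.Free (OKz K) carrier]
  [finite : Module.Finite (OKz K) carrier]
  frob : BaseChange (loc P) (BaseChange (σA P) carrier) ≃ₗ[OKzInv P] BaseChange (loc P) carrier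
  exists_bound : ∃ e : ℤ, frobImage frob ≤ zSubζPow P carrier (-e) ∧
    Module.Finite (OK K)
      (zSubζPow P carrier (-e) ⧸ (frobImage frob).submoduleOf (zSubζPow P carrier (-e))) ∧
    Module.Free (OK K)
      (zSubζPow P carrier (-e) ⧸ (frobImage frob).submoduleOf (zSubζPow P carrier (-e)))

attribute [instance] LocalShtuka.addCommGroup LocalShtuka.module LocalShtuka.free
  LocalShtuka.finite

namespace LocalShtuka

variable {P : Base F K}

/-- The isomorphism `F_M ⊗ id : S ⊗ σ^* M ≅ S ⊗ M` for a homomorphism `ψ : O_K[[z]] → S` that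
extends to a homomorphism `ψ' : O_K[[z]][1/(z - ζ)] → S`. -/
def frobOver (M : LocalShtuka P) {S : Type u} [CommRing S] (ψ' : OKzInv P →+* S) (ψ : OKz K →+* S)
    (h : ∀ x, ψ' (loc P x) = ψ x) :
    BaseChange ψ (BaseChange (σA P) M.carrier) ≃ₗ[S] BaseChange ψ M.carrier :=
  (assoc (loc P) ψ' ψ h (BaseChange (σA P) M.carrier)).symm ≪≫ₗ mapEquiv ψ' M.frob ≪≫ₗ
    assoc (loc P) ψ' ψ h M.carrier

/-- The underlying `k((z))`-vector space of the `z`-isocrystal `D = M ⊗ k((z))`. -/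
abbrev D (M : LocalShtuka P) : Type u := BaseChange (redA P) M.carrier

/-- The Frobenius `F_D : σ^* D ≅ D` of the `z`-isocrystal `D = M ⊗ k((z))`. -/
def frobD (M : LocalShtuka P) : BaseChange (σB P) M.D ≃ₗ[kz K] M.D :=
  swap (redA P) (σB P) (σA P) (redA P) (σB_redA P) M.carrier ≪≫ₗ
    M.frobOver (redA' P) (redA P) (redA'_loc P)

/-- A morphism of local shtukas. -/
structure Hom (M N : LocalShtuka P) where
  toLin : M.carrier →ₗ[OKz K] N.carrier
  comm : ∀ x, N.frob (map (loc P) (map (σA P) toLin) x) = map (loc P) toLin (M.frob x)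

variable {M N : LocalShtuka P}

lemma Hom.frobOver (f : M.Hom N) {S : Type u} [CommRing S] (ψ' : OKzInv P →+* S)
    (ψ : OKz K →+* S) (h : ∀ x, ψ' (loc P x) = ψ x)
    (x : BaseChange ψ (BaseChange (σA P) M.carrier)) :
    N.frobOver ψ' ψ h (map ψ (map (σA P) f.toLin) x) = map ψ f.toLin (M.frobOver ψ' ψ h x) := by
  have h1 : ∀ y, map ψ' N.frob.toLinearMap (map ψ' (map (loc P) (map (σA P) f.toLin)) y) =
      map ψ' (map (loc P) f.toLin) (map ψ' M.frob.toLinearMap y) := fun y => by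
    rw [map_comp_apply, map_comp_apply]
    exact map_congr ψ' f.comm y
  simp only [LocalShtuka.frobOver, LinearEquiv.trans_apply, assoc_symm_map, mapEquiv_apply, h1,
    assoc_map]

lemma Hom.frobD (f : M.Hom N) (x : BaseChange (σB P) M.D) :
    N.frobD (map (σB P) (map (redA P) f.toLin) x) = map (redA P) f.toLin (M.frobD x) := by
  rw [LocalShtuka.frobD, LinearEquiv.trans_apply, swap_map, f.frobOver]
  rfl

end LocalShtuka

/-- A rigidified local shtuka over `O_K`: a local shtuka `M` with an isomorphism
`δ : M ⊗ O_K[[z, z⁻¹}[t⁻¹] ≅ D ⊗ O_K[[z, z⁻¹}[t⁻¹]` that is compatible with the Frobenius maps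
(`δ ∘ F_M = F_D ∘ σ^* δ`) and reduces to the identity of `D = M ⊗ k((z))` modulo the maximal ideal
of `O_K`. -/
structure RigLocalShtuka (P : Base F K) extends LocalShtuka P where
  δ : BaseChange (ιA P) carrier ≃ₗ[AnnulusT P] BaseChange (ιB P) toLocalShtuka.D
  comm : ∀ x : BaseChange (ιA P) (BaseChange (σA P) carrier),
    δ (toLocalShtuka.frobOver (ιA' P) (ιA P) (ιA'_loc P) x) =
      mapEquiv (ιB P) toLocalShtuka.frobD
        (swap (ιB P) (σT P) (σB P) (ιB P) (σT_ιB P) toLocalShtuka.D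
          (mapEquiv (σT P) δ
            (swap (σA P) (ιA P) (ιA P) (σT P) (fun x => (σT_ιA P x).symm) carrier x)))
  red : ∀ x : BaseChange (redT P) (BaseChange (ιA P) carrier),
    cancel (ιB P) (redT P) (redT_ιB P) toLocalShtuka.D (mapEquiv (redT P) δ x) =
      assoc (ιA P) (redT P) (redA P) (redT_ιA P) carrier x

namespace RigLocalShtuka

variable {P : Base F K}

/-- A morphism of rigidified local shtukas: a morphism `f` of local shtukas with
`δ' ∘ f = (f mod 𝔪) ∘ δ`. -/
@[ext]
structure Hom (M N : RigLocalShtuka P) extends LocalShtuka.Hom M.toLocalShtuka N.toLocalShtuka where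
  comm_δ : ∀ x, N.δ (map (ιA P) toLin x) = map (ιB P) (map (redA P) toLin) (M.δ x)

instance : Category (RigLocalShtuka P) where
  Hom := Hom
  id M :=
    { toLin := LinearMap.id
      comm := fun x => by simp
      comm_δ := fun x => by simp }
  comp f g :=
    { toLin := g.toLin ∘ₗ f.toLin
      comm := fun x => by
        simp only [map_comp, LinearMap.comp_apply, f.comm, g.comm]
      comm_δ := fun x => by
        simp only [map_comp, LinearMap.comp_apply, f.comm_δ, g.comm_δ] }

@[simp] lemma id_toLin (M : RigLocalShtuka P) : (𝟙 M : M ⟶ M).toLin = LinearMap.id := rfl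

@[simp] lemma comp_toLin {M N L : RigLocalShtuka P} (f : M ⟶ N) (g : N ⟶ L) :
    (f ≫ g).toLin = g.toLin ∘ₗ f.toLin := rfl

variable (P) in
/-- The isogenies: the morphisms `f` for which there is a morphism `g` in the opposite direction
such that `g ∘ f` and `f ∘ g` are the multiplication by a power of `z`. -/
def isogeny : MorphismProperty (RigLocalShtuka P) := fun M N f =>
  ∃ (g : N ⟶ M) (n : ℕ),
    (f ≫ g).toLin = (PowerSeries.X : OKz K) ^ n • LinearMap.id ∧
    (g ≫ f).toLin = (PowerSeries.X : OKz K) ^ n • LinearMap.id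

end RigLocalShtuka

/-! ### `z`-isocrystals with Hodge-Pink structure -/

section

variable {R M : Type u} [CommRing R] [AddCommGroup M] [Module R M]

/-- A base change to `K((z - ζ))` as a module over `K[[z - ζ]]`. -/
instance (φ : R →+* LaurentSeries K) : Module (PowerSeries K) (BaseChange φ M) :=
  Module.compHom _ (HahnSeries.ofPowerSeries ℤ K)

/-- A `K((z - ζ))`-linear map, regarded as a `K[[z - ζ]]`-linear map. -/
def overPowerSeries {R' M' : Type u} [CommRing R'] [AddCommGroup M'] [Module R' M']
    {φ : R →+* LaurentSeries K} {φ' : R' →+* LaurentSeries K}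
    (f : BaseChange φ M →ₗ[LaurentSeries K] BaseChange φ' M') :
    BaseChange φ M →ₗ[PowerSeries K] BaseChange φ' M' where
  toFun := f
  map_add' := f.map_add
  map_smul' a x := f.map_smul (HahnSeries.ofPowerSeries ℤ K a) x

end

/-- A `z`-isocrystal over `k` with Hodge-Pink structure over `K`: a finite-dimensional
`k((z))`-vector space `D` with an isomorphism `F_D : σ^* D ≅ D`, and a `K[[z - ζ]]`-lattice `q` of
full rank in `σ^* D ⊗ K((z - ζ))`. -/
structure HPIsocrystal (P : Base F K) where
  carrier : Type u
  [addCommGroup : AddCommGroup carrier]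
  [module : Module (kz K) carrier]
  [finite : Module.Finite (kz K) carrier]
  frob : BaseChange (σB P) carrier ≃ₗ[kz K] carrier
  q : Submodule (PowerSeries K) (BaseChange (evB P) (BaseChange (σB P) carrier))
  fg_q : q.FG
  span_q : Submodule.span (LaurentSeries K)
    (q : Set (BaseChange (evB P) (BaseChange (σB P) carrier))) = ⊤

attribute [instance] HPIsocrystal.addCommGroup HPIsocrystal.module HPIsocrystal.finite

namespace HPIsocrystal

variable {P : Base F K}

/-- A morphism of `z`-isocrystals with Hodge-Pink structure: a morphism of `z`-isocrystals that
maps `q` into `q'`. -/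
@[ext]
structure Hom (D E : HPIsocrystal P) where
  toLin : D.carrier →ₗ[kz K] E.carrier
  comm : ∀ x, E.frob (map (σB P) toLin x) = toLin (D.frob x)
  map_q : ∀ x ∈ D.q, map (evB P) (map (σB P) toLin) x ∈ E.q

instance : Category (HPIsocrystal P) where
  Hom := Hom
  id D :=
    { toLin := LinearMap.id
      comm := fun x => by simp
      map_q := fun x hx => by simpa using hx }
  comp f g :=
    { toLin := g.toLin ∘ₗ f.toLin
      comm := fun x => by
        simp only [map_comp, LinearMap.comp_apply, f.comm, g.comm]
      map_q := fun x hx => by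
        simpa only [map_comp, LinearMap.comp_apply] using g.map_q _ (f.map_q x hx) }

@[simp] lemma id_toLin (D : HPIsocrystal P) : Hom.toLin (𝟙 D) = LinearMap.id := rfl

@[simp] lemma comp_toLin {D E G : HPIsocrystal P} (f : D ⟶ E) (g : E ⟶ G) :
    Hom.toLin (f ≫ g) = g.toLin ∘ₗ f.toLin := rfl

/-- The multiple `z^m f` of a morphism `f`, for an integer `m`. -/
def Hom.zsmul {D E : HPIsocrystal P} (f : D ⟶ E) (m : ℤ) : D ⟶ E :=
  { toLin := (HahnSeries.single m 1 : kz K) • f.toLin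
    comm := fun x => by
      rw [BaseChange.map_smul', σB_single, LinearMap.smul_apply, map_smul, f.comm,
        LinearMap.smul_apply]
    map_q := fun x hx => by
      rw [BaseChange.map_smul', BaseChange.map_smul', σB_single, evB_single]
      exact E.q.smul_mem _ (f.map_q x hx) : Hom D E }

@[simp] lemma zsmul_toLin {D E : HPIsocrystal P} (f : D ⟶ E) (m : ℤ) :
    Hom.toLin (Hom.zsmul f m) = (HahnSeries.single m 1 : kz K) • f.toLin := rfl

end HPIsocrystal

/-! ### The functor `H` -/

namespace RigLocalShtuka

variable {P : Base F K}

/-- The isomorphism `σ^* δ ∘ F_M⁻¹ : M ⊗ K((z - ζ)) ≅ σ^* D ⊗ K((z - ζ))`. -/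
def hodgePinkIso (M : RigLocalShtuka P) : BaseChange (evA P) M.carrier ≃ₗ[LaurentSeries K]
    BaseChange (evB P) (BaseChange (σB P) M.D) :=
  (M.frobOver (evA' P) (evA P) (evA'_loc P)).symm ≪≫ₗ
    swap (σA P) (evA P) (ιA P) (evσ P) (fun x => (evσ_ιA P x).symm) M.carrier ≪≫ₗ
    mapEquiv (evσ P) M.δ ≪≫ₗ
    swap (ιB P) (evσ P) (σB P) (evB P) (evσ_ιB P) M.D

lemma hodgePinkIso_map {M N : RigLocalShtuka P} (f : M ⟶ N)
    (x : BaseChange (evA P) M.carrier) : N.hodgePinkIso (map (evA P) f.toLin x) =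
      map (evB P) (map (σB P) (map (redA P) f.toLin)) (M.hodgePinkIso x) := by
  have h1 : (N.frobOver (evA' P) (evA P) (evA'_loc P)).symm (map (evA P) f.toLin x) =
      map (evA P) (map (σA P) f.toLin) ((M.frobOver (evA' P) (evA P) (evA'_loc P)).symm x) := by
    rw [LinearEquiv.symm_apply_eq, f.frobOver, LinearEquiv.apply_symm_apply]
  have h2 : ∀ y, map (evσ P) N.δ.toLinearMap (map (evσ P) (map (ιA P) f.toLin) y) =
      map (evσ P) (map (ιB P) (map (redA P) f.toLin)) (map (evσ P) M.δ.toLinearMap y) :=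
    fun y => by
      rw [map_comp_apply, map_comp_apply]
      exact map_congr (evσ P) f.comm_δ y
  simp only [hodgePinkIso, LinearEquiv.trans_apply, h1, swap_map, mapEquiv_apply, h2]

variable (P) in
/-- The lattice `M ⊗ K[[z - ζ]]` in `M ⊗ K((z - ζ))`. -/
def lattice (M : Type u) [AddCommGroup M] [Module (OKz K) M] :
    Submodule (PowerSeries K) (BaseChange (evA P) M) :=
  Submodule.span (PowerSeries K) (Set.range fun m : M => BaseChange.mk (evA P) m)

lemma fg_lattice (M : Type u) [AddCommGroup M] [Module (OKz K) M] [Module.Finite (OKz K) M] :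
    (lattice P M).FG := by
  classical
  obtain ⟨s, hs⟩ := Module.Finite.fg_top (R := OKz K) (M := M)
  refine ⟨s.image (BaseChange.mk (evA P)), le_antisymm ?_ ?_⟩
  · refine Submodule.span_le.2 fun x hx => ?_
    obtain ⟨m, -, rfl⟩ := Finset.mem_image.1 (Finset.mem_coe.1 hx)
    exact Submodule.subset_span ⟨m, rfl⟩
  · refine Submodule.span_le.2 ?_
    rintro _ ⟨m, rfl⟩
    have hm : m ∈ Submodule.span (OKz K) (s : Set M) := hs ▸ Submodule.mem_top
    induction hm using Submodule.span_induction with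
    | mem x hx => exact Submodule.subset_span (by simpa using ⟨x, hx, rfl⟩)
    | zero => simp
    | add x y _ _ hx hy =>
      simp only [map_add]
      exact add_mem hx hy
    | smul a x _ hx =>
      simp only [LinearMap.map_smulₛₗ]
      exact Submodule.smul_mem _ (Annulus.ev (toAnnulus P a)) hx

lemma map_mem_lattice {M N : Type u} [AddCommGroup M] [Module (OKz K) M] [AddCommGroup N]
    [Module (OKz K) N] (f : M →ₗ[OKz K] N) {x : BaseChange (evA P) M} (hx : x ∈ lattice P M) :
    map (evA P) f x ∈ lattice P N := by
  have h : lattice P M ≤ (lattice P N).comap (overPowerSeries (map (evA P) f)) := by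
    refine Submodule.span_le.2 ?_
    rintro _ ⟨m, rfl⟩
    exact Submodule.subset_span ⟨f m, (BaseChange.map_mk _ _ _).symm⟩
  exact h hx

/-- The lattice `q = σ^* δ ∘ F_M⁻¹ (M ⊗ K[[z - ζ]])`. -/
def q (M : RigLocalShtuka P) :
    Submodule (PowerSeries K) (BaseChange (evB P) (BaseChange (σB P) M.D)) :=
  (lattice P M.carrier).map (overPowerSeries M.hodgePinkIso.toLinearMap)

lemma span_q (M : RigLocalShtuka P) : Submodule.span (LaurentSeries K)
    (M.q : Set (BaseChange (evB P) (BaseChange (σB P) M.D))) = ⊤ := by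
  have h1 : (M.q : Set (BaseChange (evB P) (BaseChange (σB P) M.D))) =
      M.hodgePinkIso.toLinearMap '' (lattice P M.carrier) := rfl
  have h2 : Submodule.span (LaurentSeries K) 
      (lattice P M.carrier : Set (BaseChange (evA P) M.carrier)) = ⊤ := by
    rw [eq_top_iff, ← BaseChange.span_mk]
    exact Submodule.span_mono Submodule.subset_span
  rw [h1, Submodule.span_image, h2, Submodule.map_top, LinearEquiv.range]

variable (P) in
/-- The functor `H` from rigidified local shtukas over `O_K` to `z`-isocrystals with Hodge-Pink
structure over `K`. -/
def H : RigLocalShtuka P ⥤ HPIsocrystal P where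
  obj M :=
    { carrier := M.D
      finite := BaseChange.finite _
      frob := M.frobD
      q := M.q
      fg_q := (fg_lattice _).map _
      span_q := M.span_q }
  map {M N} f :=
    { toLin := map (redA P) f.toLin
      comm := f.frobD
      map_q := by
        rintro _ ⟨x, hx, rfl⟩
        exact ⟨map (evA P) f.toLin x, map_mem_lattice _ hx, hodgePinkIso_map f x⟩ }
  map_id M := HPIsocrystal.Hom.ext (BaseChange.map_id _)
  map_comp f g := HPIsocrystal.Hom.ext (BaseChange.map_comp _ _ _)

/-- `H` maps isogenies to isomorphisms. -/
lemma isogeny_isInvertedBy : (isogeny P).IsInvertedBy (H P) := by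
  rintro M N f ⟨g, n, h1, h2⟩
  have hX : redA P (PowerSeries.X ^ n) = HahnSeries.single (n : ℤ) 1 := by
    rw [map_pow, redA_X, HahnSeries.single_pow]
    simp
  have hs : (HahnSeries.single (-n : ℤ) 1 : kz K) * HahnSeries.single (n : ℤ) 1 = 1 := by
    rw [HahnSeries.single_mul_single]
    simp
  have key : ∀ {A B : RigLocalShtuka P} (a : A ⟶ B) (b : B ⟶ A),
      (a ≫ b).toLin = (PowerSeries.X : OKz K) ^ n • LinearMap.id →
      (HahnSeries.single (-n : ℤ) 1 : kz K) •
        (map (redA P) b.toLin ∘ₗ map (redA P) a.toLin) = LinearMap.id := by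
    intro A B a b h
    rw [← BaseChange.map_comp, ← comp_toLin, h, BaseChange.map_smul', hX, smul_smul, hs,
      one_smul, BaseChange.map_id]
  refine ⟨HPIsocrystal.Hom.zsmul ((H P).map g) (-n), HPIsocrystal.Hom.ext ?_,
    HPIsocrystal.Hom.ext ?_⟩
  · exact (key f g h1 :)
  · exact (LinearMap.comp_smul _ _ _).trans (key g f h2)

end RigLocalShtuka

variable (P : Base F K)

/-- The category of rigidified local shtukas over `O_K` up to isogeny: the localization of the
category of rigidified local shtukas at the isogenies. -/
abbrev RigLocalShtukaUpToIsogeny : Type (u + 1) := (RigLocalShtuka.isogeny P).Localization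

/-- The functor induced by `H` on the category of rigidified local shtukas up to isogeny. -/
def HUpToIsogeny : RigLocalShtukaUpToIsogeny P ⥤ HPIsocrystal P :=
  Localization.Construction.lift (RigLocalShtuka.H P) RigLocalShtuka.isogeny_isInvertedBy

end HodgePink

end

set_option linter.unusedSectionVars false

namespace HodgePink

variable {F : Type v} {K : Type u} [Field F] [Fintype F] [NormedField K] [IsUltrametricDist K]
  [Algebra F (OK K)] {P : Base F K}

/-! ### Gauss norms on `O_K[[z, z⁻¹}`. -/

namespace Annulus

/-! Call a matrix over `O_K[[z, z⁻¹}[t⁻¹]` holomorphic if its entries lie in `O_K[[z, z⁻¹}`, that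
is, if it has no pole at the zeros `ζ^{q^i}` of `t` in the punctured disc. A morphism `M → N` of
rigidified local shtukas with reduction `g : D_M → D_N` must become `f = δ_N⁻¹ ∘ g ∘ δ_M` over
`O_K[[z, z⁻¹}[t⁻¹]`. As `t` is not a zero divisor, `O_K[[z]]` embeds in this ring, so `H` is
faithful (`H_map_injective`). For fullness one starts from a `g` that respects Frobenius and the
Hodge-Pink lattices and shows that `z^r f` is defined over `O_K[[z]]` for some `r`
(`exists_map_ιA_eq_smul`).

Both hypotheses on `g` translate into matrices. Compatibility with Frobenius says `f = A σ(f) B`,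
where `A` and `B` are the matrices of `F_N` and `F_M⁻¹`, with denominators powers of `z - ζ`.
Compatibility with the lattices says that `A σ(f) B`, expanded at `z = ζ`, has entries in `K[[z -
ζ]]`; so `f` has no pole at `ζ`. Frobenius propagates this: if `s f` is holomorphic, the equation
shows that `σ(s) f` is holomorphic except perhaps at `ζ`, and regularity at `ζ` removes that pole
(`exists_map_eq_σ_smul`). Starting from `s = t^r`, all `σ^k(t)^r f` are holomorphic. Since `t =
∏_{i<k} (1 - ζ^{q^i}/z) · σ^k(t)` and `σ^k(t)` tends to `1`, these matrices converge to a
holomorphic limit, which is `f` itself. A maximum principle for division by `1 - x/z` keeps the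
Gauss norms of the limit finite (`exists_eq_t_pow_mul`).

It remains to exclude an essential singularity at `z = 0`. Coefficients of very negative index are
small, and `σ` raises them to the `q`-th power. This gain beats the bounded loss from dividing by a
power of `z - ζ`, so in `f = A σ(f) B` the far part of the principal part is contracted onto itself
and vanishes (`exists_coeff_eq_zero_of_frobenius`). Hence `f` has at most a pole at `0`, and some
`z^r f` is a morphism of rigidified local shtukas that reduces to `z^r g`.

Multiplication by `z^r` is an isogeny, so `g` lifts after localization. Conversely every morphism up
to isogeny becomes an honest one after composition with a power of `z` (`exists_zPow_comp_eq`),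
which reduces faithfulness on the localized category to faithfulness of `H`. -/

lemma one_le_zpow_of_nonpos (P : Base F K) {i : ℤ} (hi : i ≤ 0) : 1 ≤ ‖(P.ζ : K)‖ ^ i :=
  one_le_zpow_of_nonpos₀ P.norm_pos P.norm_ζ_lt_one.le hi

lemma zpow_ζ_anti (P : Base F K) {i j : ℤ} (h : i ≤ j) :
    ‖(P.ζ : K)‖ ^ j ≤ ‖(P.ζ : K)‖ ^ i :=
  zpow_le_zpow_right_of_le_one₀ P.norm_pos P.norm_ζ_lt_one.le h

/-- Every Gauss norm of an element of `O_K[[z, z⁻¹}` is finite. -/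
lemma exists_norm_coeff_le (a : Annulus P) (r : ℕ) :
    ∃ B : ℝ, ∀ i : ℤ, ‖a.coeff i‖ ≤ B * ‖(P.ζ : K)‖ ^ (-(r * i)) := by
  have hp := P.norm_pos
  -- The exponent is `r + 1` because `decay` needs a positive one, while `r = 0` is allowed. For `i
  -- ≤ 0` the bound for `r + 1` implies the one for `r`.
  obtain ⟨N, hN⟩ := eventually_atBot.1 (decay_iff.1 a.decay (r + 1) (by positivity) 1 one_pos)
  -- The second constant serves the indices above the threshold, where only integrality of the
  -- coefficient is used.
  refine ⟨max 1 (‖(P.ζ : K)‖ ^ (r * min N 0)), fun i => ?_⟩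
  have hpos : 0 < ‖(P.ζ : K)‖ ^ (-(r * i)) := by positivity
  rcases le_total i (min N 0) with h | h
  · have h1 := hN i (h.trans (min_le_left _ _))
    have h2 : ‖(P.ζ : K)‖ ^ ((r + 1 : ℝ) * i) = ‖(P.ζ : K)‖ ^ (((r + 1 : ℕ) : ℤ) * i) := by
      rw [← Real.rpow_intCast]
      push_cast
      rfl
    rw [h2] at h1
    have h3 : ‖(P.ζ : K)‖ ^ ((r : ℤ) * i) ≤ ‖(P.ζ : K)‖ ^ (((r + 1 : ℕ) : ℤ) * i) := by
      refine zpow_ζ_anti P ?_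
      have := h.trans (min_le_right _ _)
      push_cast
      linarith
    have h4 : ‖a.coeff i‖ * ‖(P.ζ : K)‖ ^ ((r : ℤ) * i) ≤ 1 :=
      (mul_le_mul_of_nonneg_left h3 (norm_nonneg _)).trans h1
    calc ‖a.coeff i‖ ≤ 1 * ‖(P.ζ : K)‖ ^ (-(r * i)) := by
          rw [zpow_neg, ← div_eq_mul_inv, le_div_iff₀ (by positivity)]
          exact h4
      _ ≤ _ := mul_le_mul_of_nonneg_right (le_max_left _ _) hpos.le
  · refine (norm_le_one _).trans ?_
    calc (1 : ℝ) ≤ ‖(P.ζ : K)‖ ^ (r * min N 0) * ‖(P.ζ : K)‖ ^ (-(r * i)) := by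
          rw [← zpow_add₀ hp.ne']
          refine one_le_zpow_of_nonpos P ?_
          have : (r : ℤ) * min N 0 ≤ r * i := mul_le_mul_of_nonneg_left h (by positivity)
          linarith
      _ ≤ _ := mul_le_mul_of_nonneg_right (le_max_right _ _) hpos.le

/-- A bilateral series all of whose Gauss norms are finite lies in `O_K[[z, z⁻¹}`. -/
def ofBounded (b : ℤ → OK K)
    (h : ∀ r : ℕ, ∃ B : ℝ, ∀ i : ℤ, i ≤ 0 → ‖b i‖ ≤ B * ‖(P.ζ : K)‖ ^ (-(r * i))) : Annulus P where
  coeff := b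
  decay r hr := by
    have hp := P.norm_pos
    -- A strictly larger integral exponent turns boundedness into decay: since `R ≥ r + 1`, the
    -- spare factor is at most `|ζ|^{-i}` for `i ≤ 0`.
    obtain ⟨R, hR⟩ := exists_nat_ge (r + 1)
    obtain ⟨B, hB⟩ := h R
    have h0 : Tendsto (fun i : ℤ => ‖(P.ζ : K)‖ ^ (-i).toNat) atBot (𝓝 0) := by
      refine (tendsto_pow_atTop_nhds_zero_of_lt_one hp.le P.norm_ζ_lt_one).comp ?_
      refine tendsto_atTop.2 fun n => ?_
      filter_upwards [eventually_le_atBot (-(n : ℤ))] with i hi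
      omega
    have h1 := h0.const_mul |B|
    rw [mul_zero] at h1
    refine squeeze_zero' (.of_forall fun _ => by positivity) ?_ h1
    filter_upwards [eventually_le_atBot 0] with i hi
    have hi' : (i : ℝ) ≤ 0 := by exact_mod_cast hi
    calc ‖(b i : K)‖ * ‖(P.ζ : K)‖ ^ (r * i)
        ≤ |B| * ‖(P.ζ : K)‖ ^ (-(R * i : ℤ)) * ‖(P.ζ : K)‖ ^ (r * i) := by
          refine mul_le_mul_of_nonneg_right ?_ (by positivity)
          exact (hB i hi).trans (mul_le_mul_of_nonneg_right (le_abs_self _) (by positivity))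
      _ = |B| * ‖(P.ζ : K)‖ ^ ((r - R) * i : ℝ) := by
          rw [mul_assoc, ← Real.rpow_intCast, ← Real.rpow_add hp]
          congr 2
          push_cast
          ring
      _ ≤ |B| * ‖(P.ζ : K)‖ ^ (-i).toNat := by
          refine mul_le_mul_of_nonneg_left ?_ (abs_nonneg _)
          rw [← Real.rpow_natCast]
          refine Real.rpow_le_rpow_of_exponent_ge hp P.norm_ζ_lt_one.le ?_
          have : (((-i).toNat : ℕ) : ℝ) = -i := by
            exact_mod_cast Int.toNat_of_nonneg (by omega : 0 ≤ -i)
          rw [this]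
          nlinarith

variable [CompleteSpace K]

lemma coeff_one_sub_mono_mul (x : OK K) (a : Annulus P) (i : ℤ) :
    ((1 - mono (-1) x) * a).coeff i = a.coeff i - x * a.coeff (i + 1) := by
  rw [mul_comm, mul_sub, mul_one, coeff_sub, coeff_mul_mono, sub_neg_eq_add, mul_comm x]

lemma coeff_zSubζ_mul (a : Annulus P) (i : ℤ) :
    (toAnnulus P (zSubζ P) * a).coeff i = a.coeff (i - 1) - P.ζ * a.coeff i := by
  rw [zSubζ, map_sub, toAnnulus_X, toAnnulus_C, mul_comm, mul_sub, coeff_sub, coeff_mul_mono,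
    coeff_mul_mono, mul_one, sub_zero, mul_comm P.ζ]

/-- Division by `1 - x / z` does not increase the Gauss norm on a circle of radius `≥ |x|`. -/
lemma norm_coeff_le_of_one_sub_mono_mul {x : OK K} {r : ℕ} (hx : ‖x‖ ≤ ‖(P.ζ : K)‖ ^ r)
    (hx1 : ‖x‖ < 1) {B : ℝ} {a : Annulus P}
    (h : ∀ i : ℤ, ‖((1 - mono (-1) x) * a).coeff i‖ ≤ B * ‖(P.ζ : K)‖ ^ (-(r * i))) (i : ℤ) :
    ‖a.coeff i‖ ≤ B * ‖(P.ζ : K)‖ ^ (-(r * i)) := by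
  have hp := P.norm_pos
  -- With `c = (1 - x/z) a` one has `a_i = c_i + x a_{i+1}`. After `n` iterations the remainder is
  -- `x^n` times a coefficient of `a`, hence of norm at most `|x|^n`. The other terms obey the bound
  -- because the shift from `i` to `i + 1` costs exactly `|ζ|^{-r}`, and `|x| ≤ |ζ|^r`.
  have key : ∀ (n : ℕ) (i : ℤ),
      ‖a.coeff i‖ ≤ max (B * ‖(P.ζ : K)‖ ^ (-(r * i))) (‖x‖ ^ n) := by
    intro n
    induction n with
    | zero => exact fun i => (norm_le_one _).trans (by simp)
    | succ n ih =>
      intro i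
      have h1 : a.coeff i = ((1 - mono (-1) x) * a).coeff i + x * a.coeff (i + 1) := by
        rw [coeff_one_sub_mono_mul]; ring
      rw [h1]
      refine (IsUltrametricDist.norm_add_le_max _ _).trans (max_le ((h i).trans (le_max_left _ _)) ?_)
      rw [norm_mul']
      rcases le_max_iff.1 (ih (i + 1)) with h2 | h2
      · refine le_trans ?_ (le_max_left _ _)
        have hB : 0 ≤ B := by
          have := (norm_nonneg _).trans h2
          exact nonneg_of_mul_nonneg_left this (by positivity)
        calc ‖x‖ * ‖a.coeff (i + 1)‖
            ≤ ‖(P.ζ : K)‖ ^ r * (B * ‖(P.ζ : K)‖ ^ (-(r * (i + 1)))) :=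
              mul_le_mul hx h2 (norm_nonneg _) (by positivity)
          _ = B * (‖(P.ζ : K)‖ ^ (r : ℤ) * ‖(P.ζ : K)‖ ^ (-(r * (i + 1)))) := by
              rw [zpow_natCast]; ring
          _ = _ := by
              rw [← zpow_add₀ hp.ne']
              congr 2
              ring
      · refine le_trans ?_ (le_max_right _ _)
        rw [pow_succ']
        exact mul_le_mul_of_nonneg_left h2 (norm_nonneg _)
  have hlim := (tendsto_const_nhds (x := B * ‖(P.ζ : K)‖ ^ (-(r * i)))).max
    (tendsto_pow_atTop_nhds_zero_of_lt_one (norm_nonneg x) hx1)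
  have h3 := ge_of_tendsto' hlim fun n => key n i
  refine h3.trans (max_le le_rfl ?_)
  exact (norm_nonneg _).trans (h i)

lemma norm_coeff_le_of_one_sub_mono_pow_mul {x : OK K} {r : ℕ} (hx : ‖x‖ ≤ ‖(P.ζ : K)‖ ^ r)
    (hx1 : ‖x‖ < 1) {B : ℝ} (n : ℕ) {a : Annulus P}
    (h : ∀ i : ℤ, ‖((1 - mono (-1) x) ^ n * a).coeff i‖ ≤ B * ‖(P.ζ : K)‖ ^ (-(r * i))) (i : ℤ) :
    ‖a.coeff i‖ ≤ B * ‖(P.ζ : K)‖ ^ (-(r * i)) := by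
  induction n generalizing a i with
  | zero => simpa using h i
  | succ n ih =>
    refine norm_coeff_le_of_one_sub_mono_mul hx hx1 (fun j => ih ?_ j) i
    simpa only [pow_succ, mul_assoc] using h

/-! ### Division by `z - ζ` -/

lemma zc_zero (i : ℤ) : zc P 0 i = (P.ζ : K) ^ i := by
  have h := map_zpow (Units.map (PowerSeries.constantCoeff (R := K)).toMonoidHom) (zUnit P) i
  have h1 := congrArg Units.val h
  have h2 : Units.map (PowerSeries.constantCoeff (R := K)).toMonoidHom (zUnit P) =
      Units.mk0 (P.ζ : K) (norm_pos_iff.1 P.norm_pos) := by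
    ext
    simp [val_zUnit]
  rw [h2, Units.val_zpow_eq_zpow_val] at h1
  rw [zc, PowerSeries.coeff_zero_eq_constantCoeff_apply]
  exact h1

lemma ev_zSubζ : ev (toAnnulus P (zSubζ P)) = PowerSeries.X := by
  rw [zSubζ, map_sub, map_sub, toAnnulus_X, toAnnulus_C, ev_mono, ev_mono, zpow_one, zpow_zero,
    val_zUnit]
  simp

/-- The quotient has `ζ^{-i} ∑_{j ≥ i} a_j ζ^j` as its coefficient of `z^{i-1}`. This tail sum is at
most `|ζ|^i`, which makes the coefficient integral. As the full sum is the value of `a` at `ζ`,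
hence zero, the tail is also minus the sum over `j < i`, and this second form gives the decay for `i
→ -∞`. -/
lemma exists_eq_zSubζ_mul {a : Annulus P} (h : PowerSeries.constantCoeff (ev a) = 0) :
    ∃ b, a = toAnnulus P (zSubζ P) * b := by
  have hp := P.norm_pos
  have hz : (P.ζ : K) ≠ 0 := norm_pos_iff.1 hp
  set f : ℤ → K := fun j => (a.coeff j : K) * (P.ζ : K) ^ j with hf
  have hf0 : Summable f := by simpa only [zc_zero] using summable_ev a 0
  have hf1 : ∑' j, f j = 0 := by
    rw [← PowerSeries.coeff_zero_eq_constantCoeff_apply, coeff_ev] at h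
    simpa only [zc_zero] using h
  have : NonarchimedeanRing K := nonarchRing
  let S : ℤ → K := fun i => ∑' j, Set.indicator {j | i ≤ j} f j
  have hsum : ∀ s : Set ℤ, Summable (s.indicator f) := fun s => by
    refine NonarchimedeanAddGroup.summable_of_tendsto_cofinite_zero ?_
    refine squeeze_zero_norm (fun j => norm_indicator_le_norm_self f j) ?_
    exact tendsto_zero_iff_norm_tendsto_zero.1 hf0.tendsto_cofinite_zero
  have hS : ∀ i, S i = f i + S (i + 1) := fun i => by
    have h1 : Set.indicator {j | i ≤ j} f =
        fun j => Set.indicator {i} f j + Set.indicator {j | i + 1 ≤ j} f j := by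
      ext j
      rcases lt_trichotomy j i with h | h | h
      · simp [Set.indicator, h.ne, not_le.2 h, not_lt.2 h.le]
      · simp [Set.indicator, h]
      · simp [Set.indicator, h, h.ne', h.le]
    simp only [S]
    rw [h1, (hsum _).tsum_add (hsum _)]
    congr 1
    rw [tsum_eq_single i]
    · simp
    · intro j hj
      simp [hj]
  have hS1 : ∀ i, ‖S i‖ ≤ ‖(P.ζ : K)‖ ^ i := fun i => by
    refine IsUltrametricDist.norm_tsum_le_of_forall_le_of_nonneg (by positivity) fun j => ?_
    by_cases hj : i ≤ j
    · rw [Set.indicator_of_mem (s := {j | i ≤ j}) hj, norm_mul, norm_zpow]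
      exact (mul_le_of_le_one_left (by positivity) (norm_le_one _)).trans (zpow_ζ_anti P hj)
    · rw [Set.indicator_of_notMem (s := {j | i ≤ j}) hj, norm_zero]
      positivity
  have hS2 : ∀ i, S i = - ∑' j, Set.indicator {j | j < i} f j := fun i => by
    rw [eq_neg_iff_add_eq_zero, ← (hsum _).tsum_add (hsum _), ← hf1]
    congr 1
    ext1 j
    rcases lt_or_ge j i with h | h
    · simp [Set.indicator, h, not_le.2 h]
    · simp [Set.indicator, h, not_lt.2 h]
  have hmem : ∀ i, (P.ζ : K) ^ (-i) * S i ∈ OK K := fun i => mem_OK.2 <| by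
    rw [norm_mul, norm_zpow]
    calc _ ≤ ‖(P.ζ : K)‖ ^ (-i) * ‖(P.ζ : K)‖ ^ i :=
          mul_le_mul_of_nonneg_left (hS1 i) (by positivity)
      _ = 1 := by rw [← zpow_add₀ hp.ne']; simp
  let b : ℤ → OK K := fun i => ⟨_, hmem i⟩
  have hb : ∀ r : ℕ, ∃ B : ℝ, ∀ i : ℤ, i ≤ 0 → ‖b i‖ ≤ B * ‖(P.ζ : K)‖ ^ (-(r * i)) := by
    intro r
    -- One extra power of `|ζ|` pays for the factor `ζ^j` in the terms of the sum.
    obtain ⟨B, hB⟩ := exists_norm_coeff_le a (r + 1)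
    have hB0 : 0 ≤ B := by
      have := (norm_nonneg _).trans (hB 0)
      exact nonneg_of_mul_nonneg_left this (by positivity)
    refine ⟨B, fun i hi => ?_⟩
    have h1 : ‖S i‖ ≤ B * ‖(P.ζ : K)‖ ^ (-(r * i)) * ‖(P.ζ : K)‖ ^ i := by
      rw [hS2, norm_neg]
      refine IsUltrametricDist.norm_tsum_le_of_forall_le_of_nonneg (by positivity) fun j => ?_
      by_cases hj : j < i
      · rw [Set.indicator_of_mem (s := {j | j < i}) hj, norm_mul, norm_zpow]
        calc _ ≤ B * ‖(P.ζ : K)‖ ^ (-(((r + 1 : ℕ) : ℤ) * j)) * ‖(P.ζ : K)‖ ^ j :=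
              mul_le_mul_of_nonneg_right (hB j) (by positivity)
          _ = B * ‖(P.ζ : K)‖ ^ (-(r * j)) := by
              rw [mul_assoc, ← zpow_add₀ hp.ne']
              congr 2
              push_cast
              ring
          _ ≤ B * ‖(P.ζ : K)‖ ^ (-(r * i)) := by
              refine mul_le_mul_of_nonneg_left (zpow_ζ_anti P ?_) hB0
              have := mul_le_mul_of_nonneg_left hj.le (Int.natCast_nonneg r)
              linarith
          _ ≤ _ := le_mul_of_one_le_right (by positivity) (one_le_zpow_of_nonpos P hi)
      · rw [Set.indicator_of_notMem (s := {j | j < i}) hj, norm_zero]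
        positivity
    change ‖(P.ζ : K) ^ (-i) * S i‖ ≤ _
    rw [norm_mul, norm_zpow, zpow_neg, inv_mul_le_iff₀ (by positivity), mul_comm]
    exact h1
  -- The factor `z⁻¹` shifts the index: `b_i` is the coefficient of `z^{i-1}` in the quotient.
  refine ⟨ofBounded b hb * mono (-1) 1, ?_⟩
  ext i : 2
  have h1 : ((a.coeff i : OK K) : K) =
      (P.ζ : K) ^ (-i) * S i - P.ζ * ((P.ζ : K) ^ (-(i + 1)) * S (i + 1)) := by
    rw [hS i, hf, ← mul_assoc (P.ζ : K), ← zpow_one_add₀ hz, show 1 + -(i + 1) = -i by ring,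
      mul_add, add_sub_cancel_right, mul_left_comm, ← zpow_add₀ hz, neg_add_cancel, zpow_zero,
      mul_one]
  rw [coeff_zSubζ_mul, coeff_mul_mono, coeff_mul_mono, mul_one, mul_one, sub_neg_eq_add,
    sub_neg_eq_add, sub_add_cancel]
  exact Subtype.ext h1

lemma exists_eq_zSubζ_pow_mul (n : ℕ) {a : Annulus P} (h : PowerSeries.X ^ n ∣ ev a) :
    ∃ b, a = toAnnulus P (zSubζ P) ^ n * b := by
  induction n generalizing a with
  | zero => exact ⟨a, by simp⟩
  | succ n ih =>
    obtain ⟨b, rfl⟩ := exists_eq_zSubζ_mul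
      (PowerSeries.X_dvd_iff.1 ((dvd_pow_self _ n.succ_ne_zero).trans h))
    rw [map_mul, ev_zSubζ, pow_succ', mul_dvd_mul_iff_left PowerSeries.X_ne_zero] at h
    obtain ⟨c, rfl⟩ := ih h
    exact ⟨c, by rw [pow_succ', mul_assoc]⟩

/-! ### The ideals of series with small coefficients -/

/-- The ideal of the series all of whose coefficients have norm at most `ε`. -/
def smallIdeal (P : Base F K) (ε : ℝ) (hε : 0 ≤ ε) : Ideal (Annulus P) where
  carrier := {a | ∀ i, ‖a.coeff i‖ ≤ ε}
  add_mem' ha hb i := (IsUltrametricDist.norm_add_le_max _ _).trans (max_le (ha i) (hb i))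
  zero_mem' i := by simpa using hε
  smul_mem' c a ha i := by
    rw [smul_eq_mul, coeff_mul]
    refine IsUltrametricDist.norm_tsum_le_of_forall_le_of_nonneg hε fun j => ?_
    rw [norm_mul']
    exact (mul_le_of_le_one_left (norm_nonneg _) (norm_le_one _)).trans (ha _)

/-- `ζ^m O_K[[z, z⁻¹}`, as a closed ideal. -/
abbrev ζIdeal (P : Base F K) (m : ℕ) : Ideal (Annulus P) :=
  smallIdeal P (‖(P.ζ : K)‖ ^ m) (by positivity)

lemma eq_zero_of_forall_mem_ζIdeal {a : Annulus P} (h : ∀ m, a ∈ ζIdeal P m) : a = 0 := by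
  ext i : 2
  refine norm_eq_zero.1 (le_antisymm ?_ (norm_nonneg _))
  exact ge_of_tendsto' (tendsto_pow_atTop_nhds_zero_of_lt_one P.norm_pos.le P.norm_ζ_lt_one)
    fun m => h m i

lemma ζIdeal_anti {m n : ℕ} (h : m ≤ n) : ζIdeal P n ≤ ζIdeal P m := fun _ ha i =>
  (ha i).trans (pow_le_pow_of_le_one P.norm_pos.le P.norm_ζ_lt_one.le h)

lemma norm_ζ_pow_q_le (m : ℕ) : ‖P.ζ ^ Fintype.card F ^ m‖ ≤ ‖(P.ζ : K)‖ ^ m := by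
  rw [norm_pow']
  exact pow_le_pow_of_le_one P.norm_pos.le P.norm_ζ_lt_one.le (Nat.lt_pow_self one_lt_q).le

lemma norm_ζ_pow_q_lt_one (m : ℕ) : ‖P.ζ ^ Fintype.card F ^ m‖ < 1 := by
  rw [norm_pow']
  exact pow_lt_one₀ P.norm_pos.le P.norm_ζ_lt_one (pow_ne_zero _ Fintype.card_ne_zero)

lemma mono_mem_ζIdeal (d : ℤ) (m : ℕ) :
    mono d (P.ζ ^ Fintype.card F ^ m) ∈ ζIdeal P m := fun i => by
  rw [coeff_mono]
  split_ifs
  · exact norm_ζ_pow_q_le m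
  · rw [norm_zero]
    positivity

/-- The limit of a sequence that converges `ζ`-adically is approximated uniformly. -/
lemma sub_mem_ζIdeal_of_tendsto {s : ℕ → Annulus P} (hs : ∀ m, s (m + 1) - s m ∈ ζIdeal P m)
    {a : Annulus P} (ha : ∀ i, Tendsto (fun m => (s m).coeff i) atTop (𝓝 (a.coeff i))) (m : ℕ) :
    a - s m ∈ ζIdeal P m := by
  have h : ∀ k, s (m + k) - s m ∈ ζIdeal P m := fun k => by
    induction k with
    | zero => simp
    | succ k ih =>
      rw [← add_assoc, ← sub_add_sub_cancel _ (s (m + k))]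
      exact add_mem (ζIdeal_anti (Nat.le_add_right m k) (hs _)) ih
  intro i
  have h1 : Tendsto (fun k => ‖(s (m + k) - s m).coeff i‖) atTop (𝓝 ‖(a - s m).coeff i‖) := by
    simp only [coeff_sub]
    have h2 := (ha i).comp (tendsto_add_atTop_nat m)
    simp only [Function.comp_def, add_comm _ m] at h2
    exact (h2.sub_const _).norm
  exact le_of_tendsto' h1 fun k => h k i

lemma t_sub_tPartial_mem (m : ℕ) : t P - tPartial P m ∈ ζIdeal P m := by
  refine sub_mem_ζIdeal_of_tendsto (s := tPartial P) (fun m => ?_) (fun i => tendsto_tCoeff i) m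
  rw [tPartial, tPartial, Finset.prod_range_succ, mul_sub, mul_one, sub_sub_cancel_left]
  exact neg_mem (Ideal.mul_mem_left _ _ (mono_mem_ζIdeal _ _))

/-- All coefficients of `t - 1` have norm at most `|ζ|`. If `a t = 0`, then `a = -(t - 1) a`, so
every bound on the coefficients of `a` improves by the factor `|ζ|`, and `a = 0`. -/
lemma t_mem_nonZeroDivisors : t P ∈ nonZeroDivisors (Annulus P) := by
  rw [mem_nonZeroDivisors_iff_right]
  intro a ha
  have h1 : t P - 1 ∈ ζIdeal P 1 := by
    have h := t_sub_tPartial_mem (P := P) 1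
    have h2 : tPartial P 1 - 1 ∈ ζIdeal P 1 := by
      rw [tPartial, Finset.prod_range_one, sub_sub_cancel_left]
      refine neg_mem fun i => ?_
      rw [coeff_mono]
      split_ifs
      · simp
      · simp
    simpa using add_mem h h2
  refine eq_zero_of_forall_mem_ζIdeal fun m => ?_
  induction m with
  | zero => exact fun i => (norm_le_one _).trans (by simp)
  | succ m ih =>
    have h2 : a = -((t P - 1) * a) := by linear_combination ha
    rw [h2]
    refine neg_mem fun i => ?_
    rw [coeff_mul]
    refine IsUltrametricDist.norm_tsum_le_of_forall_le_of_nonneg (by positivity) fun j => ?_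
    rw [norm_mul', pow_succ']
    exact mul_le_mul (by simpa using h1 j) (ih _) (norm_nonneg _) (by positivity)

/-- If `a` is divisible by all the products `∏_{i < m} (1 - ζ^{q^i} / z)^n`, then it is divisible
by `t^n`. -/
lemma exists_eq_t_pow_mul (n : ℕ) (s : ℕ → Annulus P)
    (hs : ∀ m, s m = (1 - mono (-1) (P.ζ ^ Fintype.card F ^ m)) ^ n * s (m + 1)) :
    ∃ a, s 0 = t P ^ n * a := by
  have hp := P.norm_pos
  -- Since `(1 - x)^n - 1` is a multiple of `x`, consecutive terms differ by a multiple of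
  -- `ζ^{q^m}/z`. Thus the sequence is Cauchy, uniformly in the coefficients.
  have hd : ∀ m, s (m + 1) - s m ∈ ζIdeal P m := fun m => by
    obtain ⟨w, hw⟩ := sub_dvd_pow_sub_pow (1 - mono (-1) (P.ζ ^ Fintype.card F ^ m) : Annulus P) 1 n
    have h1 : s (m + 1) - s m = w * s (m + 1) * mono (-1) (P.ζ ^ Fintype.card F ^ m) := by
      rw [one_pow] at hw
      linear_combination (-1 : Annulus P) * hs m - s (m + 1) * hw
    rw [h1]
    exact Ideal.mul_mem_left _ _ (mono_mem_ζIdeal _ _)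
  have hlim : ∀ i, ∃ c, Tendsto (fun m => (s m).coeff i) atTop (𝓝 c) := fun i => by
    refine cauchySeq_tendsto_of_complete
      (cauchySeq_of_le_geometric ‖(P.ζ : K)‖ 1 P.norm_ζ_lt_one fun m => ?_)
    rw [dist_eq_norm, norm_sub_rev, ← coeff_sub, one_mul]
    exact hd m i
  choose b hb using hlim
  -- For fixed `r`, the factors of index `m ≥ r` have their zero `ζ^{q^m}` in the disc of radius
  -- `|ζ|^r`. Dividing by them does not increase the Gauss norm on that circle, so the bound for `s
  -- r` persists for all later terms and for the limit.
  have hbdd : ∀ r : ℕ, ∃ B : ℝ, ∀ i : ℤ, i ≤ 0 → ‖b i‖ ≤ B * ‖(P.ζ : K)‖ ^ (-(r * i)) := by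
    intro r
    obtain ⟨B, hB⟩ := exists_norm_coeff_le (s r) r
    have h1 : ∀ k i, ‖(s (r + k)).coeff i‖ ≤ B * ‖(P.ζ : K)‖ ^ (-(r * i)) := fun k => by
      induction k with
      | zero => exact hB
      | succ k ih =>
        rw [hs (r + k)] at ih
        refine norm_coeff_le_of_one_sub_mono_pow_mul ?_ (norm_ζ_pow_q_lt_one (r + k)) n ih
        exact (norm_ζ_pow_q_le (P := P) _).trans
          (pow_le_pow_of_le_one hp.le P.norm_ζ_lt_one.le (Nat.le_add_right _ _))
    refine ⟨B, fun i _ => ?_⟩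
    have h2 := (hb i).comp (tendsto_add_atTop_nat r)
    exact le_of_tendsto' h2.norm fun k => by simpa only [Function.comp_apply, add_comm k r] using h1 k i
  refine ⟨ofBounded b hbdd, ?_⟩
  have h0 : ∀ m, s 0 = tPartial P m ^ n * s m := fun m => by
    induction m with
    | zero => simp [tPartial]
    | succ m ih => rw [ih, hs m, tPartial, tPartial, Finset.prod_range_succ, mul_pow, mul_assoc]
  -- Uniform convergence is needed here: modulo each `ζIdeal P m` both `t` and the limit may be
  -- replaced by their `m`-th approximations, for which the identity is `h0`.
  rw [eq_comm, ← sub_eq_zero]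
  refine eq_zero_of_forall_mem_ζIdeal fun m => ?_
  obtain ⟨w, hw⟩ := sub_dvd_pow_sub_pow (t P) (tPartial P m) n
  have h1 : t P ^ n * ofBounded b hbdd - s 0 = w * ofBounded b hbdd * (t P - tPartial P m) +
      tPartial P m ^ n * (ofBounded b hbdd - s m) := by
    linear_combination ofBounded b hbdd * hw - h0 m
  rw [h1]
  exact add_mem (Ideal.mul_mem_left _ _ (t_sub_tPartial_mem m))
    (Ideal.mul_mem_left _ _ (sub_mem_ζIdeal_of_tendsto hd hb m))

/-! ### The principal part -/

/-- The series `a` with `|a_i| ≤ B |ζ|^{-i}` for `i ≤ n`. -/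
def principalBall (P : Base F K) (n : ℤ) (B : ℝ) (hB : 0 ≤ B) : AddSubgroup (Annulus P) where
  carrier := {a | ∀ i ≤ n, ‖a.coeff i‖ ≤ B * ‖(P.ζ : K)‖ ^ (-i)}
  add_mem' ha hb i hi :=
    (IsUltrametricDist.norm_add_le_max _ _).trans (max_le (ha i hi) (hb i hi))
  zero_mem' i _ := by
    rw [coeff_zero, norm_zero]
    positivity
  neg_mem' ha i hi := by
    rw [coeff_neg, norm_neg]
    exact ha i hi

lemma coeff_toAnnulus_of_neg (x : OKz K) {i : ℤ} (hi : i < 0) : (toAnnulus P x).coeff i = 0 := by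
  rw [toAnnulus, RingHom.comp_apply, coeff_ofLaurent, HahnSeries.ofPowerSeries_apply]
  refine HahnSeries.embDomain_of_notMem_range ?_
  rintro ⟨j, hj⟩
  simp at hj
  omega

lemma coeff_toAnnulus_natCast (x : OKz K) (i : ℕ) :
    (toAnnulus P x).coeff i = PowerSeries.coeff i x := by
  rw [toAnnulus, RingHom.comp_apply, coeff_ofLaurent, HahnSeries.ofPowerSeries_apply_coeff]

/-- Multiplication by an integral power series in `z` uses only coefficients of lower or equal
index, and on these the bound `B |ζ|^{-i}` is no weaker. -/
lemma toAnnulus_mul_mem_principalBall {n : ℤ} {B : ℝ} {hB : 0 ≤ B} (x : OKz K) {a : Annulus P}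
    (ha : a ∈ principalBall P n B hB) : toAnnulus P x * a ∈ principalBall P n B hB := by
  intro i hi
  rw [coeff_mul]
  refine IsUltrametricDist.norm_tsum_le_of_forall_le_of_nonneg
    (mul_nonneg hB (zpow_nonneg (norm_nonneg _) _)) fun j => ?_
  rcases lt_or_ge j 0 with hj | hj
  · rw [coeff_toAnnulus_of_neg x hj, zero_mul, norm_zero]
    exact mul_nonneg hB (zpow_nonneg (norm_nonneg _) _)
  · rw [norm_mul']
    refine (mul_le_of_le_one_left (norm_nonneg _) (norm_le_one _)).trans ?_
    exact (ha (i - j) (by omega)).trans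
      (mul_le_mul_of_nonneg_left (zpow_ζ_anti P (by omega)) hB)

/-- Division by `z - ζ` loses only the factor `|ζ|⁻¹`. With `c = (z - ζ) a` one solves `ζ a_i =
a_{i-1} - c_i` and iterates towards `-∞`, staying below the truncation index. -/
lemma mem_principalBall_of_zSubζ_mul {n : ℤ} {B : ℝ} {hB : 0 ≤ B * ‖(P.ζ : K)‖} {hB' : 0 ≤ B}
    {a : Annulus P}
    (ha : toAnnulus P (zSubζ P) * a ∈ principalBall P n (B * ‖(P.ζ : K)‖) hB) :
    a ∈ principalBall P n B hB' := by
  have hp := P.norm_pos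
  -- The remainder after `k` iterations is `|ζ|^{-k} |a_{i-k}|`. Finiteness of the Gauss norm of
  -- radius `|ζ|²` bounds it by a constant times `|ζ|^k`; the radius `|ζ|` would give only
  -- boundedness.
  obtain ⟨G, hG⟩ := exists_norm_coeff_le a 2
  have h1 : ∀ i ≤ n, ‖a.coeff i‖ ≤
      max (B * ‖(P.ζ : K)‖ ^ (-i)) (‖(P.ζ : K)‖⁻¹ * ‖a.coeff (i - 1)‖) := fun i hi => by
    have h2 : P.ζ * a.coeff i = a.coeff (i - 1) - (toAnnulus P (zSubζ P) * a).coeff i := by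
      rw [coeff_zSubζ_mul]; ring
    have h3 : ‖(P.ζ : K)‖ * ‖a.coeff i‖ ≤
        max ‖a.coeff (i - 1)‖ (B * ‖(P.ζ : K)‖ * ‖(P.ζ : K)‖ ^ (-i)) := by
      have h4 : ‖(P.ζ : K)‖ * ‖a.coeff i‖ = ‖P.ζ * a.coeff i‖ := (norm_mul' _ _).symm
      rw [h4, h2, sub_eq_add_neg]
      refine (IsUltrametricDist.norm_add_le_max _ _).trans (max_le_max le_rfl ?_)
      rw [norm_neg]
      exact ha i hi
    rw [mul_comm, ← le_div_iff₀ hp] at h3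
    refine h3.trans ?_
    rw [div_le_iff₀ hp]
    refine max_le ?_ ?_
    · refine le_trans (le_of_eq ?_) (mul_le_mul_of_nonneg_right (le_max_right _ _) hp.le)
      field_simp
    · refine le_trans (le_of_eq ?_) (mul_le_mul_of_nonneg_right (le_max_left _ _) hp.le)
      ring
  have h2 : ∀ (k : ℕ), ∀ i ≤ n, ‖a.coeff i‖ ≤
      max (B * ‖(P.ζ : K)‖ ^ (-i)) ((‖(P.ζ : K)‖⁻¹) ^ k * ‖a.coeff (i - k)‖) := by
    intro k
    induction k with
    | zero => intro i hi; simp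
    | succ k ih =>
      intro i hi
      refine (ih i hi).trans (max_le (le_max_left _ _) ?_)
      have h3 := mul_le_mul_of_nonneg_left (h1 (i - k) (by omega))
        (by positivity : 0 ≤ ‖(P.ζ : K)‖⁻¹ ^ k)
      rw [mul_max_of_nonneg _ _ (by positivity)] at h3
      refine h3.trans (max_le_max (le_of_eq ?_) (le_of_eq ?_))
      · rw [neg_sub, sub_eq_add_neg, zpow_add₀ hp.ne', zpow_natCast, inv_pow]
        field_simp
      · push_cast
        rw [pow_succ, mul_assoc, sub_sub]
  intro i hi
  have h3 : Tendsto (fun k : ℕ => max (B * ‖(P.ζ : K)‖ ^ (-i))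
      (G * ‖(P.ζ : K)‖ ^ (-(2 * i)) * ‖(P.ζ : K)‖ ^ k)) atTop (𝓝 (max (B * ‖(P.ζ : K)‖ ^ (-i))
      (G * ‖(P.ζ : K)‖ ^ (-(2 * i)) * 0))) :=
    tendsto_const_nhds.max
      ((tendsto_pow_atTop_nhds_zero_of_lt_one hp.le P.norm_ζ_lt_one).const_mul _)
  refine (ge_of_tendsto' h3 fun k => (h2 k i hi).trans (max_le_max le_rfl ?_)).trans
    (max_le le_rfl ?_)
  · calc _ ≤ ‖(P.ζ : K)‖⁻¹ ^ k * (G * ‖(P.ζ : K)‖ ^ (-(((2 : ℕ) : ℤ) * (i - k)))) :=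
          mul_le_mul_of_nonneg_left (hG _) (by positivity)
      _ = G * (‖(P.ζ : K)‖ ^ (-(k : ℤ)) * ‖(P.ζ : K)‖ ^ (-(((2 : ℕ) : ℤ) * (i - k)))) := by
          rw [zpow_neg _ (k : ℤ), zpow_natCast, inv_pow, mul_left_comm]
      _ = _ := by
          rw [← zpow_add₀ hp.ne', mul_assoc, ← zpow_natCast _ k, ← zpow_add₀ hp.ne']
          congr 2
          push_cast
          ring
  · rw [mul_zero]
    exact mul_nonneg hB' (zpow_nonneg hp.le _)

lemma mem_principalBall_of_zSubζ_pow_mul (e : ℕ) {n : ℤ} {B : ℝ}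
    {hB : 0 ≤ B * ‖(P.ζ : K)‖ ^ e} {hB' : 0 ≤ B} {a : Annulus P}
    (ha : toAnnulus P (zSubζ P) ^ e * a ∈ principalBall P n (B * ‖(P.ζ : K)‖ ^ e) hB) :
    a ∈ principalBall P n B hB' := by
  have hp := P.norm_pos
  induction e generalizing B a with
  | zero => simpa using ha
  | succ e ih =>
    have hB1 : 0 ≤ B * ‖(P.ζ : K)‖ := by positivity
    refine mem_principalBall_of_zSubζ_mul (hB := hB1) (ih (hB := by positivity) ?_)
    intro i hi
    have h := ha i hi
    rw [pow_succ, mul_assoc] at h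
    exact h.trans (le_of_eq (by ring))

variable {m n : Type*} [Fintype m] [Fintype n]

/-- A matrix over `O_K[[z, z⁻¹}` that satisfies a Frobenius equation
`(z - ζ)^e A = U σ(A) V` over `O_K[[z]]` has no essential singularity at `z = 0`. -/
lemma exists_coeff_eq_zero_of_frobenius (e : ℕ) (A : Matrix n m (Annulus P))
    (U : Matrix n n (OKz K)) (V : Matrix m m (OKz K))
    (h : toAnnulus P (zSubζ P) ^ e • A = U.map (toAnnulus P) * A.map σ * V.map (toAnnulus P)) :
    ∃ N : ℤ, ∀ i j, ∀ k ≤ N, (A i j).coeff k = 0 := by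
  have hp := P.norm_pos
  have hq : 1 < Fintype.card F := one_lt_q
  -- The threshold is chosen so that a coefficient below it shrinks under `σ` by at least `|ζ|^e /
  -- 2`. Division by `(z - ζ)^e` loses `|ζ|^{-e}`, so a factor `1/2` is gained in total.
  have hε : 0 < ‖(P.ζ : K)‖ ^ e / 2 := by positivity
  have h1 : ∀ᶠ k : ℤ in atBot, ∀ i j, ‖(A i j).coeff k‖ ≤ ‖(P.ζ : K)‖ ^ e / 2 ∧
      ‖(A i j).coeff k‖ ≤ 1 * ‖(P.ζ : K)‖ ^ (-k) := by
    refine eventually_all.2 fun i => eventually_all.2 fun j => ?_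
    filter_upwards [(A i j).tendsto_atBot.eventually_lt_const hε,
      decay_iff.1 (A i j).decay 1 one_pos 1 one_pos] with k h1 h2
    refine ⟨h1.le, ?_⟩
    rw [one_mul, Real.rpow_intCast] at h2
    rw [zpow_neg, ← div_eq_mul_inv, le_div_iff₀ (by positivity)]
    exact h2
  obtain ⟨N, hN⟩ := eventually_atBot.1 h1
  -- The index `N` stays fixed during the induction, because multiplication by `U` and `V` and
  -- division by `z - ζ` respect the truncation `k ≤ N`. Letting `s → ∞` makes these coefficients
  -- vanish.
  have h2 : ∀ s : ℕ, ∀ i j, A i j ∈ principalBall P N ((1 / 2) ^ s) (by positivity) := by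
    intro s
    induction s with
    | zero => exact fun i j k hk => by simpa using (hN k hk i j).2
    | succ s ih =>
      intro i j
      have hB : 0 ≤ (1 / 2 : ℝ) ^ (s + 1) * ‖(P.ζ : K)‖ ^ e := by positivity
      have h3 : ∀ i j, σ (A i j) ∈ principalBall P N _ hB := fun i j k hk => by
        rw [coeff_σ, norm_pow', ← Nat.sub_add_cancel hq.le, pow_succ]
        have h4 : ‖(A i j).coeff k‖ ^ (Fintype.card F - 1) ≤ ‖(P.ζ : K)‖ ^ e / 2 :=
          (pow_le_of_le_one (norm_nonneg _) (norm_le_one _) (by omega)).trans (hN k hk i j).1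
        calc _ ≤ (‖(P.ζ : K)‖ ^ e / 2) * ((1 / 2) ^ s * ‖(P.ζ : K)‖ ^ (-k)) :=
              mul_le_mul h4 (ih i j k hk) (norm_nonneg _) hε.le
          _ = _ := by ring
      refine mem_principalBall_of_zSubζ_pow_mul e (hB := hB) ?_
      have h4 := congrFun (congrFun h i) j
      rw [Matrix.smul_apply, smul_eq_mul] at h4
      rw [h4, Matrix.mul_apply]
      refine sum_mem fun l _ => ?_
      have h5 : (U.map (toAnnulus P) * A.map σ) i l ∈ principalBall P N _ hB := by
        rw [Matrix.mul_apply]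
        exact sum_mem fun l' _ => toAnnulus_mul_mem_principalBall _ (h3 _ _)
      have h6 := toAnnulus_mul_mem_principalBall (V l j) h5
      rwa [mul_comm (toAnnulus P (V l j))] at h6
  refine ⟨N, fun i j k hk => norm_eq_zero.1 (le_antisymm ?_ (norm_nonneg _))⟩
  have h3 := (tendsto_pow_atTop_nhds_zero_of_lt_one (by norm_num : (0 : ℝ) ≤ 1 / 2)
    (by norm_num)).mul_const (‖(P.ζ : K)‖ ^ (-k))
  rw [zero_mul] at h3
  exact ge_of_tendsto' h3 fun s => h2 s i j k hk

end Annulus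

end HodgePink

/-! ### Bases and matrices of base changes. -/

namespace HodgePink

namespace BaseChange

open Module

variable {R S S' T : Type u} [CommRing R] [CommRing S] [CommRing S'] [CommRing T]
variable {M N : Type u} [AddCommGroup M] [AddCommGroup N] [Module R M] [Module R N]
variable {m n : Type*}

/-- The basis `1 ⊗ b_i` of a base change. -/
noncomputable def basis (φ : R →+* S) (b : Basis m R M) : Basis m S (BaseChange φ M) :=
  (Algebra.TensorProduct.basis (Along φ) b : Basis m (Along φ) (TensorProduct R (Along φ) M))

@[simp] lemma basis_apply (φ : R →+* S) (b : Basis m R M) (i : m) : basis φ b i = mk φ (b i) :=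
  Algebra.TensorProduct.basis_apply (A := Along φ) b i

lemma basis_repr_mk (φ : R →+* S) (b : Basis m R M) (x : M) (i : m) :
    (basis φ b).repr (mk φ x) i = φ (b.repr x i) := by
  have h := Algebra.TensorProduct.basis_repr_tmul (A := Along φ) b 1 x
  rw [one_smul] at h
  exact DFunLike.congr_fun h i

variable [Fintype m] [DecidableEq m] [Fintype n] [DecidableEq n]

lemma toMatrix_map (φ : R →+* S) (b : Basis m R M) (c : Basis n R N) (f : M →ₗ[R] N) :
    LinearMap.toMatrix (basis φ b) (basis φ c) (map φ f) = (LinearMap.toMatrix b c f).map φ := by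
  ext i j
  rw [LinearMap.toMatrix_apply, basis_apply, map_mk, basis_repr_mk, Matrix.map_apply,
    LinearMap.toMatrix_apply]

/-- The canonical isomorphisms between iterated base changes match the induced bases, so they all
have matrix `1` and drop out of the matrix forms of the compatibilities below. -/
lemma toMatrix_eq_one (b : Basis m R M) (c : Basis m R N) (f : M →ₗ[R] N)
    (h : ∀ i, f (b i) = c i) : LinearMap.toMatrix b c f = 1 := by
  ext i j
  rw [LinearMap.toMatrix_apply, h, Basis.repr_self, Matrix.one_apply, Finsupp.single_apply]
  simp only [eq_comm]

lemma toMatrix_assoc (φ : R →+* S) (ψ : S →+* T) (χ : R →+* T) (h : ∀ r, ψ (φ r) = χ r)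
    (b : Basis m R M) : LinearMap.toMatrix (basis ψ (basis φ b)) (basis χ b)
      (assoc φ ψ χ h M).toLinearMap = 1 :=
  toMatrix_eq_one _ _ _ fun i => by simp

lemma toMatrix_assoc_symm (φ : R →+* S) (ψ : S →+* T) (χ : R →+* T) (h : ∀ r, ψ (φ r) = χ r)
    (b : Basis m R M) : LinearMap.toMatrix (basis χ b) (basis ψ (basis φ b))
      (assoc φ ψ χ h M).symm.toLinearMap = 1 :=
  toMatrix_eq_one _ _ _ fun i => by simp

lemma toMatrix_swap (φ : R →+* S) (ψ : S →+* T) (φ' : R →+* S') (ψ' : S' →+* T)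
    (h : ∀ r, ψ (φ r) = ψ' (φ' r)) (b : Basis m R M) :
    LinearMap.toMatrix (basis ψ (basis φ b)) (basis ψ' (basis φ' b))
      (swap φ ψ φ' ψ' h M).toLinearMap = 1 :=
  toMatrix_eq_one _ _ _ fun i => by simp

lemma toMatrix_cancel (φ : R →+* S) (ψ : S →+* R) (h : ∀ r, ψ (φ r) = r)
    (b : Basis m R M) : LinearMap.toMatrix (basis ψ (basis φ b)) b
      (cancel φ ψ h M).toLinearMap = 1 :=
  toMatrix_eq_one _ _ _ fun i => by simp

end BaseChange

open BaseChange Module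

variable {F : Type v} {K : Type u} [Field F] [Fintype F] [NormedField K] [IsUltrametricDist K]
  [Algebra F (OK K)] [CompleteSpace K] {P : Base F K}
variable {m n : Type*} [Fintype m] [DecidableEq m] [Fintype n] [DecidableEq n]

/-! ### The matrices of `F_M`, `δ_M` and the Hodge-Pink isomorphism. -/

namespace LocalShtuka

/-- The matrix of `F_M`. -/
noncomputable def frobMatrix (M : LocalShtuka P) (b : Basis m (OKz K) M.carrier) :
    Matrix m m (OKzInv P) :=
  LinearMap.toMatrix (basis (loc P) (basis (σA P) b)) (basis (loc P) b) M.frob.toLinearMap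

/-- The matrix of `F_M⁻¹`. -/
noncomputable def frobMatrixInv (M : LocalShtuka P) (b : Basis m (OKz K) M.carrier) :
    Matrix m m (OKzInv P) :=
  LinearMap.toMatrix (basis (loc P) b) (basis (loc P) (basis (σA P) b)) M.frob.symm.toLinearMap

lemma frobMatrix_mul_inv (M : LocalShtuka P) (b : Basis m (OKz K) M.carrier) :
    M.frobMatrix b * M.frobMatrixInv b = 1 := by
  rw [frobMatrix, frobMatrixInv, ← LinearMap.toMatrix_comp, LinearEquiv.comp_coe,
    LinearEquiv.symm_trans_self, LinearEquiv.refl_toLinearMap, LinearMap.toMatrix_id]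

variable {S : Type u} [CommRing S]

lemma toMatrix_frobOver (M : LocalShtuka P) (b : Basis m (OKz K) M.carrier)
    (ψ' : OKzInv P →+* S) (ψ : OKz K →+* S) (h : ∀ x, ψ' (loc P x) = ψ x) :
    LinearMap.toMatrix (basis ψ (basis (σA P) b)) (basis ψ b)
      (M.frobOver ψ' ψ h).toLinearMap = (M.frobMatrix b).map ψ' := by
  rw [frobOver, LinearEquiv.coe_trans, LinearEquiv.coe_trans,
    LinearMap.toMatrix_comp _ (basis ψ' (basis (loc P) b)),
    LinearMap.toMatrix_comp _ (basis ψ' (basis (loc P) (basis (σA P) b))),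
    toMatrix_assoc, toMatrix_assoc_symm, mapEquiv_toLinearMap, toMatrix_map, one_mul, mul_one]
  rfl

lemma toMatrix_frobOver_symm (M : LocalShtuka P) (b : Basis m (OKz K) M.carrier)
    (ψ' : OKzInv P →+* S) (ψ : OKz K →+* S) (h : ∀ x, ψ' (loc P x) = ψ x) :
    LinearMap.toMatrix (basis ψ b) (basis ψ (basis (σA P) b))
      (M.frobOver ψ' ψ h).symm.toLinearMap = (M.frobMatrixInv b).map ψ' := by
  have h1 : (M.frobOver ψ' ψ h).symm = (assoc (loc P) ψ' ψ h M.carrier).symm ≪≫ₗ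
      mapEquiv ψ' M.frob.symm ≪≫ₗ assoc (loc P) ψ' ψ h (BaseChange (σA P) M.carrier) := rfl
  rw [h1, LinearEquiv.coe_trans, LinearEquiv.coe_trans,
    LinearMap.toMatrix_comp _ (basis ψ' (basis (loc P) (basis (σA P) b))),
    LinearMap.toMatrix_comp _ (basis ψ' (basis (loc P) b)),
    toMatrix_assoc, toMatrix_assoc_symm, mapEquiv_toLinearMap, toMatrix_map, one_mul, mul_one]
  rfl

lemma toMatrix_frobD (M : LocalShtuka P) (b : Basis m (OKz K) M.carrier) :
    LinearMap.toMatrix (basis (σB P) (basis (redA P) b)) (basis (redA P) b)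
      M.frobD.toLinearMap = (M.frobMatrix b).map (redA' P) := by
  rw [frobD, LinearEquiv.coe_trans,
    LinearMap.toMatrix_comp _ (basis (redA P) (basis (σA P) b)), toMatrix_swap,
    toMatrix_frobOver, mul_one]

end LocalShtuka

namespace RigLocalShtuka

/-- The matrix of `δ_M`. -/
noncomputable def δMatrix (M : RigLocalShtuka P) (b : Basis m (OKz K) M.carrier) :
    Matrix m m (AnnulusT P) :=
  LinearMap.toMatrix (basis (ιA P) b) (basis (ιB P) (basis (redA P) b)) M.δ.toLinearMap

/-- The matrix of `δ_M⁻¹`. -/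
noncomputable def δMatrixInv (M : RigLocalShtuka P) (b : Basis m (OKz K) M.carrier) :
    Matrix m m (AnnulusT P) :=
  LinearMap.toMatrix (basis (ιB P) (basis (redA P) b)) (basis (ιA P) b) M.δ.symm.toLinearMap

variable (M : RigLocalShtuka P) (b : Basis m (OKz K) M.carrier)

lemma δMatrix_mul_inv : M.δMatrix b * M.δMatrixInv b = 1 := by
  rw [δMatrix, δMatrixInv, ← LinearMap.toMatrix_comp, LinearEquiv.comp_coe,
    LinearEquiv.symm_trans_self, LinearEquiv.refl_toLinearMap, LinearMap.toMatrix_id]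

/-- The relation `δ ∘ F_M = F_D ∘ σ^* δ` in coordinates; the matrix of `F_D` is that of `F_M`
reduced modulo the maximal ideal and carried back by the section `k → O_K`. -/
lemma δMatrix_mul_frobMatrix :
    M.δMatrix b * (M.frobMatrix b).map (ιA' P) =
      ((M.frobMatrix b).map (redA' P)).map (ιB P) * (M.δMatrix b).map (σT P) := by
  have h : M.δ.toLinearMap ∘ₗ (M.frobOver (ιA' P) (ιA P) (ιA'_loc P)).toLinearMap =
      (mapEquiv (ιB P) M.frobD).toLinearMap ∘ₗ
        (swap (ιB P) (σT P) (σB P) (ιB P) (σT_ιB P) M.D).toLinearMap ∘ₗ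
        (mapEquiv (σT P) M.δ).toLinearMap ∘ₗ
        (swap (σA P) (ιA P) (ιA P) (σT P) (fun x => (σT_ιA P x).symm) M.carrier).toLinearMap :=
    LinearMap.ext M.comm
  have h1 := congrArg (LinearMap.toMatrix (basis (ιA P) (basis (σA P) b))
    (basis (ιB P) (basis (redA P) b))) h
  rw [LinearMap.toMatrix_comp _ (basis (ιA P) b),
    LinearMap.toMatrix_comp _ (basis (ιB P) (basis (σB P) (basis (redA P) b))),
    LinearMap.toMatrix_comp _ (basis (σT P) (basis (ιB P) (basis (redA P) b))),
    LinearMap.toMatrix_comp _ (basis (σT P) (basis (ιA P) b)), toMatrix_swap, toMatrix_swap,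
    mapEquiv_toLinearMap, mapEquiv_toLinearMap, toMatrix_map, toMatrix_map,
    LocalShtuka.toMatrix_frobD, LocalShtuka.toMatrix_frobOver, mul_one, one_mul] at h1
  exact h1

lemma map_redT_δMatrix : (M.δMatrix b).map (redT P) = 1 := by
  have h : (cancel (ιB P) (redT P) (redT_ιB P) M.D).toLinearMap ∘ₗ
      (mapEquiv (redT P) M.δ).toLinearMap =
      (assoc (ιA P) (redT P) (redA P) (redT_ιA P) M.carrier).toLinearMap := LinearMap.ext M.red
  have h1 := congrArg (LinearMap.toMatrix (basis (redT P) (basis (ιA P) b))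
    (basis (redA P) b)) h
  rw [LinearMap.toMatrix_comp _ (basis (redT P) (basis (ιB P) (basis (redA P) b))),
    toMatrix_cancel, mapEquiv_toLinearMap, toMatrix_map, toMatrix_assoc, one_mul] at h1
  exact h1

/-- Since `evσ` applies `σ` before expanding at `ζ`, the matrix of `σ^* δ` over `K((z - ζ))` is the
image of that of `δ` under `evσ`. -/
lemma toMatrix_hodgePinkIso :
    LinearMap.toMatrix (basis (evA P) b) (basis (evB P) (basis (σB P) (basis (redA P) b)))
      M.hodgePinkIso.toLinearMap =
      (M.δMatrix b).map (evσ P) * (M.frobMatrixInv b).map (evA' P) := by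
  rw [hodgePinkIso, LinearEquiv.coe_trans, LinearEquiv.coe_trans, LinearEquiv.coe_trans,
    LinearMap.toMatrix_comp _ (basis (evσ P) (basis (ιB P) (basis (redA P) b))),
    LinearMap.toMatrix_comp _ (basis (evσ P) (basis (ιA P) b)),
    LinearMap.toMatrix_comp _ (basis (evA P) (basis (σA P) b)),
    toMatrix_swap, toMatrix_swap, mapEquiv_toLinearMap, toMatrix_map,
    LocalShtuka.toMatrix_frobOver_symm, one_mul, one_mul]
  rfl

/-- The coordinates of the elements of `M ⊗ K[[z - ζ]]` are power series. -/
lemma exists_repr_of_mem_lattice {M : Type u} [AddCommGroup M] [Module (OKz K) M]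
    (b : Basis m (OKz K) M) {x : BaseChange (evA P) M} (hx : x ∈ lattice P M) (i : m) :
    ∃ y : PowerSeries K, (basis (evA P) b).repr x i = HahnSeries.ofPowerSeries ℤ K y := by
  induction hx using Submodule.span_induction with
  | mem x hx =>
    obtain ⟨y, rfl⟩ := hx
    exact ⟨_, basis_repr_mk _ _ _ _⟩
  | zero => exact ⟨0, by simp⟩
  | add x y _ _ hx hy =>
    obtain ⟨x', hx⟩ := hx
    obtain ⟨y', hy⟩ := hy
    exact ⟨x' + y', by rw [map_add, Finsupp.add_apply, hx, hy, map_add]⟩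
  | smul a x _ hx =>
    obtain ⟨x', hx⟩ := hx
    refine ⟨a * x', ?_⟩
    rw [map_mul, ← hx]
    have h : (basis (evA P) b).repr (HahnSeries.ofPowerSeries ℤ K a • x) =
      HahnSeries.ofPowerSeries ℤ K a • (basis (evA P) b).repr x := map_smul _ _ _
    exact DFunLike.congr_fun h i

end RigLocalShtuka

end HodgePink

/-! ### Descent of Frobenius-equivariant matrices to `O_K[[z]][z⁻¹]`. -/

namespace HodgePink

variable {F : Type v} {K : Type u} [Field F] [Fintype F] [NormedField K] [IsUltrametricDist K]
  [Algebra F (OK K)] [CompleteSpace K] {P : Base F K}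

lemma algebraMap_annulusT_injective (P : Base F K) :
    Function.Injective (algebraMap (Annulus P) (AnnulusT P)) :=
  IsLocalization.injective _
    (Submonoid.powers_le.2 Annulus.t_mem_nonZeroDivisors)

lemma toAnnulus_injective (P : Base F K) : Function.Injective (toAnnulus P) := fun x y h => by
  ext i : 1
  rw [← Annulus.coeff_toAnnulus_natCast (P := P), h, Annulus.coeff_toAnnulus_natCast]

lemma ιA_injective (P : Base F K) : Function.Injective (ιA P) :=
  (algebraMap_annulusT_injective P).comp (toAnnulus_injective P)

/-- Allows the compatibility of a morphism with `F_M`, an identity over `O_K[[z]][1/(z - ζ)]`, to be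
checked over `O_K[[z, z⁻¹}[t⁻¹]`. -/
lemma ιA'_injective (P : Base F K) : Function.Injective (ιA' P) := by
  rw [injective_iff_map_eq_zero]
  intro x hx
  obtain ⟨⟨a, s⟩, h⟩ := IsLocalization.surj (Submonoid.powers (zSubζ P)) x
  have h1 := congrArg (ιA' P) h
  rw [map_mul, hx, zero_mul] at h1
  have h2 : ιA P a = 0 := (ιA'_loc P a).symm.trans h1.symm
  have h3 : a = 0 := ιA_injective P (h2.trans (map_zero _).symm)
  have h4 : IsUnit (algebraMap (OKz K) (OKzInv P) s) := IsLocalization.map_units _ s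
  rw [h3, map_zero] at h
  exact (h4.mul_left_eq_zero).1 h

section Matrix

variable {m n : Type*} [Finite m] [Finite n]

/-- The elements of a matrix over a localization `R[1/x]` have a common denominator. -/
lemma exists_pow_smul_eq_map {R S : Type*} [CommRing R] [CommRing S] [Algebra R S] (x : R)
    [IsLocalization.Away x S] (A : Matrix n m S) :
    ∃ (e : ℕ) (B : Matrix n m R), B.map (algebraMap R S) = algebraMap R S x ^ e • A := by
  obtain ⟨⟨_, e, rfl⟩, h⟩ := IsLocalization.exist_integer_multiples_of_finite
    (Submonoid.powers x) (fun ij : n × m => A ij.1 ij.2)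
  choose B hB using h
  refine ⟨e, Matrix.of fun i j => B (i, j), ?_⟩
  ext i j
  simpa [Algebra.smul_def] using hB (i, j)

variable {m n : Type*} [Fintype m] [Fintype n] [DecidableEq m] [DecidableEq n]

variable {e₁ e₂ : ℕ} {A : Matrix n n (OKzInv P)} {B : Matrix m m (OKzInv P)}
  {U : Matrix n n (OKz K)} {V : Matrix m m (OKz K)} {f : Matrix n m (AnnulusT P)}
  {Y : Matrix n m (PowerSeries K)} {s : Annulus P} {C : Matrix n m (Annulus P)}

/-- The images of `U σ(C) V`, where `U`, `V` and `C` are matrices `A`, `B` and `f` cleared of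
denominators. -/
lemma map_mul_σ_mul (hU : U.map (loc P) = loc P (zSubζ P) ^ e₁ • A)
    (hV : V.map (loc P) = loc P (zSubζ P) ^ e₂ • B)
    (hC : C.map (algebraMap _ (AnnulusT P)) = algebraMap _ (AnnulusT P) s • f)
    {S : Type u} [CommRing S] {ψ' : OKzInv P →+* S} {ψ : OKz K →+* S}
    (hψ : ∀ x, ψ' (loc P x) = ψ x) {χ : AnnulusT P →+* S} {θ : Annulus P →+* S}
    (hθ : ∀ x, θ (toAnnulus P x) = ψ x) (hχ : ∀ x, χ (algebraMap _ _ x) = θ (Annulus.σ x)) :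
    (U.map (toAnnulus P) * C.map Annulus.σ * V.map (toAnnulus P)).map θ =
      (ψ (zSubζ P) ^ (e₁ + e₂) * θ (Annulus.σ s)) • (A.map ψ' * f.map χ * B.map ψ') := by
  have h1 : (U.map (toAnnulus P)).map θ = ψ (zSubζ P) ^ e₁ • A.map ψ' := by
    ext i j
    have h := congrArg ψ' (congrFun (congrFun hU i) j)
    simpa [hθ, hψ] using h
  have h2 : (V.map (toAnnulus P)).map θ = ψ (zSubζ P) ^ e₂ • B.map ψ' := by
    ext i j
    have h := congrArg ψ' (congrFun (congrFun hV i) j)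
    simpa [hθ, hψ] using h
  have h3 : (C.map Annulus.σ).map θ = θ (Annulus.σ s) • f.map χ := by
    ext i j
    have h := congrArg χ (congrFun (congrFun hC i) j)
    simpa [hχ] using h
  rw [Matrix.map_mul, Matrix.map_mul, h1, h2, h3]
  simp only [Matrix.smul_mul, Matrix.mul_smul, smul_smul]
  congr 1
  ring

/-- One step of the descent: if `s f` is holomorphic for a Frobenius-equivariant matrix `f`
that is holomorphic at `z = ζ`, then `σ(s) f` is holomorphic. -/
lemma exists_map_eq_σ_smul (hU : U.map (loc P) = loc P (zSubζ P) ^ e₁ • A)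
    (hV : V.map (loc P) = loc P (zSubζ P) ^ e₂ • B)
    (hf : f = A.map (ιA' P) * f.map (σT P) * B.map (ιA' P))
    (hY : A.map (evA' P) * f.map (evσ P) * B.map (evA' P) = Y.map (HahnSeries.ofPowerSeries ℤ K))
    (hC : C.map (algebraMap _ (AnnulusT P)) = algebraMap _ (AnnulusT P) s • f) :
    ∃ D : Matrix n m (Annulus P),
      D.map (algebraMap _ (AnnulusT P)) = algebraMap _ (AnnulusT P) (Annulus.σ s) • f := by
  set Z : Matrix n m (Annulus P) := U.map (toAnnulus P) * C.map Annulus.σ * V.map (toAnnulus P)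
    with hZ
  -- The holomorphic matrix `Z` is read in two rings. Over `O_K[[z, z⁻¹}[t⁻¹]` the Frobenius
  -- equation gives `Z = (z - ζ)^{e₁+e₂} σ(s) f`. Over `K((z - ζ))`, where `f` itself cannot be
  -- evaluated because `t` vanishes at `ζ`, the hypothesis `hY` takes the place of regularity of `f`
  -- and shows that `Z` vanishes to order `e₁ + e₂`.
  have hT := map_mul_σ_mul hU hV hC (ιA'_loc P) (θ := algebraMap _ _) (fun _ => rfl)
    (σT_algebraMap P)
  rw [← hf, ← hZ] at hT
  have hE := map_mul_σ_mul hU hV hC (evA'_loc P) (θ := evL P) (fun _ => rfl) (evσ_algebraMap P)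
  rw [hY, ← hZ] at hE
  have hdvd : ∀ i j, PowerSeries.X ^ (e₁ + e₂) ∣ Annulus.ev (Z i j) := fun i j => by
    refine ⟨Annulus.ev (Annulus.σ s) * Y i j, HahnSeries.ofPowerSeries_injective (Γ := ℤ) ?_⟩
    have h := congrFun (congrFun hE i) j
    refine h.trans ?_
    rw [Matrix.smul_apply, smul_eq_mul, Matrix.map_apply, map_mul, map_mul, map_pow,
      ← Annulus.ev_zSubζ (P := P), mul_assoc]
    rfl
  choose D hD using fun i j => Annulus.exists_eq_zSubζ_pow_mul (e₁ + e₂) (hdvd i j)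
  refine ⟨Matrix.of D, ?_⟩
  ext i j
  have h := congrFun (congrFun hT i) j
  rw [Matrix.map_apply, hD, map_mul, map_pow, Matrix.smul_apply, smul_eq_mul, mul_assoc] at h
  exact ((isUnit_ιA_zSubζ P).pow _).mul_left_cancel h

/-- A matrix over `O_K[[z, z⁻¹}[t⁻¹]` that is compatible with Frobenius matrices and that is
holomorphic at `z = ζ` is defined over `O_K[[z]][z⁻¹]`. -/
theorem exists_map_ιA_eq_smul
    (hf : f = A.map (ιA' P) * f.map (σT P) * B.map (ιA' P))
    (hY : A.map (evA' P) * f.map (evσ P) * B.map (evA' P) =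
      Y.map (HahnSeries.ofPowerSeries ℤ K)) :
    ∃ (N : ℕ) (E : Matrix n m (OKz K)), E.map (ιA P) = ιA P PowerSeries.X ^ N • f := by
  obtain ⟨e₁, U, hU⟩ := exists_pow_smul_eq_map (S := OKzInv P) (zSubζ P) A
  obtain ⟨e₂, V, hV⟩ := exists_pow_smul_eq_map (S := OKzInv P) (zSubζ P) B
  obtain ⟨r, C₀, hC₀⟩ := exists_pow_smul_eq_map (S := AnnulusT P) (Annulus.t P) f
  have hinj := algebraMap_annulusT_injective P
  -- `τ k` is the tail `∏_{i ≥ k} (1 - ζ^{q^i}/z)` of the product for `t`.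
  let τ : ℕ → Annulus P := fun k => Annulus.σ^[k] (Annulus.t P)
  have hτ : ∀ k, τ k = (1 - Annulus.mono (-1) (P.ζ ^ Fintype.card F ^ k)) * τ (k + 1) := by
    intro k
    induction k with
    | zero => simpa [τ] using Annulus.t_eq (P := P)
    | succ k ih =>
      have h := congrArg Annulus.σ ih
      rw [map_mul, map_sub, map_one, Annulus.σ_mono, ← pow_mul, ← pow_succ] at h
      simpa only [τ, ← Function.iterate_succ_apply'] using h
  have hC : ∀ k, ∃ C : Matrix n m (Annulus P),
      C.map (algebraMap _ (AnnulusT P)) = algebraMap _ (AnnulusT P) (τ k ^ r) • f := by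
    intro k
    induction k with
    | zero => exact ⟨C₀, by rw [hC₀, map_pow]; rfl⟩
    | succ k ih =>
      obtain ⟨C, hC⟩ := ih
      obtain ⟨D, hD⟩ := exists_map_eq_σ_smul hU hV hf hY hC
      refine ⟨D, ?_⟩
      rw [hD, map_pow]
      simp only [τ, Function.iterate_succ_apply']
  choose C hC using hC
  -- The entries of `C k = τ(k)^r f` form a chain of successive quotients by `(1 - ζ^{q^k}/z)^r`, so
  -- `C 0 = t^r f` is divisible by `t^r`; the quotient is `f`.
  have hD : ∀ i j, ∃ d, C 0 i j = Annulus.t P ^ r * d := fun i j =>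
    Annulus.exists_eq_t_pow_mul r (fun k => C k i j) fun k => hinj <| by
      have h1 := congrFun (congrFun (hC k) i) j
      have h2 := congrFun (congrFun (hC (k + 1)) i) j
      rw [Matrix.map_apply, Matrix.smul_apply, smul_eq_mul] at h1 h2
      rw [h1, map_mul, h2, hτ k, mul_pow, map_mul, mul_assoc]
  choose d hd using hD
  have hdf : f = (Matrix.of d).map (algebraMap _ (AnnulusT P)) := by
    ext i j
    have h1 := congrFun (congrFun (hC 0) i) j
    rw [Matrix.map_apply, Matrix.smul_apply, smul_eq_mul, hd, map_mul] at h1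
    have h2 : IsUnit (algebraMap _ (AnnulusT P) (Annulus.t P ^ r)) := by
      rw [map_pow]
      exact (IsLocalization.Away.algebraMap_isUnit (S := AnnulusT P) (Annulus.t P)).pow r
    exact (h2.mul_left_cancel h1).symm
  have hfrob : toAnnulus P (zSubζ P) ^ (e₁ + e₂) • Matrix.of d =
      U.map (toAnnulus P) * (Matrix.of d).map Annulus.σ * V.map (toAnnulus P) := by
    -- Now that `f` is holomorphic, clearing denominators in its Frobenius equation needs only
    -- powers of `z - ζ`, whence `s = 1`.
    have h1 : (Matrix.of d).map (algebraMap _ (AnnulusT P)) =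
        algebraMap (Annulus P) (AnnulusT P) 1 • f := by
      rw [← hdf, map_one, one_smul]
    have h2 := map_mul_σ_mul hU hV h1 (ιA'_loc P) (θ := algebraMap _ _) (fun _ => rfl)
      (σT_algebraMap P)
    rw [← hf, map_one, map_one, mul_one, hdf] at h2
    refine Matrix.map_injective hinj (Eq.trans ?_ h2.symm)
    ext i j
    simp [ιA]
  obtain ⟨N, hN⟩ := Annulus.exists_coeff_eq_zero_of_frobenius _ _ _ _ hfrob
  have hX : ∀ k : ℕ, toAnnulus P PowerSeries.X ^ k = Annulus.mono k 1 := fun k => by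
    induction k with
    | zero => simp; rfl
    | succ k ih => rw [pow_succ, ih, toAnnulus_X, Annulus.mono_mul_mono]; simp
  -- The coefficients of index at most `N` vanish and `-|N| ≤ N`, so multiplication by `z^{|N|}`
  -- leaves no negative powers.
  refine ⟨N.natAbs, Matrix.of fun i j => PowerSeries.mk fun k => (d i j).coeff (k - N.natAbs), ?_⟩
  ext i j
  rw [Matrix.smul_apply, hdf, smul_eq_mul, ← map_pow, ιA, RingHom.comp_apply, map_pow, hX,
    Matrix.map_apply, Matrix.map_apply, RingHom.comp_apply, ← map_mul]
  congr 1
  ext k : 2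
  rw [mul_comm, Annulus.coeff_mul_mono, mul_one]
  rcases lt_or_ge k 0 with hk | hk
  · rw [Annulus.coeff_toAnnulus_of_neg _ hk]
    exact (hN i j _ (by omega)).symm
  · lift k to ℕ using hk
    rw [Annulus.coeff_toAnnulus_natCast]
    simp

end Matrix

end HodgePink

/-! ### Full faithfulness of `H` up to powers of `z`. -/

namespace HodgePink

open BaseChange CategoryTheory Module

variable {F : Type v} {K : Type u} [Field F] [Fintype F] [NormedField K] [IsUltrametricDist K]
  [Algebra F (OK K)] [CompleteSpace K] {P : Base F K}

lemma redA_X_pow (P : Base F K) (n : ℕ) :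
    redA P (PowerSeries.X ^ n) = HahnSeries.single (n : ℤ) 1 := by
  rw [map_pow, redA_X, HahnSeries.single_pow]
  simp

lemma ιB_single_one (P : Base F K) (n : ℕ) :
    ιB P (HahnSeries.single (n : ℤ) 1) = ιA P PowerSeries.X ^ n := by
  have h : (HahnSeries.single (n : ℤ) 1 : kz K) = HahnSeries.single 1 1 ^ n := by simp
  rw [h, map_pow, ιB, RingHom.comp_apply, ofkz_single, map_one, ιA, RingHom.comp_apply,
    toAnnulus_X]

namespace RigLocalShtuka

variable {M N : RigLocalShtuka P}

/-- After base change to `O_K[[z, z⁻¹}[t⁻¹]`, `f` equals `δ_N⁻¹ ∘ (f mod 𝔪) ∘ δ_M`, hence is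
determined by its reduction; injectivity of `ιA` on matrix entries then recovers `f`. -/
lemma H_map_injective {f g : M ⟶ N} (h : (H P).map f = (H P).map g) : f = g := by
  classical
  let b := Free.chooseBasis (OKz K) M.carrier
  let c := Free.chooseBasis (OKz K) N.carrier
  have h1 : map (redA P) f.toLin = map (redA P) g.toLin := congrArg HPIsocrystal.Hom.toLin h
  have h2 : map (ιA P) f.toLin = map (ιA P) g.toLin := LinearMap.ext fun x => N.δ.injective <| by
    rw [f.comm_δ, g.comm_δ, h1]
  have h3 := congrArg (LinearMap.toMatrix (basis (ιA P) b) (basis (ιA P) c)) h2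
  rw [toMatrix_map, toMatrix_map] at h3
  have h4 := (LinearMap.toMatrix b c).injective (Matrix.map_injective (ιA_injective P) h3)
  obtain ⟨⟨f, _⟩, _⟩ := f
  obtain ⟨⟨g, _⟩, _⟩ := g
  cases h4
  rfl

section Matrix

variable {m n : Type*} [Fintype m] [DecidableEq m] [Fintype n] [DecidableEq n]
  (b : Basis m (OKz K) M.carrier) (c : Basis n (OKz K) N.carrier) (G : Matrix n m (kz K))

/-- The matrix of `δ_N⁻¹ ∘ g ∘ δ_M`, where `g : D_M → D_N` has the matrix `G`. -/
noncomputable def δConj : Matrix n m (AnnulusT P) :=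
  N.δMatrixInv c * (G.map (ιB P) * M.δMatrix b)

lemma δMatrix_mul_δConj : N.δMatrix c * δConj b c G = G.map (ιB P) * M.δMatrix b := by
  rw [δConj, ← Matrix.mul_assoc, δMatrix_mul_inv, Matrix.one_mul]

lemma δMatrixInv_mul : N.δMatrixInv c * N.δMatrix c = 1 :=
  mul_eq_one_comm.1 (N.δMatrix_mul_inv c)

/-- Both rigidifications reduce to the identity. This is what makes the lifted morphism reduce to a
multiple of the given `g`. -/
lemma map_redT_δConj : (δConj b c G).map (redT P) = G := by
  have h := congrArg (fun A => A.map (redT P)) (δMatrix_mul_δConj b c G)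
  simp only [Matrix.map_mul, map_redT_δMatrix, Matrix.one_mul, Matrix.mul_one] at h
  rw [h]
  exact Matrix.ext fun i j => redT_ιB P _

variable {G}

/-- Each of `δ_M`, `g` and `δ_N` commutes with Frobenius, hence so does `δ_N⁻¹ ∘ g ∘ δ_M`. To avoid
a separate relation for `δ_N⁻¹`, the equality is checked after multiplication by the invertible
matrix of `δ_N`. -/
lemma δConj_mul_frobMatrix
    (hG : (N.frobMatrix c).map (redA' P) * G.map (σB P) = G * (M.frobMatrix b).map (redA' P)) :
    δConj b c G * (M.frobMatrix b).map (ιA' P) =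
      (N.frobMatrix c).map (ιA' P) * (δConj b c G).map (σT P) := by
  have h0 : (G.map (σB P)).map (ιB P) = (G.map (ιB P)).map (σT P) :=
    Matrix.ext fun i j => (σT_ιB P _).symm
  have h1 : N.δMatrix c * (δConj b c G * (M.frobMatrix b).map (ιA' P)) =
      N.δMatrix c * ((N.frobMatrix c).map (ιA' P) * (δConj b c G).map (σT P)) := by
    calc _ = G.map (ιB P) * (((M.frobMatrix b).map (redA' P)).map (ιB P) *
          (M.δMatrix b).map (σT P)) := by
          rw [← Matrix.mul_assoc, δMatrix_mul_δConj, Matrix.mul_assoc, δMatrix_mul_frobMatrix]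
      _ = ((N.frobMatrix c).map (redA' P)).map (ιB P) *
          (N.δMatrix c * δConj b c G).map (σT P) := by
          rw [δMatrix_mul_δConj, Matrix.map_mul, ← h0, ← Matrix.mul_assoc, ← Matrix.mul_assoc,
            ← Matrix.map_mul, ← Matrix.map_mul, hG]
      _ = _ := by
          rw [Matrix.map_mul, ← Matrix.mul_assoc, ← Matrix.mul_assoc, δMatrix_mul_frobMatrix]
  have h2 := congrArg (N.δMatrixInv c * ·) h1
  simpa only [← Matrix.mul_assoc, δMatrixInv_mul, Matrix.one_mul] using h2

lemma δConj_eq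
    (hG : (N.frobMatrix c).map (redA' P) * G.map (σB P) = G * (M.frobMatrix b).map (redA' P)) :
    δConj b c G = (N.frobMatrix c).map (ιA' P) * (δConj b c G).map (σT P) *
      (M.frobMatrixInv b).map (ιA' P) := by
  have hinv : (M.frobMatrix b).map (ιA' P) * (M.frobMatrixInv b).map (ιA' P) = 1 := by
    rw [← Matrix.map_mul, M.frobMatrix_mul_inv, Matrix.map_one _ (map_zero _) (map_one _)]
  rw [← δConj_mul_frobMatrix b c hG, Matrix.mul_assoc, hinv, Matrix.mul_one]

set_option maxRecDepth 2000 in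
/-- The matrix of the map `M ⊗ K((z - ζ)) → N ⊗ K((z - ζ))` induced by `g : D_M → D_N`. -/
lemma toMatrix_hodgePinkIso_conj (g : M.D →ₗ[kz K] N.D) :
    LinearMap.toMatrix (basis (evA P) b) (basis (evA P) c) (N.hodgePinkIso.symm.toLinearMap ∘ₗ
      map (evB P) (map (σB P) g) ∘ₗ M.hodgePinkIso.toLinearMap) =
    (N.frobMatrix c).map (evA' P) *
      (δConj b c (LinearMap.toMatrix (basis (redA P) b) (basis (redA P) c) g)).map (evσ P) *
      (M.frobMatrixInv b).map (evA' P) := by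
  set L := N.hodgePinkIso.symm.toLinearMap ∘ₗ map (evB P) (map (σB P) g) ∘ₗ
    M.hodgePinkIso.toLinearMap with hL
  set G := LinearMap.toMatrix (basis (redA P) b) (basis (redA P) c) g with hG
  have h1 : N.hodgePinkIso.toLinearMap ∘ₗ L =
      map (evB P) (map (σB P) g) ∘ₗ M.hodgePinkIso.toLinearMap :=
    LinearMap.ext fun x => N.hodgePinkIso.apply_symm_apply _
  have h5 : LinearMap.toMatrix (basis (evB P) (basis (σB P) (basis (redA P) b)))
      (basis (evB P) (basis (σB P) (basis (redA P) c))) (map (evB P) (map (σB P) g)) =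
      (G.map (σB P)).map (evB P) :=
    (toMatrix_map (evB P) _ _ _).trans
      (congrArg (fun A => Matrix.map A (evB P)) (toMatrix_map (σB P) _ _ g))
  have h2 : (N.δMatrix c).map (evσ P) * (N.frobMatrixInv c).map (evA' P) *
      LinearMap.toMatrix (basis (evA P) b) (basis (evA P) c) L =
      (G.map (σB P)).map (evB P) *
        ((M.δMatrix b).map (evσ P) * (M.frobMatrixInv b).map (evA' P)) := by
    rw [← toMatrix_hodgePinkIso, ← toMatrix_hodgePinkIso, ← h5]
    exact (LinearMap.toMatrix_comp _ _ _ _ _).symm.trans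
      ((congrArg (LinearMap.toMatrix _ _) h1).trans (LinearMap.toMatrix_comp _ _ _ _ _))
  have h3 : (G.map (σB P)).map (evB P) = (G.map (ιB P)).map (evσ P) :=
    Matrix.ext fun i j => (evσ_ιB P _).symm
  -- The Hodge-Pink isomorphism of `N` is `σ^* δ_N ∘ F_N⁻¹`, so `F_N ∘ σ^* δ_N⁻¹` cancels it on the
  -- left and isolates the matrix of `L`.
  have h4 : (N.frobMatrix c).map (evA' P) * (N.δMatrixInv c).map (evσ P) *
      ((N.δMatrix c).map (evσ P) * (N.frobMatrixInv c).map (evA' P)) = 1 := by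
    rw [Matrix.mul_assoc, ← Matrix.mul_assoc ((N.δMatrixInv c).map (evσ P)),
      ← Matrix.map_mul, δMatrixInv_mul, Matrix.map_one _ (map_zero _) (map_one _), Matrix.one_mul,
      ← Matrix.map_mul, N.frobMatrix_mul_inv, Matrix.map_one _ (map_zero _) (map_one _)]
  rw [← Matrix.one_mul (LinearMap.toMatrix (basis (evA P) b) (basis (evA P) c) L), ← h4,
    Matrix.mul_assoc, h2, h3, δConj, Matrix.map_mul, Matrix.map_mul]
  simp only [Matrix.mul_assoc]

set_option maxRecDepth 2000 in
-- The lattices `q` are the images of `M ⊗ K[[z - ζ]]` and `N ⊗ K[[z - ζ]]` under the Hodge-Pink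
-- isomorphisms. Transported back through these, `g(q_M) ⊂ q_N` says that a map `M ⊗ K((z - ζ)) → N
-- ⊗ K((z - ζ))` preserves the standard lattices, so its matrix has power series entries.
lemma exists_evσ_δConj_eq (g : (H P).obj M ⟶ (H P).obj N) :
    ∃ Y : Matrix n m (PowerSeries K), (N.frobMatrix c).map (evA' P) *
      (δConj b c (LinearMap.toMatrix (basis (redA P) b) (basis (redA P) c)
        (HPIsocrystal.Hom.toLin g))).map (evσ P) *
      (M.frobMatrixInv b).map (evA' P) = Y.map (HahnSeries.ofPowerSeries ℤ K) := by
  have hmem : ∀ x ∈ lattice P M.carrier, (N.hodgePinkIso.symm.toLinearMap ∘ₗ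
      map (evB P) (map (σB P) (HPIsocrystal.Hom.toLin g)) ∘ₗ M.hodgePinkIso.toLinearMap) x ∈
      lattice P N.carrier := fun x hx => by
    obtain ⟨y, hy, hyx⟩ := HPIsocrystal.Hom.map_q g _ ⟨x, hx, rfl⟩
    have h1 := (N.hodgePinkIso.symm_apply_eq).2 hyx.symm
    rw [← h1] at hy
    exact hy
  choose Y hY using fun i j => exists_repr_of_mem_lattice c
    (hmem _ (Submodule.subset_span ⟨b j, rfl⟩)) i
  refine ⟨Matrix.of Y, (toMatrix_hodgePinkIso_conj b c _).symm.trans (Matrix.ext fun i j => ?_)⟩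
  refine (LinearMap.toMatrix_apply (basis (evA P) b) (basis (evA P) c) _ i j).trans ?_
  exact (congrArg (fun x => (basis (evA P) c).repr ((N.hodgePinkIso.symm.toLinearMap ∘ₗ
    map (evB P) (map (σB P) (HPIsocrystal.Hom.toLin g)) ∘ₗ M.hodgePinkIso.toLinearMap) x) i)
    (basis_apply (evA P) b j)).trans (hY i j)

lemma map_redA_eq {E : Matrix n m (OKz K)} {r : ℕ}
    (hE : E.map (ιA P) = ιA P PowerSeries.X ^ r • δConj b c G) :
    E.map (redA P) = (HahnSeries.single (r : ℤ) 1 : kz K) • G := by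
  have h1 : E.map (redA P) = (E.map (ιA P)).map (redT P) :=
    Matrix.ext fun i j => (redT_ιA P _).symm
  have h2 : (δConj b c G).map (redT P) = G := map_redT_δConj b c G
  rw [h1, hE]
  refine Matrix.ext fun i j => ?_
  conv_rhs => rw [← h2]
  rw [Matrix.map_apply, Matrix.smul_apply, smul_eq_mul, map_mul, ← map_pow, redT_ιA, redA_X_pow]
  rfl

/-- A multiple `z^r δ_N⁻¹ ∘ g ∘ δ_M` that is defined over `O_K[[z]]` is a morphism. -/
lemma exists_toLin_eq {E : Matrix n m (OKz K)} {r : ℕ}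
    (hG : (N.frobMatrix c).map (redA' P) * G.map (σB P) = G * (M.frobMatrix b).map (redA' P))
    (hE : E.map (ιA P) = ιA P PowerSeries.X ^ r • δConj b c G) :
    ∃ f : M ⟶ N, LinearMap.toMatrix b c f.toLin = E := by
  set l : M.carrier →ₗ[OKz K] N.carrier := (LinearMap.toMatrix b c).symm E
  have hl : LinearMap.toMatrix b c l = E := LinearEquiv.apply_symm_apply _ _
  refine ⟨⟨⟨l, ?_⟩, ?_⟩, hl⟩
  · have h : N.frob.toLinearMap ∘ₗ map (loc P) (map (σA P) l) =
        map (loc P) l ∘ₗ M.frob.toLinearMap := by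
      refine (LinearMap.toMatrix (basis (loc P) (basis (σA P) b)) (basis (loc P) c)).injective ?_
      rw [LinearMap.toMatrix_comp _ (basis (loc P) (basis (σA P) c)),
        LinearMap.toMatrix_comp _ (basis (loc P) b), toMatrix_map, toMatrix_map, toMatrix_map, hl,
        ← LocalShtuka.frobMatrix, ← LocalShtuka.frobMatrix]
      refine Matrix.map_injective (ιA'_injective P) ?_
      -- Frobenius fixes `z`, so the same factor `z^r` appears on both sides and the identity
      -- reduces to the equivariance of `δConj`.
      have h1 : ((E.map (σA P)).map (loc P)).map (ιA' P) =
          ιA P PowerSeries.X ^ r • (δConj b c G).map (σT P) := by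
        have h2 : ((E.map (σA P)).map (loc P)).map (ιA' P) = (E.map (ιA P)).map (σT P) :=
          Matrix.ext fun i j => (ιA'_loc P _).trans (σT_ιA P _).symm
        rw [h2, hE]
        refine Matrix.ext fun i j => ?_
        simp [σT_ιA, σA]
      have h3 : (E.map (loc P)).map (ιA' P) = ιA P PowerSeries.X ^ r • δConj b c G := by
        rw [← hE]
        exact Matrix.ext fun i j => ιA'_loc P _
      dsimp only
      rw [Matrix.map_mul, Matrix.map_mul, h1, h3, Matrix.mul_smul, Matrix.smul_mul,
        δConj_mul_frobMatrix b c hG]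
    exact LinearMap.congr_fun h
  · have h : N.δ.toLinearMap ∘ₗ map (ιA P) l =
        map (ιB P) (map (redA P) l) ∘ₗ M.δ.toLinearMap := by
      refine (LinearMap.toMatrix (basis (ιA P) b)
        (basis (ιB P) (basis (redA P) c))).injective ?_
      -- The matrix `E` reduces to `z^r G`, hence compatibility with the rigidifications is `z^r`
      -- times the defining property of `δConj`.
      have h1 : (E.map (redA P)).map (ιB P) = ιA P PowerSeries.X ^ r • G.map (ιB P) := by
        rw [map_redA_eq b c hE, ← ιB_single_one]
        exact Matrix.ext fun i j => map_mul (ιB P) _ _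
      rw [LinearMap.toMatrix_comp _ (basis (ιA P) c),
        LinearMap.toMatrix_comp _ (basis (ιB P) (basis (redA P) b)), toMatrix_map, toMatrix_map,
        toMatrix_map, hl, hE, ← δMatrix, ← δMatrix, h1, Matrix.mul_smul, Matrix.smul_mul,
        δMatrix_mul_δConj]
    exact LinearMap.congr_fun h

end Matrix

/-- A morphism of Hodge-Pink structures between the images of two rigidified local shtukas comes,
after multiplication by a power of `z`, from a morphism of rigidified local shtukas. -/
theorem exists_H_map_eq_zsmul (g : (H P).obj M ⟶ (H P).obj N) :
    ∃ (r : ℕ) (f : M ⟶ N), (H P).map f = HPIsocrystal.Hom.zsmul g r := by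
  classical
  let b := Free.chooseBasis (OKz K) M.carrier
  let c := Free.chooseBasis (OKz K) N.carrier
  let gl : M.D →ₗ[kz K] N.D := HPIsocrystal.Hom.toLin g
  have hg : (N.frobMatrix c).map (redA' P) *
      (LinearMap.toMatrix (basis (redA P) b) (basis (redA P) c) gl).map (σB P) =
      LinearMap.toMatrix (basis (redA P) b) (basis (redA P) c) gl *
        (M.frobMatrix b).map (redA' P) := by
    have h : N.frobD.toLinearMap ∘ₗ map (σB P) gl = gl ∘ₗ M.frobD.toLinearMap :=
      LinearMap.ext (HPIsocrystal.Hom.comm g)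
    have h1 := congrArg (LinearMap.toMatrix (basis (σB P) (basis (redA P) b))
      (basis (redA P) c)) h
    rwa [LinearMap.toMatrix_comp _ (basis (σB P) (basis (redA P) c)),
      LinearMap.toMatrix_comp _ (basis (redA P) b), toMatrix_map,
      LocalShtuka.toMatrix_frobD, LocalShtuka.toMatrix_frobD] at h1
  obtain ⟨Y, hY⟩ := exists_evσ_δConj_eq b c g
  obtain ⟨r, E, hE⟩ := exists_map_ιA_eq_smul (δConj_eq b c hg) hY
  obtain ⟨f, hf⟩ := exists_toLin_eq b c hg hE
  have hfg : map (redA P) f.toLin = (HahnSeries.single (r : ℤ) 1 : kz K) • gl := by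
    refine (LinearMap.toMatrix (basis (redA P) b) (basis (redA P) c)).injective ?_
    rw [toMatrix_map, hf, map_redA_eq b c hE, map_smul]
  exact ⟨r, f, HPIsocrystal.Hom.ext hfg⟩

/-! ### Passage to the category up to isogeny. -/

/-- Multiplication by `z^n`. -/
noncomputable def zPow (M : RigLocalShtuka P) (n : ℕ) : M ⟶ M :=
  { toLin := (PowerSeries.X : OKz K) ^ n • LinearMap.id
    comm := fun x => by
      rw [map_smul', map_smul', map_smul', BaseChange.map_id, BaseChange.map_id,
        BaseChange.map_id, LinearMap.smul_apply,
        LinearMap.smul_apply, LinearMap.id_apply, LinearMap.id_apply, map_smul]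
      simp [σA]
    comm_δ := fun x => by
      rw [map_smul', map_smul', map_smul', BaseChange.map_id, BaseChange.map_id,
        BaseChange.map_id, LinearMap.smul_apply,
        LinearMap.smul_apply, LinearMap.id_apply, LinearMap.id_apply, map_smul, redA_X_pow,
        ιB_single_one, map_pow] : Hom M M }

@[simp] lemma zPow_toLin (M : RigLocalShtuka P) (n : ℕ) :
    (zPow M n).toLin = (PowerSeries.X : OKz K) ^ n • LinearMap.id := rfl

lemma hom_ext_toLin {f g : M ⟶ N} (h : f.toLin = g.toLin) : f = g := by
  obtain ⟨⟨f, _⟩, _⟩ := f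
  obtain ⟨⟨g, _⟩, _⟩ := g
  cases h
  rfl

lemma zPow_comp (f : M ⟶ N) (n : ℕ) : zPow M n ≫ f = f ≫ zPow N n :=
  hom_ext_toLin <| by
    rw [comp_toLin, comp_toLin, zPow_toLin, zPow_toLin, LinearMap.comp_smul, LinearMap.smul_comp]
    rfl

lemma zPow_comp_zPow (M : RigLocalShtuka P) (n k : ℕ) : zPow M n ≫ zPow M k = zPow M (n + k) :=
  hom_ext_toLin <| by
    rw [comp_toLin, zPow_toLin, zPow_toLin, zPow_toLin, LinearMap.comp_smul, LinearMap.smul_comp,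
      smul_smul, pow_add, mul_comm]
    rfl

lemma zPow_zero_comp (f : M ⟶ N) : zPow M 0 ≫ f = f :=
  hom_ext_toLin (by simp)

lemma isogeny_zPow (M : RigLocalShtuka P) (n : ℕ) : isogeny P (zPow M n) :=
  ⟨𝟙 M, n, by simp, by simp⟩

lemma H_map_zPow_comp (n : ℕ) (g : (H P).obj M ⟶ (H P).obj N) :
    (H P).map (zPow M n) ≫ g = HPIsocrystal.Hom.zsmul g n := by
  refine HPIsocrystal.Hom.ext ?_
  have h : HPIsocrystal.Hom.toLin ((H P).map (zPow M n)) =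
      (HahnSeries.single (n : ℤ) 1 : kz K) • LinearMap.id := by
    refine (map_smul' (redA P) _ _).trans ?_
    rw [redA_X_pow, BaseChange.map_id]
    rfl
  rw [HPIsocrystal.comp_toLin, h, LinearMap.comp_smul]
  rfl

/-- Powers of `z` commute with every morphism of rigidified local shtukas, so the denominator of the
second factor can be moved past the numerator of the first, and denominators add. -/
lemma Q_map_zPow_comp_comp {L : RigLocalShtuka P} {n k : ℕ}
    {f : (isogeny P).Q.obj M ⟶ (isogeny P).Q.obj N} {f' : M ⟶ N}
    (hf : (isogeny P).Q.map (zPow M n) ≫ f = (isogeny P).Q.map f')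
    {g : (isogeny P).Q.obj N ⟶ (isogeny P).Q.obj L} {g' : N ⟶ L}
    (hg : (isogeny P).Q.map (zPow N k) ≫ g = (isogeny P).Q.map g') :
    (isogeny P).Q.map (zPow M (k + n)) ≫ f ≫ g = (isogeny P).Q.map (f' ≫ g') := by
  rw [← zPow_comp_zPow, Functor.map_comp, Functor.map_comp, ← hg, Category.assoc,
    ← Category.assoc _ f g, hf, ← Category.assoc, ← Category.assoc, ← Functor.map_comp,
    ← Functor.map_comp, zPow_comp]

/-- If `g` is a quasi-inverse of the isogeny `w`, with `g ≫ w` equal to `z^n`, then `z^n` followed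
by the formal inverse of `w` is `g`. -/
lemma Q_map_zPow_comp_wInv {w : M ⟶ N} (hw : isogeny P w) : ∃ (n : ℕ) (g : N ⟶ M),
    (isogeny P).Q.map (zPow N n) ≫ Localization.Construction.wInv w hw =
      (isogeny P).Q.map g := by
  obtain ⟨g, n, -, h2⟩ := id hw
  refine ⟨n, g, ?_⟩
  have h3 : zPow N n = g ≫ w := hom_ext_toLin h2.symm
  have h4 := (Localization.Construction.wIso w hw).hom_inv_id
  rw [h3, Functor.map_comp, Category.assoc]
  exact (congrArg _ h4).trans (Category.comp_id _)

/-- Every morphism up to isogeny is a morphism divided by a power of `z`. -/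
lemma exists_zPow_comp_eq (f : (isogeny P).Q.obj M ⟶ (isogeny P).Q.obj N) :
    ∃ (n : ℕ) (h : M ⟶ N), (isogeny P).Q.map (zPow M n) ≫ f = (isogeny P).Q.map h := by
  -- Morphisms of the localization are generated under composition by images of morphisms and formal
  -- inverses of isogenies. The property of having a power of `z` as denominator holds for both
  -- kinds and is stable under composition, so it holds for all.
  let Pr : MorphismProperty (isogeny P).Localization := fun X Y f =>
    ∃ (n : ℕ) (h : X.as.obj ⟶ Y.as.obj),
      (isogeny P).Q.map (zPow X.as.obj n) ≫ f = (isogeny P).Q.map h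
  have : Pr.IsStableUnderComposition := ⟨fun _ _ ⟨_, _, hf⟩ ⟨_, _, hg⟩ =>
    ⟨_, _, Q_map_zPow_comp_comp hf hg⟩⟩
  have hPr : Pr = ⊤ := Localization.Construction.morphismProperty_eq_top Pr
    (fun X Y f => ⟨0, f, (Functor.map_comp _ _ _).symm.trans
      (congrArg _ (zPow_zero_comp f))⟩)
    (fun X Y w hw => Q_map_zPow_comp_wInv hw)
  have h : Pr f := by rw [hPr]; trivial
  exact h

lemma isIso_Q_map_zPow (M : RigLocalShtuka P) (n : ℕ) :
    IsIso ((isogeny P).Q.map (zPow M n)) :=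
  (isogeny P).Q_inverts _ (isogeny_zPow M n)

lemma HUpToIsogeny_map_Q (f : M ⟶ N) :
    (HUpToIsogeny P).map ((isogeny P).Q.map f) = (H P).map f :=
  (Functor.congr_hom (Localization.Construction.fac (H P) isogeny_isInvertedBy) f).trans
    ((Category.id_comp _).trans (Category.comp_id _))

/-- Some `z^r g` is the image of an honest morphism, and multiplication by `z^r` on `M` is
invertible after localization. -/
lemma exists_HUpToIsogeny_map_eq (g : (H P).obj M ⟶ (H P).obj N) :
    ∃ f : (isogeny P).Q.obj M ⟶ (isogeny P).Q.obj N, (HUpToIsogeny P).map f = g := by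
  obtain ⟨r, f, hf⟩ := exists_H_map_eq_zsmul g
  have := isIso_Q_map_zPow M r
  refine ⟨inv ((isogeny P).Q.map (zPow M r)) ≫ (isogeny P).Q.map f, ?_⟩
  rw [Functor.map_comp, Functor.map_inv]
  refine (IsIso.inv_comp_eq _).2 ?_
  rw [HUpToIsogeny_map_Q, HUpToIsogeny_map_Q, hf]
  exact (H_map_zPow_comp r g).symm

/-- Two morphisms up to isogeny acquire the common denominator `z^{k+n}`; their numerators have
equal images under `H`, hence are equal, and the denominator is invertible. -/
lemma HUpToIsogeny_map_injective {f g : (isogeny P).Q.obj M ⟶ (isogeny P).Q.obj N}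
    (h : (HUpToIsogeny P).map f = (HUpToIsogeny P).map g) : f = g := by
  obtain ⟨n, f', hf⟩ := exists_zPow_comp_eq f
  obtain ⟨k, g', hg⟩ := exists_zPow_comp_eq g
  have h1 : (isogeny P).Q.map (zPow M (k + n)) ≫ f = (isogeny P).Q.map (zPow M k ≫ f') := by
    rw [← zPow_comp_zPow, Functor.map_comp, Category.assoc, hf, ← Functor.map_comp]
  have h2 : (isogeny P).Q.map (zPow M (k + n)) ≫ g = (isogeny P).Q.map (zPow M n ≫ g') := by
    rw [add_comm, ← zPow_comp_zPow, Functor.map_comp, Category.assoc, hg, ← Functor.map_comp]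
  have h3 : zPow M k ≫ f' = zPow M n ≫ g' := H_map_injective <| by
    refine (HUpToIsogeny_map_Q _).symm.trans (Eq.trans ?_ (HUpToIsogeny_map_Q _))
    rw [← h1, ← h2, Functor.map_comp, Functor.map_comp, h]
  have := isIso_Q_map_zPow M (k + n)
  rw [← cancel_epi ((isogeny P).Q.map (zPow M (k + n))), h1, h2, h3]

theorem full_HUpToIsogeny (P : Base F K) : (HUpToIsogeny P).Full where
  -- Every object of the localization is, by construction, the image of the object `X.as.obj`, so
  -- the statements for images of objects cover all cases.
  map_surjective {X Y} g := exists_HUpToIsogeny_map_eq (M := X.as.obj) (N := Y.as.obj) g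

theorem faithful_HUpToIsogeny (P : Base F K) : (HUpToIsogeny P).Faithful where
  map_injective {X Y} _ _ h := HUpToIsogeny_map_injective (M := X.as.obj) (N := Y.as.obj) h

end RigLocalShtuka

end HodgePink

/-- The functor `H` from rigidified local shtukas over `O_K` up to isogeny to `z`-isocrystals with
Hodge-Pink structure over `K` is fully faithful. -/
theorem mainTheorem12 {F : Type v} {K : Type u} [Field F] [Fintype F] [NormedField K]
    [IsUltrametricDist K] [CompleteSpace K] [Algebra F (HodgePink.OK K)]
    (P : HodgePink.Base F K) :
    (HodgePink.HUpToIsogeny P).Full ∧ (HodgePink.HUpToIsogeny P).Faithful :=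
  ⟨HodgePink.RigLocalShtuka.full_HUpToIsogeny P, HodgePink.RigLocalShtuka.faithful_HUpToIsogeny P⟩
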